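/- A graded algebra is a commutative $\mathbb{C}$-algebra $A=\bigoplus_{i\ge 0}A_i$ with $A_iA_j\subset A_{i+j}$ and $A_0=\mathbb{C}1\neq 0$. A homogeneous presentation of $A$ consists of a polynomial ring $\mathbb{C}[\vec x]=\mathbb{C}[x_1,\dots,x_n]$ with $\deg x_i>0$, homogeneous $f_1,\dots,f_m\in\mathbb{C}[\vec x]$, and a homomorphism of graded algebras $\varphi:\mathbb{C}[\vec x]\to A$. It is a homogeneous Koszul resolution if the Koszul dg algebra $K(\mathbb{C}[\vec x],\vec f)=\mathbb{C}[\vec x,\xi_1,\dots,\xi_m]$ ($\xi_i$ odd of cohomological degree $-1$, $\partial=\sum_i f_i\partial_{\xi_i}$) maps quasi-isomorphically to $A$ (with zero differential) by $\varphi$ and $\xi_i\mapsto 0$. A presentation is minimal if the $\varphi(x_i)$ are a minimal generating set of $A_>=\bigoplus_{i\ge 1}A_i$ over $A$ and the $f_j$ are a minimal generating set of $\ker\varphi$ over $\mathbb{C}[\vec x]$; here homogeneous elements of a homogeneous ideal $I$ of a graded algebra $R$ are a minimal generating set if their classes form a $\mathbb{C}$-basis of $I/R_>I$. The chiral Koszul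 complex $D^{ch}(K(\mathbb{C}[\vec x],\vec f))$ is the following dg vertex algebra (parity is cohomological degree mod $2$). As a space it is the polynomial superalgebra in the jet variables $u^{(k)}$, $k\ge0$, with $u$ one of $x_i,\partial_{x_i}$ (even, degree $0$), $\xi_i$ (odd, degree $-1$), $\partial_{\xi_i}$ (odd, degree $1$). The vacuum is $1$, $u_{(-k-1)}$ is multiplication by $u^{(k)}$, translation is the derivation $Tu^{(k)}=(k+1)u^{(k+1)}$, and for $k\ge0$ one has $(\partial_{x_i})_{(k)}=\partial/\partial x_i^{(k)}$, $(x_i)_{(k)}=-\partial/\partial(\partial_{x_i})^{(k)}$, $(\partial_{\xi_i})_{(k)}=\partial/\partial\xi_i^{(k)}$, $(\xi_i)_{(k)}=\partial/\partial(\partial_{\xi_i})^{(k)}$; the field of a monomial is the normally ordered product of the fields of its factors. The differential is $\big(\sum_i (f_i)_{(-1)}\partial_{\xi_i}\big)_{(0)}$. Two dg vertex algebras are quasi-isomorphic if they are joined by a finite zigzag of quasi-isomorphisms of dg vertex algebras. **Theorem.** Let $A$ be a graded algebra with two homogeneous Koszul resolutions $K=K(\mathbb{C}[\vec x],\vec f)\to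 A\leftarrow L=K(\mathbb{C}[\vec y],\vec g)$ (so $A$ is a graded complete intersection). Then: 1. $D^{ch}(K)$ and $D^{ch}(L)$ are dg vertex algebras, and they are quasi-isomorphic. 2. $A$ has a minimal presentation that is a Koszul resolution. For every minimal presentation of $A$, with Koszul complex $M$, $D^{ch}(M)$ is a dg vertex algebra, and for each $U\in\{K,L\}$ there are a quasi-isomorphism of dg vertex algebras $\iota:D^{ch}(M)\to D^{ch}(U)$ and a quasi-isomorphism of complexes $\pi:D^{ch}(U)\to D^{ch}(M)$ of degree $0$, such that $\pi\circ\iota=\mathrm{id}$, $\pi T=T\pi$, and $\pi(\iota(a)_{(n)}v)=a_{(n)}\pi(v)$ for all $a\in D^{ch}(M)$, $v\in D^{ch}(U)$, $n\in\mathbb{Z}$. 3. Any two minimal presentations of $A$ have isomorphic chiral Koszul complexes (as dg vertex algebras). -/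

import Mathlib

noncomputable section

/-! ## Differential graded vertex algebras over `ℂ` -/

/-- The data of a differential graded vertex (super)algebra: a complex vector space with a
cohomological grading, a vacuum, the products `a_(n) b` for all integers `n`, a translation
operator `T` and a differential `d`.  The parity of an element is its cohomological degree mod 2.
The axioms are in `DGVertexData.IsDGVertexAlgebra`. -/
structure DGVertexData where
  carrier : Type
  [addCommGroup : AddCommGroup carrier]
  [module : Module ℂ carrier]
  deg : ℤ → Submodule ℂ carrier
  vac : carrier
  prod : ℤ → carrier → carrier → carrier
  T : carrier → carrier
  d : carrier → carrier

attribute [instance] DGVertexData.addCommGroup DGVertexData.module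

/-- The axioms of a dg vertex algebra: a `ℤ`-graded vertex superalgebra (vacuum, translation and
Borcherds identities, with Koszul signs) with an odd derivation `d` of all products that has
degree `1` and square zero. -/
structure DGVertexData.IsDGVertexAlgebra (V : DGVertexData) : Prop where
  isInternal : DirectSum.IsInternal V.deg
  vac_mem : V.vac ∈ V.deg 0
  prod_mem : ∀ (n p q : ℤ) (a b : V.carrier), a ∈ V.deg p → b ∈ V.deg q →
    V.prod n a b ∈ V.deg (p + q)
  T_mem : ∀ (p : ℤ) (a : V.carrier), a ∈ V.deg p → V.T a ∈ V.deg p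
  d_mem : ∀ (p : ℤ) (a : V.carrier), a ∈ V.deg p → V.d a ∈ V.deg (p + 1)
  prod_linear_left : ∀ (n : ℤ) (b : V.carrier), IsLinearMap ℂ (fun a => V.prod n a b)
  prod_linear_right : ∀ (n : ℤ) (a : V.carrier), IsLinearMap ℂ (V.prod n a)
  T_linear : IsLinearMap ℂ V.T
  d_linear : IsLinearMap ℂ V.d
  truncation : ∀ a b : V.carrier, ∃ N : ℤ, ∀ n : ℤ, N ≤ n → V.prod n a b = 0
  vac_prod : ∀ (n : ℤ) (a : V.carrier), V.prod n V.vac a = if n = -1 then a else 0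
  prod_vac_neg_one : ∀ a : V.carrier, V.prod (-1) a V.vac = a
  prod_vac_nonneg : ∀ (n : ℤ) (a : V.carrier), 0 ≤ n → V.prod n a V.vac = 0
  T_eq : ∀ a : V.carrier, V.T a = V.prod (-2) a V.vac
  T_prod : ∀ (n : ℤ) (a b : V.carrier),
    V.T (V.prod n a b) = V.prod n (V.T a) b + V.prod n a (V.T b)
  borcherds : ∀ (p q : ℤ) (a b c : V.carrier), a ∈ V.deg p → b ∈ V.deg q → ∀ k m n : ℤ,
    (∑ᶠ j : ℕ, Ring.choose m j • V.prod (m + k - j) (V.prod (n + j) a b) c) =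
      (∑ᶠ j : ℕ, ((-1) ^ j * Ring.choose n j) • V.prod (m + n - j) a (V.prod (k + j) b c)) -
      (∑ᶠ j : ℕ, ((-1) ^ j * Ring.choose n j * (Int.negOnePow (n + p * q) : ℤ)) •
        V.prod (n + k - j) b (V.prod (m + j) a c))
  d_prod : ∀ (n p : ℤ) (a b : V.carrier), a ∈ V.deg p →
    V.d (V.prod n a b) = V.prod n (V.d a) b + (Int.negOnePow p : ℤ) • V.prod n a (V.d b)
  d_d : ∀ a : V.carrier, V.d (V.d a) = 0

/-- A dg vertex algebra. -/
structure DGVertexAlgebra extends DGVertexData where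
  isDG : toDGVertexData.IsDGVertexAlgebra

/-- `φ` is a morphism of dg vertex algebras. -/
structure IsDGVertexHom (V W : DGVertexData) (φ : V.carrier →ₗ[ℂ] W.carrier) : Prop where
  map_deg : ∀ (p : ℤ) (a : V.carrier), a ∈ V.deg p → φ a ∈ W.deg p
  map_vac : φ V.vac = W.vac
  map_prod : ∀ (n : ℤ) (a b : V.carrier), φ (V.prod n a b) = W.prod n (φ a) (φ b)
  map_T : ∀ a : V.carrier, φ (V.T a) = W.T (φ a)
  map_d : ∀ a : V.carrier, φ (V.d a) = W.d (φ a)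

/-- The chain map `φ` induces an injection and a surjection on the cohomology of `d`. -/
def IsCohomologyIso (V W : DGVertexData) (φ : V.carrier →ₗ[ℂ] W.carrier) : Prop :=
  (∀ a : V.carrier, V.d a = 0 → (∃ c, φ a = W.d c) → ∃ c, a = V.d c) ∧
  (∀ b : W.carrier, W.d b = 0 → ∃ a : V.carrier, V.d a = 0 ∧ ∃ c, b = φ a + W.d c)

/-- Being connected by a finite zigzag of quasi-isomorphisms of dg vertex algebras. -/
def DGVertexAlgebra.QuasiIsomorphic : DGVertexAlgebra → DGVertexAlgebra → Prop :=
  Relation.EqvGen fun V W =>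
    ∃ φ : V.carrier →ₗ[ℂ] W.carrier, IsDGVertexHom V.toDGVertexData W.toDGVertexData φ ∧
      IsCohomologyIso V.toDGVertexData W.toDGVertexData φ

/-- Isomorphism of dg vertex algebras. -/
def DGVertexData.Isomorphic (V W : DGVertexData) : Prop :=
  ∃ φ : V.carrier ≃ₗ[ℂ] W.carrier, IsDGVertexHom V W φ.toLinearMap

/-- `ι : M → V` is a dg vertex algebra quasi-isomorphism, and `π : V → M` is a map of complexes,
also a quasi-isomorphism, that commutes with translation, is linear over the vertex algebra `M`
acting on `V` through `ι`, and satisfies `π ∘ ι = id`. -/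
structure IsChiralRetract (M V : DGVertexData) (ι : M.carrier →ₗ[ℂ] V.carrier)
    (π : V.carrier →ₗ[ℂ] M.carrier) : Prop where
  isHom : IsDGVertexHom M V ι
  ι_quasiIso : IsCohomologyIso M V ι
  π_deg : ∀ (p : ℤ) (v : V.carrier), v ∈ V.deg p → π v ∈ M.deg p
  π_d : ∀ v : V.carrier, π (V.d v) = M.d (π v)
  π_T : ∀ v : V.carrier, π (V.T v) = M.T (π v)
  π_prod : ∀ (n : ℤ) (a : M.carrier) (v : V.carrier),
    π (V.prod n (ι a) v) = M.prod n a (π v)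
  π_ι : ∀ a : M.carrier, π (ι a) = a
  π_quasiIso : IsCohomologyIso V M π

/-! ## The chiral differential operators on `ℂ[x₁,…,xₙ,ξ₁,…,ξₘ]`

The `xᵢ` are even of degree `0` and the `ξᵢ` are odd of degree `-1`. -/

namespace Chiral

/-- The generators: `inl (i, false) = xᵢ`, `inl (i, true) = ∂_{xᵢ}`, `inr (i, false) = ξᵢ`,
`inr (i, true) = ∂_{ξᵢ}`. -/
abbrev Gen (n m : ℕ) : Type := (Fin n × Bool) ⊕ (Fin m × Bool)

/-- The even jet variables `u^{(k)}`, where `u` is `xᵢ` or `∂_{xᵢ}`. -/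
abbrev EvenJet (n : ℕ) : Type := (Fin n × Bool) × ℕ

/-- The odd jet variables `u^{(k)}`, where `u` is `ξᵢ` or `∂_{ξᵢ}`, with a linear order that
serves to write monomials. -/
abbrev OddJet (m : ℕ) : Type := Fin m ×ₗ (Bool ×ₗ ℕ)

/-- The odd jet variable `ξᵢ^{(k)}` (`b = false`) or `∂_{ξᵢ}^{(k)}` (`b = true`). -/
def oddJet {m : ℕ} (i : Fin m) (b : Bool) (k : ℕ) : OddJet m := toLex (i, toLex (b, k))

/-- Monomials: a multi-exponent in the even jet variables, and a finite set of odd jet variables,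
which stands for their product in increasing order. -/
abbrev Mono (n m : ℕ) : Type := (EvenJet n →₀ ℕ) × Finset (OddJet m)

/-- The underlying space: the polynomial superalgebra in all the jet variables. -/
abbrev Space (n m : ℕ) : Type := Mono n m →₀ ℂ

variable {n m : ℕ}

/-- Left multiplication by an even jet variable. -/
def mulEven (u : EvenJet n) : Space n m →ₗ[ℂ] Space n m :=
  Finsupp.linearCombination ℂ fun p : Mono n m =>
    Finsupp.single (p.1 + Finsupp.single u 1, p.2) (1 : ℂ)

/-- The partial derivative with respect to an even jet variable. -/
def derivEven (u : EvenJet n) : Space n m →ₗ[ℂ] Space n m :=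
  Finsupp.linearCombination ℂ fun p : Mono n m =>
    Finsupp.single (p.1 - Finsupp.single u 1, p.2) (p.1 u : ℂ)

/-- The sign of moving the odd variable `u` past the smaller odd variables in `S`. -/
def oddSign (u : OddJet m) (S : Finset (OddJet m)) : ℂ := (-1) ^ (S.filter (· < u)).card

/-- Left multiplication by an odd jet variable. -/
def mulOdd (u : OddJet m) : Space n m →ₗ[ℂ] Space n m :=
  Finsupp.linearCombination ℂ fun p : Mono n m =>
    if u ∈ p.2 then 0 else Finsupp.single (p.1, insert u p.2) (oddSign u p.2)

/-- The left partial derivative with respect to an odd jet variable. -/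
def derivOdd (u : OddJet m) : Space n m →ₗ[ℂ] Space n m :=
  Finsupp.linearCombination ℂ fun p : Mono n m =>
    if u ∈ p.2 then Finsupp.single (p.1, p.2.erase u) (oddSign u p.2) else 0

/-- The parity operator. -/
def parity : Space n m →ₗ[ℂ] Space n m :=
  Finsupp.linearCombination ℂ fun p : Mono n m => Finsupp.single p ((-1 : ℂ) ^ p.2.card)

/-- The operator `u_(-k-1)`, `k ≥ 0`: multiplication by `u^{(k)}`. -/
def create : Gen n m → ℕ → (Space n m →ₗ[ℂ] Space n m)
  | Sum.inl u, k => mulEven (u, k)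
  | Sum.inr (i, b), k => mulOdd (oddJet i b k)

/-- The operator `u_(k)`, `k ≥ 0`; so `(∂_{xᵢ})_(k) = ∂/∂xᵢ^{(k)}`,
`(xᵢ)_(k) = -∂/∂(∂_{xᵢ})^{(k)}`, `(∂_{ξᵢ})_(k) = ∂/∂ξᵢ^{(k)}` and
`(ξᵢ)_(k) = ∂/∂(∂_{ξᵢ})^{(k)}`. -/
def annihilate : Gen n m → ℕ → (Space n m →ₗ[ℂ] Space n m)
  | Sum.inl (i, true), k => derivEven ((i, false), k)
  | Sum.inl (i, false), k => -derivEven ((i, true), k)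
  | Sum.inr (i, b), k => derivOdd (oddJet i (!b) k)

/-- Conjugation by the parity operator if the generator is odd, the identity if it is even. -/
def twist : Gen n m → (Space n m → Space n m) → (Space n m → Space n m)
  | Sum.inl _, B => B
  | Sum.inr _, B => fun v => parity (B (parity v))

/-- A field is given by its modes: `B l` is the coefficient of `z^{-l-1}`. -/
abbrev Modes (n m : ℕ) : Type := ℤ → Space n m → Space n m

/-- The identity field. -/
def idField : Modes n m := fun l v => if l = -1 then v else 0

/-- The modes of the normally ordered product `:(∂_z^k u(z) / k!) B(z):`, where `u` is a
generator.  This is the field of the element `u_(-k-1) b` if `B` is the field of `b`. -/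
def normalOrdered (u : Gen n m) (k : ℕ) (B : Modes n m) : Modes n m := fun l v =>
  (∑ᶠ j : ℕ, ((k + j).choose j : ℂ) • create u (k + j) (B (l + j) v)) +
    (-1 : ℂ) ^ k • ∑ᶠ j : ℕ, ((k + j).choose j : ℂ) •
      twist u (B (l - k - 1 - j)) (annihilate u j v)

/-- The jet variables of a monomial, in the order in which they are multiplied. -/
def factors (p : Mono n m) : List (Gen n m × ℕ) :=
  (Finsupp.toMultiset p.1).toList.map (fun u => (Sum.inl u.1, u.2)) ++
    (p.2.sort (· ≤ ·)).map
      (fun u => (Sum.inr ((ofLex u).1, (ofLex (ofLex u).2).1), (ofLex (ofLex u).2).2))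

/-- The field attached to a monomial. -/
def field (p : Mono n m) : Modes n m :=
  (factors p).foldr (fun u B => normalOrdered u.1 u.2 B) idField

/-- The products `a_(l) b`. -/
def vprod (l : ℤ) (a b : Space n m) : Space n m := a.sum fun p c => c • field p l b

/-- The vacuum `1`. -/
def vacuum : Space n m := Finsupp.single (0, ∅) 1

/-- The derivation with `T u^{(k)} = (k + 1) u^{(k+1)}`; the variable `u^{(k)}` stands for the
divided power `T^k u / k!`. -/
def translation : Space n m →ₗ[ℂ] Space n m :=
  Finsupp.linearCombination ℂ fun p : Mono n m =>
    (∑ u ∈ p.1.support, ((u.2 : ℂ) + 1) •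
      mulEven (u.1, u.2 + 1) (derivEven u (Finsupp.single p (1 : ℂ)))) +
    (∑ u ∈ p.2, (((ofLex (ofLex u).2).2 : ℂ) + 1) •
      mulOdd (oddJet (ofLex u).1 (ofLex (ofLex u).2).1 ((ofLex (ofLex u).2).2 + 1))
        (derivOdd u (Finsupp.single p (1 : ℂ))))

/-- The cohomological degree: each `ξᵢ^{(k)}` has degree `-1`, each `∂_{ξᵢ}^{(k)}` has degree `1`,
and the even variables have degree `0`. -/
def cohDeg (p : Mono n m) : ℤ := ∑ u ∈ p.2, if (ofLex (ofLex u).2).1 = true then 1 else -1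

/-- The embedding of `ℂ[x₁,…,xₙ]`, with `xᵢ ↦ xᵢ^{(0)}`. -/
def ofPoly (f : MvPolynomial (Fin n) ℂ) : Space n m :=
  ∑ s ∈ f.support, Finsupp.single (s.mapDomain (fun i => ((i, false), 0)), ∅) (f.coeff s)

/-- The element `∑ᵢ (fᵢ)_(-1) ∂_{ξᵢ}`. -/
def differentialElement (f : Fin m → MvPolynomial (Fin n) ℂ) : Space n m :=
  ∑ i, vprod (-1) (ofPoly (f i)) (Finsupp.single (0, {oddJet i true 0}) 1)

/-- The chiral Koszul complex: the chiral differential operators on `ℂ[x₁,…,xₙ,ξ₁,…,ξₘ]` with the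
differential `(∑ᵢ (fᵢ)_(-1) ∂_{ξᵢ})_(0)`. -/
def chiralKoszul (f : Fin m → MvPolynomial (Fin n) ℂ) : DGVertexData where
  carrier := Space n m
  deg := fun p => Finsupp.supported ℂ ℂ {q : Mono n m | cohDeg q = p}
  vac := vacuum
  prod := vprod
  T := translation
  d := vprod 0 (differentialElement f)

end Chiral

/-! ## Koszul resolutions of a graded algebra -/

/-- The differential `∑ᵢ fᵢ ∂_{ξᵢ}` of the Koszul dg algebra `R[ξ₁,…,ξₘ]`, the exterior algebra
over `R` of the free module with basis the `ξᵢ`: the contraction with `ξᵢ ↦ fᵢ`. -/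
def koszulDifferential {R : Type*} [CommRing R] {m : ℕ} (f : Fin m → R) :
    ExteriorAlgebra R (Fin m → R) →ₗ[R] ExteriorAlgebra R (Fin m → R) :=
  CliffordAlgebra.contractLeft (Fintype.linearCombination R f)

/-- A homogeneous presentation of a graded algebra `A`: a polynomial ring with variables of
positive degrees, homogeneous polynomials `fᵢ`, and a homomorphism of graded algebras to `A`. -/
structure KoszulPresentation {A : Type*} [CommRing A] [Algebra ℂ A]
    (𝒜 : ℕ → Submodule ℂ A) where
  n : ℕ
  m : ℕ
  wt : Fin n → ℕ
  wt_pos : ∀ i, 0 < wt i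
  f : Fin m → MvPolynomial (Fin n) ℂ
  fdeg : Fin m → ℕ
  f_homogeneous : ∀ i, (f i).IsWeightedHomogeneous wt (fdeg i)
  aug : MvPolynomial (Fin n) ℂ →ₐ[ℂ] A
  aug_mem : ∀ i, aug (MvPolynomial.X i) ∈ 𝒜 (wt i)

/-- `e` is a minimal generating set of the homogeneous ideal `I` of the graded algebra `R`: its
elements are homogeneous elements of `I`, and their classes form a basis of `I / R_> I`, where
`R_>` is the ideal of elements of positive degree. -/
structure IsMinimalGeneratingSet {R : Type*} [CommRing R] [Algebra ℂ R]
    (𝒢 : ℕ → Submodule ℂ R) [GradedAlgebra 𝒢] (I : Ideal R) {κ : Type*} (e : κ → R) : Prop where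
  mem : ∀ i, e i ∈ I
  homogeneous : ∀ i, SetLike.IsHomogeneousElem 𝒢 (e i)
  linearIndependent : LinearIndependent ℂ fun i =>
    Ideal.Quotient.mk ((HomogeneousIdeal.irrelevant 𝒢).toIdeal * I) (e i)
  spans : ∀ a ∈ I, ∃ b ∈ Submodule.span ℂ (Set.range e),
    a - b ∈ (HomogeneousIdeal.irrelevant 𝒢).toIdeal * I

namespace KoszulPresentation

variable {A : Type*} [CommRing A] [Algebra ℂ A] {𝒜 : ℕ → Submodule ℂ A}

/-- The homomorphism of the Koszul dg algebra to `A` that extends `aug` and kills all `ξᵢ`. -/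
def augmentation (K : KoszulPresentation 𝒜) :
    ExteriorAlgebra (MvPolynomial (Fin K.n) ℂ) (Fin K.m → MvPolynomial (Fin K.n) ℂ) →+* A :=
  K.aug.toRingHom.comp (ExteriorAlgebra.algebraMapInv : ExteriorAlgebra
    (MvPolynomial (Fin K.n) ℂ) (Fin K.m → MvPolynomial (Fin K.n) ℂ) →ₐ[_] _).toRingHom

/-- The augmentation is a dg algebra quasi-isomorphism to `A`, where `A` has zero differential. -/
structure IsResolution (K : KoszulPresentation 𝒜) : Prop where
  comm : ∀ z, K.augmentation (koszulDifferential K.f z) = 0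
  surjective : ∀ a : A, ∃ z, koszulDifferential K.f z = 0 ∧ K.augmentation z = a
  injective : ∀ z, koszulDifferential K.f z = 0 → K.augmentation z = 0 →
    ∃ w, z = koszulDifferential K.f w

/-- The presentation is minimal: the images of the variables form a minimal generating set of
`A_>`, and the `fᵢ` form a minimal generating set of the kernel of `aug`. -/
structure IsMinimal [GradedAlgebra 𝒜] (K : KoszulPresentation 𝒜) : Prop where
  generators : IsMinimalGeneratingSet 𝒜 (HomogeneousIdeal.irrelevant 𝒜).toIdeal
    fun i => K.aug (MvPolynomial.X i)
  relations :
    letI : GradedAlgebra (MvPolynomial.weightedHomogeneousSubmodule ℂ K.wt) :=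
      MvPolynomial.weightedGradedAlgebra ℂ K.wt
    IsMinimalGeneratingSet (MvPolynomial.weightedHomogeneousSubmodule ℂ K.wt)
      (RingHom.ker K.aug) K.f

/-- The chiral Koszul complex of a presentation. -/
def chiral (K : KoszulPresentation 𝒜) : DGVertexData := Chiral.chiralKoszul K.f

end KoszulPresentation

end

/-! The chiral Koszul complex carries free fields, so its vertex algebra axioms come from the
reconstruction argument. The generating fields are translation covariant and pairwise local, since
their supercommutators are multiples of the delta function and are killed by `z - w`. Dong's lemma
(`Local.fprod`) passes locality to iterated products. A covariant field that is local to the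
generators is determined by its value at the vacuum (`modes_ext`), so the field of `a_(k) b` is the
`k`-th product of the fields of `a` and `b` (`fprod_toField`). The Borcherds identity is then a
statement about two local fields (`borcherds_of_local`). The differential is the zero mode of an odd
element `Q` with `Q_(0) Q = 0`, hence an odd derivation of square zero.

Two kinds of moves relate different presentations. The first kind changes coordinates: `xᵢ ↦ xᵢ + p`
with `p` free of `xᵢ`, `fᵢ ↦ fᵢ - p fₗ` with `i ≠ l`, and rescalings. Each lifts to an isomorphism
of chiral complexes carrying `Q` to the new `Q`. The first two are exponentials of the zero modes of
`p ∂_{xᵢ}` and `ξₗ p ∂_{ξᵢ}`, whose squares kill all generators (`isomorphic_shear`,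
`isomorphic_exchange`, `isomorphic_scale`). The second kind adds a variable `z` together with the
relation `z`. This adjoins a contractible factor: a homotopy sending `z` to `ζ` and `∂_ζ` to `∂_z`
has as anticommutator with the differential the operator counting the new variables. Hence closed
vectors that the projection kills are exact, and the inclusion and the projection are inverse to
each other on cohomology (`exists_isChiralRetract_of_stabilization`).

The commutative algebra shows that these moves suffice. Let `K` be a Koszul resolution and `M` a
minimal presentation of `A`. By minimality a lift of a generator of `M` contains some variable of
`K` linearly, so that variable can be exchanged for the lift. Repeating this, and subtracting lifts
from the remaining variables, makes the variables of `K` into those of `M` and variables mapping to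
zero. The kernel is then generated by the relations of `M` and the extra variables, and in their
syzygies no coefficient has a constant term. A second exchange turns the relations of `K` into
exactly these. None is left over, because syzygies of a Koszul resolution have coefficients in the
kernel of the augmentation, hence without constant term (`IsResolution.mem_of_relation`). So up to
moves of the first kind `K` is a stabilization of `M` (`IsResolution.reduction`).

Consequently `M` is a retract of a resolution, hence a resolution, and its chiral complex is a
retract of that of `K` and likewise of `L`, which gives the zigzag. Two minimal presentations reduce
to each other, so they have equally many variables; then nothing is adjoined and the retraction is
an isomorphism. -/

noncomputable section

/-! ## Fields on a vector space and their products -/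

namespace FieldCalculus

/-- A sequence that vanishes from some point on. -/
def Ev {V : Type*} [Zero V] (F : ℕ → V) : Prop := ∃ J, ∀ j, J ≤ j → F j = 0

section BinomialSums

variable {V : Type*} [AddCommGroup V]

theorem Ev.finite {F : ℕ → V} (h : Ev F) : (Function.support F).Finite := by
  obtain ⟨J, hJ⟩ := h
  refine (Set.finite_lt_nat J).subset fun j hj => ?_
  by_contra hlt
  exact hj (hJ j (not_lt.mp hlt))

theorem Ev.add {F G : ℕ → V} (hF : Ev F) (hG : Ev G) : Ev fun j => F j + G j := by
  obtain ⟨J, hJ⟩ := hF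
  obtain ⟨K, hK⟩ := hG
  exact ⟨max J K, fun j hj => by
    beta_reduce
    rw [hJ j (le_trans (le_max_left _ _) hj), hK j (le_trans (le_max_right _ _) hj), add_zero]⟩

theorem Ev.map {W : Type*} [AddCommGroup W] {F : ℕ → V} (hF : Ev F) (f : ℕ → V → W)
    (hf : ∀ j, f j 0 = 0) : Ev fun j => f j (F j) := by
  obtain ⟨J, hJ⟩ := hF
  exact ⟨J, fun j hj => by beta_reduce; rw [hJ j hj, hf]⟩

theorem Ev.smul {F : ℕ → V} (hF : Ev F) (c : ℕ → ℤ) : Ev fun j => c j • F j :=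
  hF.map (fun j v => c j • v) fun _ => smul_zero _

/-- `∑ⱼ xʲ (n choose j) Fⱼ`. -/
def bsum (x n : ℤ) (F : ℕ → V) : V := ∑ᶠ j : ℕ, (x ^ j * Ring.choose n j) • F j

theorem finsum_eq_range {F : ℕ → V} {J : ℕ} (hJ : ∀ j, J ≤ j → F j = 0) :
    ∑ᶠ j, F j = ∑ j ∈ Finset.range J, F j := by
  refine finsum_eq_sum_of_support_subset _ fun j hj => ?_
  simp only [Finset.coe_range, Set.mem_Iio]
  by_contra hlt
  exact hj (hJ j (not_lt.mp hlt))

theorem bsum_eq_range (x n : ℤ) {F : ℕ → V} {J : ℕ} (hJ : ∀ j, J ≤ j → F j = 0) :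
    bsum x n F = ∑ j ∈ Finset.range J, (x ^ j * Ring.choose n j) • F j :=
  finsum_eq_range fun j hj => by rw [hJ j hj, smul_zero]

theorem bsum_zero_left (x : ℤ) (F : ℕ → V) : bsum x 0 F = F 0 := by
  rw [bsum, finsum_eq_single _ 0]
  · simp
  · intro j hj
    rw [Ring.choose_zero_pos _ (Nat.pos_of_ne_zero hj)]; simp

theorem bsum_zero (x n : ℤ) : bsum x n (fun _ => (0 : V)) = 0 := by simp [bsum]

theorem bsum_add (x n : ℤ) {F G : ℕ → V} (hF : Ev F) (hG : Ev G) :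
    bsum x n (fun j => F j + G j) = bsum x n F + bsum x n G := by
  simp only [bsum, smul_add]
  exact finsum_add_distrib (hF.smul _).finite (hG.smul _).finite

theorem bsum_map {W : Type*} [AddCommGroup W] (x n : ℤ) {F : ℕ → V} (hF : Ev F) (f : V →+ W) :
    f (bsum x n F) = bsum x n fun j => f (F j) := by
  rw [bsum, bsum, f.map_finsum (hF.smul _).finite]
  exact finsum_congr fun j => by rw [map_zsmul]

theorem bsum_sub (x n : ℤ) {F G : ℕ → V} (hF : Ev F) (hG : Ev G) :
    bsum x n (fun j => F j - G j) = bsum x n F - bsum x n G := by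
  simp only [bsum, smul_sub]
  exact finsum_sub_distrib (hF.smul _).finite (hG.smul _).finite

theorem bsum_smul {R : Type*} [Ring R] [Module R V] (x n : ℤ) {F : ℕ → V} (hF : Ev F) (c : R) :
    bsum x n (fun j => c • F j) = c • bsum x n F :=
  (bsum_map x n hF (DistribSMul.toAddMonoidHom V c)).symm

/-- Pascal's rule for the binomial coefficients: raising `n` by one multiplies the generating
operator by `1 + x · shift`. -/
theorem bsum_pascal (x n : ℤ) {F : ℕ → V} (hF : Ev F) :
    bsum x (n + 1) F = bsum x n F + x • bsum x n fun j => F (j + 1) := by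
  obtain ⟨J, hJ⟩ := hF
  rw [bsum_eq_range x _ (J := J + 1) fun j hj => hJ j (by omega),
    bsum_eq_range x n (J := J + 1) fun j hj => hJ j (by omega),
    bsum_eq_range x n (J := J) fun j hj => hJ (j + 1) (by omega), Finset.sum_range_succ',
    Finset.sum_range_succ' _ J, Finset.smul_sum]
  simp only [pow_zero, Ring.choose_zero_right, Ring.choose_succ_succ, mul_add, add_smul,
    Finset.sum_add_distrib]
  simp only [smul_smul, pow_succ']
  simp only [mul_assoc]
  abel

/-- The telescoping identity behind the Leibniz rule for translations. -/
theorem bsum_telescope (n : ℤ) {F G : ℕ → V} (hF : Ev F) (hG : ∀ j, G (j + 1) = F j) :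
    (bsum (-1) n fun j => (n - j) • F j) + (bsum (-1) n fun j => (j : ℤ) • G j) = 0 := by
  obtain ⟨J, hJ⟩ := hF
  rw [bsum_eq_range (-1) n (J := J) fun j hj => by rw [hJ j hj, smul_zero],
    bsum_eq_range (-1) n (J := J + 1), Finset.sum_range_succ']
  · simp only [Nat.cast_zero, zero_smul, smul_zero, add_zero, ← Finset.sum_add_distrib, hG]
    refine Finset.sum_eq_zero fun j _ => ?_
    rw [smul_smul, smul_smul, ← add_smul]
    -- The terms cancel in pairs because `(n - j) * choose n j = (j + 1) * choose n (j + 1)`.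
    have h := Ring.choose_smul_choose n (n := j + 1) (k := j) (by omega)
    rw [Nat.choose_succ_self_right, Nat.add_sub_cancel_left, Ring.choose_one_right,
      nsmul_eq_mul] at h
    have h2 : (-1 : ℤ) ^ j * Ring.choose n j * (n - j) +
        (-1) ^ (j + 1) * Ring.choose n (j + 1) * ((j + 1 : ℕ) : ℤ) = 0 := by
      push_cast at h ⊢
      linear_combination (-(-1 : ℤ) ^ j) * h
    rw [h2, zero_smul]
  · rintro (_ | j) hj
    · omega
    · rw [hG, hJ j (by omega), smul_zero]

end BinomialSums

/-! ### Fields -/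

variable {V : Type*} [AddCommGroup V] [Module ℂ V]

variable (V) in
/-- A field on `V`, given by its modes. -/
structure FieldOp where
  modes : ℤ → V →ₗ[ℂ] V
  trunc : ∀ v, ∃ N : ℤ, ∀ n, N ≤ n → modes n v = 0

theorem FieldOp.ev (A : FieldOp V) (k : ℤ) (v : V) : Ev fun j : ℕ => A.modes (k + j) v := by
  obtain ⟨N, hN⟩ := A.trunc v
  exact ⟨(N - k).toNat, fun j hj => hN _ (by omega)⟩

/-- The coefficients of `(z - w)ⁿ` times the commutator of two fields, where the two summands are
expanded in the two different domains. -/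
def bor (e : ℤ) (A B : FieldOp V) (k m n : ℤ) (v : V) : V :=
  bsum (-1) n (fun j => A.modes (m + n - j) (B.modes (k + j) v)) -
    (e * (Int.negOnePow n : ℤ)) • bsum (-1) n fun j => B.modes (n + k - j) (A.modes (m + j) v)

theorem ev_left (A B : FieldOp V) (k l : ℤ) (v : V) :
    Ev fun j : ℕ => A.modes (l - j) (B.modes (k + j) v) :=
  (B.ev k v).map (fun j w => A.modes (l - j) w) fun _ => map_zero _

/-- This is `z = w + (z - w)`, applied to `(z - w)ⁿ` times the commutator. Every later induction on
`m` or `n` runs through this recursion. -/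
theorem bor_pascal (e : ℤ) (A B : FieldOp V) (k m n : ℤ) (v : V) :
    bor e A B k (m + 1) n v = bor e A B (k + 1) m n v + bor e A B k m (n + 1) v := by
  simp only [bor]
  rw [bsum_pascal _ _ (ev_left A B k (m + (n + 1)) v), bsum_pascal _ _ (ev_left B A m (n + 1 + k) v)]
  have h1 : (fun j : ℕ => A.modes (m + 1 + n - j) (B.modes (k + j) v)) =
      fun j : ℕ => A.modes (m + (n + 1) - j) (B.modes (k + j) v) := by
    funext j; ring_nf
  have h2 : (fun j : ℕ => A.modes (m + (n + 1) - (j + 1 : ℕ)) (B.modes (k + (j + 1 : ℕ)) v)) =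
      fun j : ℕ => A.modes (m + n - j) (B.modes (k + 1 + j) v) := by
    funext j; push_cast; ring_nf
  have h3 : (fun j : ℕ => B.modes (n + (k + 1) - j) (A.modes (m + j) v)) =
      fun j : ℕ => B.modes (n + 1 + k - j) (A.modes (m + j) v) := by
    funext j; ring_nf
  have h4 : (fun j : ℕ => B.modes (n + 1 + k - (j + 1 : ℕ)) (A.modes (m + (j + 1 : ℕ)) v)) =
      fun j : ℕ => B.modes (n + k - j) (A.modes (m + 1 + j) v) := by
    funext j; push_cast; ring_nf
  rw [h1, h2, h3, h4, Int.negOnePow_succ]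
  simp only [Units.val_neg, smul_add, mul_neg, neg_smul, one_smul, smul_neg]
  abel

theorem bor_zero_right (e : ℤ) (A B : FieldOp V) (k m : ℤ) (v : V) :
    bor e A B k m 0 v = A.modes m (B.modes k v) - e • B.modes k (A.modes m v) := by
  simp [bor, bsum_zero_left]

theorem bor_add (e : ℤ) (A B : FieldOp V) (k m n : ℤ) (v w : V) :
    bor e A B k m n (v + w) = bor e A B k m n v + bor e A B k m n w := by
  simp only [bor, map_add]
  rw [bsum_add _ _ (ev_left A B _ _ _) (ev_left A B _ _ _),
    bsum_add _ _ (ev_left B A _ _ _) (ev_left B A _ _ _), smul_add]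
  abel

theorem bor_smul (e : ℤ) (A B : FieldOp V) (k m n : ℤ) (c : ℂ) (v : V) :
    bor e A B k m n (c • v) = c • bor e A B k m n v := by
  simp only [bor, map_smul]
  rw [bsum_smul _ _ (ev_left A B _ _ _), bsum_smul _ _ (ev_left B A _ _ _), smul_sub,
    smul_comm c]

theorem bor_trunc (e : ℤ) (A B : FieldOp V) (m n : ℤ) (v : V) :
    ∃ N : ℤ, ∀ k, N ≤ k → bor e A B k m n v = 0 := by
  obtain ⟨K, hK⟩ := B.trunc v
  obtain ⟨J, hJ⟩ := A.ev m v
  have h : ∀ j : ℕ, ∃ N : ℤ, ∀ k, N ≤ k → B.modes (n + k - j) (A.modes (m + j) v) = 0 := by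
    intro j
    obtain ⟨N, hN⟩ := B.trunc (A.modes (m + j) v)
    exact ⟨N - n + j, fun k hk => hN _ (by omega)⟩
  choose N hN using h
  -- The bound for the second sum depends on `j`, but `A_(m+j) v` vanishes for `j ≥ J`, so a maximum
  -- of finitely many bounds suffices.
  obtain ⟨M, hM⟩ := ((Finset.range J).image N).exists_le
  refine ⟨max K M, fun k hk => ?_⟩
  have h1 : ∀ j : ℕ, B.modes (k + j) v = 0 := fun j => hK _ (by have := le_max_left K M; omega)
  have h2 : ∀ j : ℕ, B.modes (n + k - j) (A.modes (m + j) v) = 0 := by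
    intro j
    by_cases hj : j < J
    · exact hN j k (((hM _ (Finset.mem_image_of_mem _ (Finset.mem_range.mpr hj))).trans
        (le_max_right _ _)).trans hk)
    · have := hJ j (not_lt.mp hj)
      beta_reduce at this
      rw [this, map_zero]
  simp [bor, h1, h2, bsum_zero]

/-- The `n`-th product of two fields. -/
def fprod (e n : ℤ) (A B : FieldOp V) : FieldOp V where
  modes k :=
    { toFun := bor e A B k 0 n
      map_add' := bor_add e A B k 0 n
      map_smul' := bor_smul e A B k 0 n }
  trunc := bor_trunc e A B 0 n

theorem fprod_modes (e n : ℤ) (A B : FieldOp V) (k : ℤ) (v : V) :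
    (fprod e n A B).modes k v = bor e A B k 0 n v := rfl

/-! ### Locality -/

/-- Two fields are local if their commutator, with sign `e`, is killed by a power of `z - w`. -/
def Local (e : ℤ) (A B : FieldOp V) : Prop := ∃ N : ℕ, ∀ k m v, bor e A B k m N v = 0

theorem bor_eq_zero_of_le {e : ℤ} {A B : FieldOp V} {N : ℕ}
    (h : ∀ k m v, bor e A B k m N v = 0) (i : ℕ) (k m : ℤ) (v : V) :
    bor e A B k m (N + i) v = 0 := by
  induction i generalizing k m with
  | zero => simpa using h k m v
  | succ i ih =>
    have := bor_pascal e A B k m (N + i) v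
    rw [ih, ih, zero_add] at this
    rw [Nat.cast_succ, ← add_assoc, ← this]

/-- The Borcherds identity for a pair of local fields. -/
theorem borcherds_of_local {e : ℤ} {A B : FieldOp V} (h : Local e A B) (k m n : ℤ) (v : V) :
    bsum 1 m (fun j => (fprod e (n + j) A B).modes (m + k - j) v) = bor e A B k m n v := by
  obtain ⟨N, hN⟩ := h
  have hz : ∀ n' : ℤ, N ≤ n' → ∀ k m, bor e A B k m n' v = 0 := fun n' hn' k m => by
    have := bor_eq_zero_of_le hN (n' - N).toNat k m v
    rwa [show (N : ℤ) + (n' - N).toNat = n' by omega] at this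
  have hev : ∀ k m n : ℤ, Ev fun j : ℕ => (fprod e (n + j) A B).modes (m + k - j) v :=
    fun k m n => ⟨(N - n).toNat, fun j hj => hz _ (by omega) _ _⟩
  -- The left side satisfies the recursion of `bor_pascal`; both sides amount to expanding `z^m` as
  -- `(w + (z - w))^m`. At `m = 0` they agree by definition, and the recursion carries this upwards
  -- in `m`.
  have hL : ∀ k m n : ℤ, bsum 1 (m + 1) (fun j => (fprod e (n + j) A B).modes (m + 1 + k - j) v) =
      bsum 1 m (fun j => (fprod e (n + j) A B).modes (m + (k + 1) - j) v) +
      bsum 1 m (fun j => (fprod e (n + 1 + j) A B).modes (m + k - j) v) := by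
    intro k m n
    rw [bsum_pascal _ _ (hev k (m + 1) n), one_smul]
    congr 2 <;> funext j
    · ring_nf
    · push_cast; ring_nf
  suffices H : ∀ m : ℤ, ∀ k n, bsum 1 m (fun j => (fprod e (n + j) A B).modes (m + k - j) v) -
      bor e A B k m n v = 0 from sub_eq_zero.mp (H m k n)
  intro m
  induction m using Int.induction_on with
  | zero =>
    intro k n
    rw [bsum_zero_left, fprod_modes]; simp
  | succ m ih =>
    intro k n
    rw [hL, bor_pascal, add_sub_add_comm, ih, ih, add_zero]
  | pred m ih =>
    intro k n
    -- For negative `m` the recursion trades a lower `m` for a higher `n`. By locality both sides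
    -- vanish once `n ≥ N`, so the induction is on the distance `i` from `n` up to `N`.
    have key : ∀ i : ℕ, ∀ k n : ℤ, N ≤ n + i →
        bsum 1 (-(m : ℤ) - 1) (fun j => (fprod e (n + j) A B).modes (-(m : ℤ) - 1 + k - j) v) -
          bor e A B k (-(m : ℤ) - 1) n v = 0 := by
      intro i
      induction i with
      | zero =>
        intro k n hn
        rw [hz n (by simpa using hn), sub_zero]
        have : (fun j : ℕ => (fprod e (n + j) A B).modes (-(m : ℤ) - 1 + k - j) v) = fun _ => 0 := by
          funext j
          exact hz _ (by omega) _ _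
        rw [this, bsum_zero]
      | succ i ihi =>
        intro k n hn
        have h1 := ih (k - 1) n
        have h2 := hL (k - 1) (-(m : ℤ) - 1) n
        have h3 := bor_pascal e A B (k - 1) (-(m : ℤ) - 1) n v
        have h4 := ihi (k - 1) (n + 1) (by push_cast at hn ⊢; omega)
        simp only [sub_add_cancel] at h2 h3
        rw [h2, h3, add_sub_add_comm, h4, add_zero] at h1
        exact h1
    exact key (N - n).toNat k n (by omega)

end FieldCalculus

namespace FieldCalculus

/-! ### Difference operators and Dong's lemma -/

section Difference

variable {V : Type*} [AddCommGroup V]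

/-- Multiplication by `z - w` on doubly indexed families. -/
def dif : (ℤ → ℤ → V) →+ (ℤ → ℤ → V) where
  toFun F m k := F (m + 1) k - F m (k + 1)
  map_zero' := by funext m k; simp
  map_add' F G := by funext m k; simp only [Pi.add_apply]; abel

/-- Multiplication by `z - x` on families indexed by the powers of `z`, `w` and `x`. -/
def difZX : (ℤ → ℤ → ℤ → V) →+ (ℤ → ℤ → ℤ → V) where
  toFun F m k l := F (m + 1) k l - F m k (l + 1)
  map_zero' := by funext m k l; simp
  map_add' F G := by funext m k l; simp only [Pi.add_apply]; abel

/-- Multiplication by `w - x` on families indexed by the powers of `z`, `w` and `x`. -/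
def difWX : (ℤ → ℤ → ℤ → V) →+ (ℤ → ℤ → ℤ → V) where
  toFun F m k l := F m (k + 1) l - F m k (l + 1)
  map_zero' := by funext m k l; simp
  map_add' F G := by funext m k l; simp only [Pi.add_apply]; abel

/-- Multiplication by `z - w` on families indexed by the powers of `z`, `w` and `x`. -/
def difZW : (ℤ → ℤ → ℤ → V) →+ (ℤ → ℤ → ℤ → V) where
  toFun F m k l := F (m + 1) k l - F m (k + 1) l
  map_zero' := by funext m k l; simp
  map_add' F G := by funext m k l; simp only [Pi.add_apply]; abel

theorem dif_apply (F : ℤ → ℤ → V) (m k : ℤ) : dif F m k = F (m + 1) k - F m (k + 1) := rfl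

theorem difZX_apply (F : ℤ → ℤ → ℤ → V) (m k l : ℤ) :
    difZX F m k l = F (m + 1) k l - F m k (l + 1) := rfl

theorem difWX_apply (F : ℤ → ℤ → ℤ → V) (m k l : ℤ) :
    difWX F m k l = F m (k + 1) l - F m k (l + 1) := rfl

theorem difZW_apply (F : ℤ → ℤ → ℤ → V) (m k l : ℤ) :
    difZW F m k l = F (m + 1) k l - F m (k + 1) l := rfl

theorem commute_difZX_difWX :
    Function.Commute (difZX : (ℤ → ℤ → ℤ → V) →+ _) (difWX : (ℤ → ℤ → ℤ → V) →+ _) := by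
  intro F
  funext m k l
  simp only [difZX_apply, difWX_apply]
  abel

theorem commute_difZW_difWX :
    Function.Commute (difZW : (ℤ → ℤ → ℤ → V) →+ _) (difWX : (ℤ → ℤ → ℤ → V) →+ _) := by
  intro F
  funext m k l
  simp only [difZW_apply, difWX_apply]
  abel

theorem iterate_difWX_apply (N : ℕ) (F : ℤ → ℤ → ℤ → V) (m k l : ℤ) :
    (difWX^[N] F) m k l = (dif^[N] (F m)) k l := by
  induction N generalizing F with
  | zero => rfl
  | succ N ih => rw [Function.iterate_succ_apply, ih]; rfl

theorem iterate_difZX_apply (N : ℕ) (F : ℤ → ℤ → ℤ → V) (m k l : ℤ) :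
    (difZX^[N] F) m k l = (dif^[N] (fun m l => F m k l)) m l := by
  induction N generalizing F with
  | zero => rfl
  | succ N ih => rw [Function.iterate_succ_apply, ih]; rfl

theorem iterate_dif_map {W : Type*} [AddCommGroup W] (f : V →+ W) (N : ℕ) (F : ℤ → ℤ → V)
    (m k : ℤ) : (dif^[N] fun m k => f (F m k)) m k = f ((dif^[N] F) m k) := by
  induction N generalizing F with
  | zero => rfl
  | succ N ih =>
    rw [Function.iterate_succ_apply, Function.iterate_succ_apply, ← ih]
    have h : dif (fun m k => f (F m k)) = fun m k => f (dif F m k) := by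
      funext m k
      simp [dif_apply]
    rw [h]

theorem iterate_dif_swap (N : ℕ) (F : ℤ → ℤ → V) (m k : ℤ) :
    (dif^[N] fun m k => F k m) m k = (-1 : ℤ) ^ N • (dif^[N] F) k m := by
  induction N generalizing F m k with
  | zero => simp
  | succ N ih =>
    rw [Function.iterate_succ_apply', dif_apply, ih F (m + 1) k, ih F m (k + 1), Function.iterate_succ_apply', dif_apply,
      pow_succ]
    simp only [mul_neg, mul_one, neg_smul, smul_sub]
    abel

/-- A sum over the powers of `z / w`, with shifts. -/
def diagSum (n s c c' : ℤ) (F : ℤ → ℤ → ℤ → V) (m k l : ℤ) : V :=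
  bsum (-1) n fun j : ℕ => F (m + c - s * j) (k + c' + s * j) l

/-- The sums `diagSum` of `F` are finite. -/
def DiagEv (s : ℤ) (F : ℤ → ℤ → ℤ → V) : Prop :=
  ∀ m k l, Ev fun j : ℕ => F (m - s * j) (k + s * j) l

theorem DiagEv.difWX {s : ℤ} {F : ℤ → ℤ → ℤ → V} (h : DiagEv s F) : DiagEv s (difWX F) := by
  intro m k l
  have h1 := (h m (k + 1) l).add ((h m k (l + 1)).map (fun _ v => -v) fun _ => neg_zero)
  convert h1 using 2 with j
  rw [difWX_apply, sub_eq_add_neg]; ring_nf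

theorem DiagEv.difZX {s : ℤ} {F : ℤ → ℤ → ℤ → V} (h : DiagEv s F) : DiagEv s (difZX F) := by
  intro m k l
  have h1 := (h (m + 1) k l).add ((h m k (l + 1)).map (fun _ v => -v) fun _ => neg_zero)
  convert h1 using 2 with j
  rw [difZX_apply, sub_eq_add_neg]; ring_nf

theorem difWX_diagSum {n s c c' : ℤ} {F : ℤ → ℤ → ℤ → V} (h : DiagEv s F) :
    difWX (diagSum n s c c' F) = diagSum n s c c' (difWX F) := by
  funext m k l
  simp only [difWX_apply, diagSum]
  rw [bsum_sub]
  · congr 2; funext j; ring_nf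
  · convert h (m + c) (k + c' + 1) l using 2 with j; ring_nf
  · exact h (m + c) (k + c') (l + 1)

theorem difZX_diagSum {n s c c' : ℤ} {F : ℤ → ℤ → ℤ → V} (h : DiagEv s F) :
    difZX (diagSum n s c c' F) = diagSum n s c c' (difZX F) := by
  funext m k l
  simp only [difZX_apply, diagSum]
  rw [bsum_sub]
  · congr 2; funext j; ring_nf
  · convert h (m + c + 1) (k + c') l using 2 with j; ring_nf
  · exact h (m + c) (k + c') (l + 1)

theorem iterate_diagSum {n s c c' : ℤ} (M N : ℕ) {F : ℤ → ℤ → ℤ → V} (h : DiagEv s F) :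
    difZX^[M] (difWX^[N] (diagSum n s c c' F)) = diagSum n s c c' (difZX^[M] (difWX^[N] F)) := by
  induction N generalizing F with
  | zero =>
    induction M generalizing F with
    | zero => rfl
    | succ M ih =>
      simp only [Function.iterate_zero, id, Function.iterate_succ_apply] at ih ⊢
      rw [difZX_diagSum h, ih h.difZX]
  | succ N ih => rw [Function.iterate_succ_apply, Function.iterate_succ_apply, difWX_diagSum h,
      ih h.difWX]

theorem diagSum_zero (n s c c' : ℤ) : diagSum n s c c' (0 : ℤ → ℤ → ℤ → V) = 0 := by
  funext m k l
  simp [diagSum, bsum_zero]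

/-- Used with the Leibniz expansion of a double commutator: one summand dies by a power of `w - x`,
the other by a power of `z - x`, and the two multiplications commute. -/
theorem iterate_comm_zero (M N : ℕ) {F P R : ℤ → ℤ → ℤ → V} (hF : F = P + R)
    (hP : difWX^[N] P = 0) (hR : difZX^[M] R = 0) : difZX^[M] (difWX^[N] F) = 0 := by
  have hc : Function.Commute (difZX^[M] : (ℤ → ℤ → ℤ → V) → _) difWX^[N] :=
    commute_difZX_difWX.iterate_iterate M N
  rw [hF, iterate_map_add, hP, zero_add, hc.eq, hR, iterate_map_zero]

/-- The hypothesis says `F (m + 1) k = F m (k + 1)`, so the family is constant along antidiagonals,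
and each antidiagonal reaches the region where `F` vanishes. -/
theorem eq_zero_of_dif_eq_zero {F : ℤ → ℤ → V} {K : ℤ} (hK : ∀ m k, K ≤ k → F m k = 0)
    (h : dif F = 0) : F = 0 := by
  have key : ∀ (i : ℕ) (m k : ℤ), K ≤ k + i → F m k = 0 := by
    intro i
    induction i with
    | zero => intro m k h; exact hK m k (by simpa using h)
    | succ i ih =>
      intro m k hk
      have := congrFun (congrFun h (m - 1)) k
      rw [dif_apply, ih (m - 1) (k + 1) (by push_cast at hk; omega), sub_add_cancel, sub_zero] at this
      exact this
  funext m k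
  exact key (K - k).toNat m k (by omega)

theorem eq_zero_of_iterate_dif_eq_zero {F : ℤ → ℤ → V} {K : ℤ} (N : ℕ)
    (hK : ∀ m k, K ≤ k → F m k = 0) (h : dif^[N] F = 0) : F = 0 := by
  induction N generalizing F with
  | zero => exact h
  | succ N ih =>
    refine eq_zero_of_dif_eq_zero hK (ih (fun m k hk => ?_) h)
    rw [dif_apply, hK _ _ hk, hK _ _ (by omega), sub_zero]

end Difference

variable {V : Type*} [AddCommGroup V] [Module ℂ V]

/-- The supercommutator of the modes of two fields, applied to a vector. -/
def comm (e : ℤ) (A B : FieldOp V) (v : V) (m k : ℤ) : V :=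
  A.modes m (B.modes k v) - e • B.modes k (A.modes m v)

/-- For a natural exponent `(z - w)^N` is a polynomial, so its two expansions coincide and act on
the ordinary supercommutator. -/
theorem bor_eq_iterate_dif (e : ℤ) (A B : FieldOp V) (N : ℕ) (k m : ℤ) (v : V) :
    bor e A B k m N v = (dif^[N] (comm e A B v)) m k := by
  induction N generalizing k m with
  | zero => simp [bor_zero_right, comm]
  | succ N ih =>
    rw [Function.iterate_succ_apply', dif_apply, ← ih, ← ih, bor_pascal, Nat.cast_succ]
    abel

theorem local_iff {e : ℤ} {A B : FieldOp V} :
    Local e A B ↔ ∃ N : ℕ, ∀ v, dif^[N] (comm e A B v) = 0 := by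
  refine exists_congr fun N => ⟨fun h v => ?_, fun h k m v => ?_⟩
  · funext m k
    rw [← bor_eq_iterate_dif, h]; rfl
  · rw [bor_eq_iterate_dif, h]; rfl

theorem Local.symm {e : ℤ} {A B : FieldOp V} (h : Local e A B) (he : e * e = 1) :
    Local e B A := by
  rw [local_iff] at h ⊢
  obtain ⟨N, hN⟩ := h
  refine ⟨N, fun v => ?_⟩
  have h1 : comm e B A v = fun m k => (-e) • comm e A B v k m := by
    funext m k
    simp only [comm, smul_sub, smul_smul, neg_mul, he, neg_smul, one_smul]
    abel
  rw [h1]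
  funext m k
  have := iterate_dif_map (DistribSMul.toAddMonoidHom V (-e)) N (fun m k => comm e A B v k m) m k
  simp only [DistribSMul.toAddMonoidHom_apply] at this
  rw [this, iterate_dif_swap, hN]
  simp

theorem Local.mono_exists {e : ℤ} {A B : FieldOp V} (h : Local e A B) :
    ∃ N : ℕ, ∀ M, N ≤ M → ∀ v, dif^[M] (comm e A B v) = 0 := by
  rw [local_iff] at h
  obtain ⟨N, hN⟩ := h
  refine ⟨N, fun M hM v => ?_⟩
  obtain ⟨i, rfl⟩ := Nat.exists_eq_add_of_le' hM
  rw [Function.iterate_add_apply, hN, iterate_map_zero]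

/-- **Dong's lemma**. -/
theorem Local.fprod {e₁ e₂ e₃ : ℤ} {A B C : FieldOp V} (hAB : Local e₁ A B) (hAC : Local e₂ A C)
    (hBC : Local e₃ B C) (n : ℤ) : Local (e₂ * e₃) (fprod e₁ n A B) C := by
  obtain ⟨N₁, h₁⟩ := hAB
  rw [local_iff] at hAC hBC
  obtain ⟨N₂, h₂⟩ := hAC
  obtain ⟨N₃, h₃⟩ := hBC
  -- The commutator of `(z - w)ⁿ[A(z), B(w)]` with `C(x)`. Multiplication by `z - w` raises `n`, and
  -- the family vanishes for `n ≥ N₁`.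
  let Q : V → ℤ → ℤ → ℤ → ℤ → V := fun v n m k l =>
    bor e₁ A B k m n (C.modes l v) - (e₂ * e₃) • C.modes l (bor e₁ A B k m n v)
  have hQ : ∀ v n, difZW (Q v n) = Q v (n + 1) := by
    intro v n
    funext m k l
    simp only [difZW_apply, Q, bor_pascal e₁ A B k m n, map_add, smul_add]
    abel
  have hQ0 : ∀ v (n : ℤ), N₁ ≤ n → Q v n = 0 := by
    intro v n hn
    have hz : ∀ k m v, bor e₁ A B k m n v = 0 := fun k m v => by
      have := bor_eq_zero_of_le h₁ (n - N₁).toNat k m v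
      rwa [show (N₁ : ℤ) + (n - N₁).toNat = n by omega] at this
    funext m k l
    simp [Q, hz]
  -- `Q` is a difference of two expansions in powers of `w / z` and `z / w`. Their coefficients are
  -- built from the commutators of `C` with `AB` and with `BA`.
  let F₁ : V → ℤ → ℤ → ℤ → V := fun v m k l =>
    A.modes m (B.modes k (C.modes l v)) - (e₂ * e₃) • C.modes l (A.modes m (B.modes k v))
  let F₂ : V → ℤ → ℤ → ℤ → V := fun v m k l =>
    B.modes k (A.modes m (C.modes l v)) - (e₂ * e₃) • C.modes l (B.modes k (A.modes m v))
  have hF₁ : ∀ v, DiagEv 1 (F₁ v) := by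
    intro v m k l
    have := (ev_left A B k m (C.modes l v)).add
      ((ev_left A B k m v).map (fun _ w => -((e₂ * e₃) • C.modes l w)) fun _ => by simp)
    convert this using 2 with j
    simp only [F₁, one_mul, sub_eq_add_neg]
  have hF₂ : ∀ v, DiagEv (-1) (F₂ v) := by
    intro v m k l
    have := (ev_left B A m k (C.modes l v)).add
      ((ev_left B A m k v).map (fun _ w => -((e₂ * e₃) • C.modes l w)) fun _ => by simp)
    convert this using 2 with j
    simp only [F₂, neg_mul, one_mul, sub_eq_add_neg, neg_neg]
  have hQF : ∀ v n, Q v n = diagSum n 1 n 0 (F₁ v) -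
      (e₁ * (Int.negOnePow n : ℤ)) • diagSum n (-1) 0 n (F₂ v) := by
    intro v n
    funext m k l
    simp only [Q, bor, diagSum, F₁, F₂, Pi.sub_apply, Pi.smul_apply]
    rw [map_sub, map_zsmul]
    have e1 := bsum_map (-1) n (ev_left A B k (m + n) v) (C.modes l).toAddMonoidHom
    have e2 := bsum_map (-1) n (ev_left B A m (n + k) v) (C.modes l).toAddMonoidHom
    simp only [LinearMap.toAddMonoidHom_coe] at e1 e2
    rw [e1, e2, smul_sub, smul_comm (e₂ * e₃), sub_sub_sub_comm, ← smul_sub,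
      ← bsum_smul (-1) n (F := fun j => C.modes l (A.modes (m + n - j) (B.modes (k + j) v)))
        ((ev_left A B k (m + n) v).map (fun _ w => C.modes l w) fun _ => map_zero _),
      ← bsum_smul (-1) n (F := fun j => C.modes l (B.modes (n + k - j) (A.modes (m + j) v)))
        ((ev_left B A m (n + k) v).map (fun _ w => C.modes l w) fun _ => map_zero _),
      ← bsum_sub, ← bsum_sub]
    · congr 3 <;> funext j <;> ring_nf
    · exact ev_left _ _ _ _ _
    · exact ((ev_left B A m (n + k) v).map (fun _ w => (e₂ * e₃) • C.modes l w) fun _ => by simp)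
    · exact ev_left _ _ _ _ _
    · exact ((ev_left A B k (m + n) v).map (fun _ w => (e₂ * e₃) • C.modes l w) fun _ => by simp)
  -- The Leibniz rule `[AB, C] = A[B, C] ± [A, C]B` makes the first summand vanish under a power of
  -- `w - x` and the second under a power of `z - x`.
  have hkill₁ : ∀ v, difZX^[N₂] (difWX^[N₃] (F₁ v)) = 0 := by
    intro v
    refine iterate_comm_zero N₂ N₃ (P := fun m k l => A.modes m (comm e₃ B C v k l))
      (R := fun m k l => e₃ • comm e₂ A C (B.modes k v) m l) ?_ ?_ ?_
    · funext m k l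
      simp only [F₁, comm, Pi.add_apply, map_sub, map_zsmul, smul_sub, smul_smul, mul_comm e₂ e₃]
      abel
    · funext m k l
      rw [iterate_difWX_apply]
      have := iterate_dif_map (A.modes m).toAddMonoidHom N₃ (comm e₃ B C v) k l
      simp only [LinearMap.toAddMonoidHom_coe] at this
      rw [this, h₃]
      simp
    · funext m k l
      rw [iterate_difZX_apply]
      have := iterate_dif_map (DistribSMul.toAddMonoidHom V e₃) N₂ (comm e₂ A C (B.modes k v)) m l
      simp only [DistribSMul.toAddMonoidHom_apply] at this
      rw [this, h₂]
      simp
  have hkill₂ : ∀ v, difZX^[N₂] (difWX^[N₃] (F₂ v)) = 0 := by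
    intro v
    refine iterate_comm_zero N₂ N₃ (P := fun m k l => e₂ • comm e₃ B C (A.modes m v) k l)
      (R := fun m k l => B.modes k (comm e₂ A C v m l)) ?_ ?_ ?_
    · funext m k l
      simp only [F₂, comm, Pi.add_apply, map_sub, map_zsmul, smul_sub, smul_smul]
      abel
    · funext m k l
      rw [iterate_difWX_apply]
      have := iterate_dif_map (DistribSMul.toAddMonoidHom V e₂) N₃ (comm e₃ B C (A.modes m v)) k l
      simp only [DistribSMul.toAddMonoidHom_apply] at this
      rw [this, h₃]
      simp
    · funext m k l
      rw [iterate_difZX_apply]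
      have := iterate_dif_map (B.modes k).toAddMonoidHom N₂ (comm e₂ A C v) m l
      simp only [LinearMap.toAddMonoidHom_coe] at this
      rw [this, h₂]
      simp
  have hkill : ∀ v n, difZX^[N₂] (difWX^[N₃] (Q v n)) = 0 := by
    intro v n
    rw [hQF, iterate_map_sub, iterate_map_sub, iterate_map_zsmul, iterate_map_zsmul,
      iterate_diagSum _ _ (hF₁ v), iterate_diagSum _ _ (hF₂ v), hkill₁, hkill₂, diagSum_zero,
      diagSum_zero, smul_zero, sub_zero]
  -- On families killed by `z - w` the variables `z` and `w` act equally, so `z - x` may be replaced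
  -- by `w - x`.
  have hZW : ∀ (i : ℕ) (R : ℤ → ℤ → ℤ → V), difZW R = 0 → difZX^[i] R = difWX^[i] R := by
    intro i
    induction i with
    | zero => intro R _; rfl
    | succ i ih =>
      intro R hR
      have h1 : difZX R = difWX R := by
        funext m k l
        have := congrFun (congrFun (congrFun hR m) k) l
        rw [difZW_apply] at this
        rw [difZX_apply, difWX_apply, sub_eq_zero.mp this]
      rw [Function.iterate_succ_apply, Function.iterate_succ_apply, h1]
      exact ih _ (by rw [commute_difZW_difWX.eq, hR, map_zero])
  -- Descending induction on `n`: if `(w - x)^M` kills `Q v (n + 1)`, then `(w - x)^(N₃ + M) Q v n`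
  -- is killed by `z - w`. Thus a further factor `(w - x)^N₂` equals `(z - x)^N₂`, and `hkill`
  -- applies.
  have hmain : ∀ (i : ℕ) (n : ℤ), N₁ ≤ n + i → ∃ M : ℕ, ∀ v, difWX^[M] (Q v n) = 0 := by
    intro i
    induction i with
    | zero => intro n hn; exact ⟨0, fun v => hQ0 v n (by simpa using hn)⟩
    | succ i ih =>
      intro n hn
      obtain ⟨M, hM⟩ := ih (n + 1) (by push_cast at hn ⊢; omega)
      refine ⟨N₂ + (N₃ + M), fun v => ?_⟩
      rw [Function.iterate_add_apply, ← hZW]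
      · rw [add_comm N₃ M, Function.iterate_add_apply,
          (commute_difZX_difWX.iterate_iterate N₂ M).eq, hkill, iterate_map_zero]
      · rw [(commute_difZW_difWX.iterate_right _).eq, hQ, Function.iterate_add_apply, hM,
          iterate_map_zero]
  obtain ⟨M, hM⟩ := hmain (N₁ - n).toNat n (by omega)
  rw [local_iff]
  refine ⟨M, fun v => ?_⟩
  funext k l
  -- The slice `m = 0` of `Q` is the commutator of the `n`-th product with `C`.
  have := congrFun (congrFun (congrFun (hM v) 0) k) l
  rw [iterate_difWX_apply] at this
  exact this

end FieldCalculus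

/-! ### Linearity of locality, uniqueness of fields, covariance -/

namespace FieldCalculus

variable {V : Type*} [AddCommGroup V] [Module ℂ V]

theorem Local.of_add {e : ℤ} {A B C D : FieldOp V} (hC : ∀ n v, C.modes n v = A.modes n v + B.modes n v)
    (hA : Local e A D) (hB : Local e B D) : Local e C D := by
  obtain ⟨N, hN⟩ := hA.mono_exists
  obtain ⟨M, hM⟩ := hB.mono_exists
  rw [local_iff]
  refine ⟨max N M, fun v => ?_⟩
  have : comm e C D v = comm e A D v + comm e B D v := by
    funext m k
    simp only [comm, hC, map_add, smul_add, Pi.add_apply]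
    abel
  rw [this, iterate_map_add, hN _ (le_max_left _ _), hM _ (le_max_right _ _), add_zero]

theorem Local.of_smul {e : ℤ} {A C D : FieldOp V} (c : ℂ) (hC : ∀ n v, C.modes n v = c • A.modes n v)
    (hA : Local e A D) : Local e C D := by
  rw [local_iff] at hA ⊢
  obtain ⟨N, hN⟩ := hA
  refine ⟨N, fun v => ?_⟩
  have : comm e C D v = fun m k => c • comm e A D v m k := by
    funext m k
    simp only [comm, hC, map_smul, smul_sub, smul_comm c]
  rw [this]
  funext m k
  have := iterate_dif_map (DistribSMul.toAddMonoidHom V c) N (comm e A D v) m k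
  simp only [DistribSMul.toAddMonoidHom_apply] at this
  rw [this, hN]
  simp

theorem Local.of_zero {e : ℤ} {C D : FieldOp V} (hC : ∀ n v, C.modes n v = 0) : Local e C D := by
  rw [local_iff]
  refine ⟨0, fun v => ?_⟩
  funext m k
  simp [comm, hC]

/-- Two fields that are local to a field `u` and agree on `v` agree on the vectors `u_(k) v`. -/
theorem Local.eq_of_eq {e : ℤ} {A B u : FieldOp V} (hA : Local e A u) (hB : Local e B u) {v : V}
    (hv : ∀ n, A.modes n v = B.modes n v) (n k : ℤ) :
    A.modes n (u.modes k v) = B.modes n (u.modes k v) := by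
  obtain ⟨N, hN⟩ := hA.mono_exists
  obtain ⟨M, hM⟩ := hB.mono_exists
  obtain ⟨K, hK⟩ := u.trunc v
  -- Agreement on `v` cancels the terms with `u` on the left. The remainder is killed by a power of
  -- `z - w` and vanishes for large `k`, so it is zero.
  have h1 : comm e A u v - comm e B u v =
      fun m k => A.modes m (u.modes k v) - B.modes m (u.modes k v) := by
    funext m k
    simp only [comm, Pi.sub_apply, hv]
    abel
  have h2 : dif^[max N M] (comm e A u v - comm e B u v) = 0 := by
    rw [iterate_map_sub, hN _ (le_max_left _ _), hM _ (le_max_right _ _), sub_zero]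
  rw [h1] at h2
  have h3 := eq_zero_of_iterate_dif_eq_zero (K := K) _ (fun m k hk => by
    rw [hK k hk, map_zero, map_zero, sub_zero]) h2
  exact sub_eq_zero.mp (congrFun (congrFun h3 n) k)

/-! ### Translation covariance -/

/-- The field `A` satisfies `[T, A(z)] = ∂_z A(z)`. -/
def Covariant (T : V →ₗ[ℂ] V) (A : FieldOp V) : Prop :=
  ∀ n v, T (A.modes n v) = A.modes n (T v) - n • A.modes (n - 1) v

/-- Commuting `T` past both factors gives `∂_z + ∂_w` of the product. Since `(∂_z + ∂_w)(z - w)ⁿ =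
0`, what remains after taking the residue in `z` is the derivative in `w`; `bsum_telescope` is this
cancellation on coefficients. -/
theorem Covariant.fprod {T : V →ₗ[ℂ] V} {A B : FieldOp V} (hA : Covariant T A)
    (hB : Covariant T B) (e n : ℤ) : Covariant T (fprod e n A B) := by
  have half : ∀ (A B : FieldOp V), Covariant T A → Covariant T B → ∀ (a k : ℤ) (v : V),
      bsum (-1) n (fun j : ℕ => T (A.modes (a - j) (B.modes (k + j) v))) =
      bsum (-1) n (fun j : ℕ => A.modes (a - j) (B.modes (k + j) (T v))) -
        ((bsum (-1) n fun j : ℕ => (a - j) • A.modes (a - 1 - j) (B.modes (k + j) v)) +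
        bsum (-1) n fun j : ℕ => (k + j) • A.modes (a - j) (B.modes (k - 1 + j) v)) := by
    intro A B hA hB a k v
    rw [← bsum_add, ← bsum_sub]
    · congr 1
      funext j
      rw [hA, hB, map_sub, map_zsmul]
      ring_nf
      abel
    · exact ev_left _ _ _ _ _
    · exact ((ev_left A B k (a - 1) v).smul _).add ((ev_left A B (k - 1) a v).smul _)
    · exact (ev_left A B k (a - 1) v).smul _
    · exact (ev_left A B (k - 1) a v).smul _
  intro k v
  have tele1 := bsum_telescope n (ev_left A B k (n - 1) v)
    (G := fun j : ℕ => A.modes (n - j) (B.modes (k - 1 + j) v))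
    fun j => by push_cast; ring_nf
  have tele2 := bsum_telescope n (ev_left B A 0 (n + k - 1) v)
    (G := fun j : ℕ => B.modes (n + k - j) (A.modes (0 - 1 + j) v))
    fun j => by push_cast; ring_nf
  have split1 : bsum (-1) n (fun j : ℕ => (k + j) • A.modes (n - j) (B.modes (k - 1 + j) v)) =
      k • bsum (-1) n (fun j : ℕ => A.modes (n - j) (B.modes (k - 1 + j) v)) +
      bsum (-1) n fun j : ℕ => (j : ℤ) • A.modes (n - j) (B.modes (k - 1 + j) v) := by
    rw [← bsum_smul _ _ (ev_left A B (k - 1) n v), ← bsum_add]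
    · simp only [add_smul]
    · exact (ev_left A B (k - 1) n v).smul _
    · exact (ev_left A B (k - 1) n v).smul _
  have split2 : bsum (-1) n (fun j : ℕ => (n + k - j) • B.modes (n + k - 1 - j) (A.modes (0 + j) v)) =
      k • bsum (-1) n (fun j : ℕ => B.modes (n + k - 1 - j) (A.modes (0 + j) v)) +
      bsum (-1) n fun j : ℕ => (n - j) • B.modes (n + k - 1 - j) (A.modes (0 + j) v) := by
    rw [← bsum_smul _ _ (ev_left B A 0 (n + k - 1) v), ← bsum_add]
    · congr 1
      funext j
      rw [← add_smul]
      congr 1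
      ring
    · exact (ev_left B A 0 (n + k - 1) v).smul _
    · exact (ev_left B A 0 (n + k - 1) v).smul _
  have m1 := bsum_map (-1) n (ev_left A B k n v) T.toAddMonoidHom
  have m2 := bsum_map (-1) n (ev_left B A 0 (n + k) v) T.toAddMonoidHom
  simp only [LinearMap.toAddMonoidHom_coe] at m1 m2
  have z1 : bsum (-1) n (fun j : ℕ => (0 + (j : ℤ)) • B.modes (n + k - j) (A.modes (0 - 1 + j) v)) =
      bsum (-1) n fun j : ℕ => (j : ℤ) • B.modes (n + k - j) (A.modes (0 - 1 + j) v) := by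
    simp only [zero_add]
  simp only [fprod_modes, bor]
  rw [map_sub, map_zsmul]
  rw [show (0 : ℤ) + n = n by ring, show n + (k - 1) = n + k - 1 by ring, m1, m2,
    half A B hA hB, half B A hB hA, split1, split2, z1, ← sub_eq_zero]
  rw [eq_neg_of_add_eq_zero_left tele1, eq_neg_of_add_eq_zero_left tele2]
  module

/-- Covariance at the vacuum reads `T A_(n+1) vac = -(n + 1) A_(n) vac`. Starting from the
truncation bound, vanishing descends as long as `n + 1 ≠ 0`. -/
theorem Covariant.modes_vac {T : V →ₗ[ℂ] V} {A : FieldOp V} (hA : Covariant T A) {vac : V}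
    (hT : T vac = 0) {n : ℤ} (hn : 0 ≤ n) : A.modes n vac = 0 := by
  obtain ⟨N, hN⟩ := A.trunc vac
  have key : ∀ (i : ℕ) (n : ℤ), 0 ≤ n → N ≤ n + i → A.modes n vac = 0 := by
    intro i
    induction i with
    | zero => intro n _ h; exact hN n (by simpa using h)
    | succ i ih =>
      intro n hn h
      have h1 := hA (n + 1) vac
      rw [ih (n + 1) (by omega) (by push_cast at h; omega), hT, map_zero, map_zero, zero_sub,
        add_sub_cancel_right, eq_comm, neg_eq_zero, ← Int.cast_smul_eq_zsmul ℂ] at h1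
      refine (smul_eq_zero.mp h1).resolve_left ?_
      exact_mod_cast (by omega : n + 1 ≠ 0)
  exact key (N - n).toNat n hn (by omega)

/-- The series `A(z) vac` solves a first-order equation in `z`, so it is determined by its constant
term. -/
theorem Covariant.vac_ext {T : V →ₗ[ℂ] V} {A B : FieldOp V} (hA : Covariant T A)
    (hB : Covariant T B) {vac : V} (hT : T vac = 0) (h : A.modes (-1) vac = B.modes (-1) vac)
    (n : ℤ) : A.modes n vac = B.modes n vac := by
  by_cases hn : 0 ≤ n
  · rw [hA.modes_vac hT hn, hB.modes_vac hT hn]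
  · obtain ⟨k, rfl⟩ : ∃ k : ℕ, n = -k - 1 := ⟨(-n - 1).toNat, by omega⟩
    clear hn
    induction k with
    | zero => simpa using h
    | succ k ih =>
      have h1 := hA (-k - 1) vac
      have h2 := hB (-k - 1) vac
      rw [ih, h2, hT, map_zero, map_zero, zero_sub, zero_sub, neg_inj, ← sub_eq_zero, ← smul_sub,
        ← Int.cast_smul_eq_zsmul ℂ] at h1
      have h3 := (smul_eq_zero.mp h1).resolve_left
        (by exact_mod_cast (by omega : -(k : ℤ) - 1 ≠ 0))
      rw [show -((k + 1 : ℕ) : ℤ) - 1 = -k - 1 - 1 by push_cast; ring, sub_eq_zero.mp h3]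

/-- Nonnegative modes kill the vacuum, so of the two sums only the term `j = 0` of the first
survives. -/
theorem fprod_modes_vac {T : V →ₗ[ℂ] V} {A B : FieldOp V} (hA : Covariant T A)
    (hB : Covariant T B) {vac : V} (hT : T vac = 0) (e n : ℤ) :
    (fprod e n A B).modes (-1) vac = A.modes n (B.modes (-1) vac) := by
  have h1 : (fun j : ℕ => B.modes (n + -1 - j) (A.modes (0 + j) vac)) = fun _ => 0 := by
    funext j
    rw [hA.modes_vac hT (by omega), map_zero]
  rw [fprod_modes, bor, h1, bsum_zero, smul_zero, sub_zero,
    bsum_eq_range (J := 1) _ _ fun j hj => by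
      rw [hB.modes_vac hT (by omega), map_zero]]
  simp

end FieldCalculus

/-! ## The Fock space of the jet variables -/

namespace Chiral

open FieldCalculus

variable {n m : ℕ}

theorem mulEven_single (u : EvenJet n) (p : Mono n m) (c : ℂ) :
    mulEven u (Finsupp.single p c) = Finsupp.single (p.1 + Finsupp.single u 1, p.2) c := by
  simp [mulEven]

theorem derivEven_single (u : EvenJet n) (p : Mono n m) (c : ℂ) :
    derivEven u (Finsupp.single p c) =
      Finsupp.single (p.1 - Finsupp.single u 1, p.2) (c * p.1 u) := by
  simp [derivEven]

theorem mulOdd_single (u : OddJet m) (p : Mono n m) (c : ℂ) :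
    mulOdd u (Finsupp.single p c) =
      if u ∈ p.2 then 0 else Finsupp.single (p.1, insert u p.2) (c * oddSign u p.2) := by
  rw [mulOdd, Finsupp.linearCombination_single, smul_ite, smul_zero, Finsupp.smul_single, smul_eq_mul]

theorem derivOdd_single (u : OddJet m) (p : Mono n m) (c : ℂ) :
    derivOdd u (Finsupp.single p c) =
      if u ∈ p.2 then Finsupp.single (p.1, p.2.erase u) (c * oddSign u p.2) else 0 := by
  rw [derivOdd, Finsupp.linearCombination_single, smul_ite, smul_zero, Finsupp.smul_single, smul_eq_mul]

theorem parity_single (p : Mono n m) (c : ℂ) :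
    parity (Finsupp.single p c) = Finsupp.single p (c * (-1) ^ p.2.card) := by
  simp [parity]

theorem linearMap_ext {W : Type*} [AddCommGroup W] [Module ℂ W] {f g : Space n m →ₗ[ℂ] W}
    (h : ∀ p, f (Finsupp.single p 1) = g (Finsupp.single p 1)) (v : Space n m) : f v = g v :=
  congrFun (congrArg DFunLike.coe (Finsupp.lhom_ext' fun p => LinearMap.ext_ring (h p) : f = g)) v

theorem mulEven_mulEven (u v : EvenJet n) (x : Space n m) :
    mulEven u (mulEven v x) = mulEven v (mulEven u x) :=
  linearMap_ext (f := mulEven u ∘ₗ mulEven v) (g := mulEven v ∘ₗ mulEven u) (fun p => by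
    simp [mulEven_single, add_right_comm]) x

theorem derivEven_derivEven (u v : EvenJet n) (x : Space n m) :
    derivEven u (derivEven v x) = derivEven v (derivEven u x) :=
  linearMap_ext (f := derivEven u ∘ₗ derivEven v) (g := derivEven v ∘ₗ derivEven u) (fun p => by
    simp only [LinearMap.comp_apply, derivEven_single, tsub_right_comm]
    congr 1
    by_cases h : u = v
    · rw [h]
    · have h' := Ne.symm h
      simp [h, h', mul_comm]) x

theorem derivEven_mulEven (u v : EvenJet n) (x : Space n m) :
    derivEven u (mulEven v x) = mulEven v (derivEven u x) + if u = v then x else 0 := by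
  by_cases h : u = v
  · subst h
    refine linearMap_ext (f := derivEven u ∘ₗ mulEven u)
      (g := mulEven u ∘ₗ derivEven u + LinearMap.id) (fun p => ?_) x |>.trans (by simp)
    simp only [LinearMap.comp_apply, LinearMap.add_apply, LinearMap.id_apply, derivEven_single,
      mulEven_single, add_tsub_cancel_right]
    by_cases hp : p.1 u = 0
    · simp [hp]
    · rw [tsub_add_cancel_of_le (Finsupp.single_le_iff.mpr (Nat.one_le_iff_ne_zero.mpr hp)),
        ← Finsupp.single_add]
      simp
  · rw [if_neg h, add_zero]
    refine linearMap_ext (f := derivEven u ∘ₗ mulEven v) (g := mulEven v ∘ₗ derivEven u)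
      (fun p => ?_) x
    simp only [LinearMap.comp_apply, derivEven_single, mulEven_single, Finsupp.add_apply,
      Finsupp.single_apply, if_neg (Ne.symm h), add_zero]
    congr 2
    ext w
    simp only [Finsupp.tsub_apply, Finsupp.add_apply, Finsupp.single_apply]
    by_cases hw : u = w
    · subst hw
      simp [Ne.symm h]
    · simp [hw]

theorem oddSign_insert (u v : OddJet m) {S : Finset (OddJet m)} (hv : v ∉ S) :
    oddSign u (insert v S) = (if v < u then -1 else 1) * oddSign u S := by
  unfold oddSign
  rw [Finset.filter_insert]
  split_ifs
  · rw [Finset.card_insert_of_notMem (by simp [hv]), pow_succ']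
  · simp

theorem oddSign_erase (u v : OddJet m) {S : Finset (OddJet m)} (hv : v ∈ S) :
    oddSign u (S.erase v) = (if v < u then -1 else 1) * oddSign u S := by
  have h := oddSign_insert u v (Finset.notMem_erase v S)
  rw [Finset.insert_erase hv] at h
  rw [h, ← mul_assoc]
  split_ifs <;> simp

theorem oddSign_mul_self (u : OddJet m) (S : Finset (OddJet m)) : oddSign u S * oddSign u S = 1 := by
  unfold oddSign
  rw [← mul_pow]; simp

theorem mulOdd_mulOdd (u v : OddJet m) (x : Space n m) :
    mulOdd u (mulOdd v x) = -mulOdd v (mulOdd u x) := by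
  refine linearMap_ext (f := mulOdd u ∘ₗ mulOdd v) (g := -(mulOdd v ∘ₗ mulOdd u)) (fun p => ?_) x
  simp only [LinearMap.comp_apply, LinearMap.neg_apply, mulOdd_single]
  by_cases h : u = v
  · subst h
    split_ifs with h1 <;> simp [mulOdd_single]
  · have h' := Ne.symm h
    by_cases h1 : v ∈ p.2 <;> by_cases h2 : u ∈ p.2 <;>
      simp [h1, h2, mulOdd_single, h, h', oddSign_insert]
    rw [Finset.insert_comm, ← Finsupp.single_neg]
    congr 1
    rcases lt_or_gt_of_ne h with h3 | h3 <;> simp [h3, h3.not_gt, mul_comm]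

theorem derivOdd_derivOdd (u v : OddJet m) (x : Space n m) :
    derivOdd u (derivOdd v x) = -derivOdd v (derivOdd u x) := by
  refine linearMap_ext (f := derivOdd u ∘ₗ derivOdd v) (g := -(derivOdd v ∘ₗ derivOdd u))
    (fun p => ?_) x
  simp only [LinearMap.comp_apply, LinearMap.neg_apply, derivOdd_single]
  by_cases h : u = v
  · subst h
    split_ifs with h1 <;> simp [derivOdd_single]
  · have h' := Ne.symm h
    by_cases h1 : v ∈ p.2 <;> by_cases h2 : u ∈ p.2 <;>
      simp [h1, h2, derivOdd_single, h, h', oddSign_erase]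
    rw [Finset.erase_right_comm, ← Finsupp.single_neg]
    congr 1
    rcases lt_or_gt_of_ne h with h3 | h3 <;> simp [h3, h3.not_gt, mul_comm]

theorem derivOdd_mulOdd (u v : OddJet m) (x : Space n m) :
    derivOdd u (mulOdd v x) = -mulOdd v (derivOdd u x) + if u = v then x else 0 := by
  by_cases h : u = v
  · subst h
    refine linearMap_ext (f := derivOdd u ∘ₗ mulOdd u)
      (g := -(mulOdd u ∘ₗ derivOdd u) + LinearMap.id) (fun p => ?_) x |>.trans (by simp)
    simp only [LinearMap.comp_apply, LinearMap.neg_apply, LinearMap.add_apply, LinearMap.id_apply,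
      derivOdd_single, mulOdd_single]
    by_cases h1 : u ∈ p.2
    · simp [h1, mulOdd_single, oddSign_erase, oddSign_mul_self]
    · simp [h1, derivOdd_single, oddSign_insert, oddSign_mul_self]
  · rw [if_neg h, add_zero]
    refine linearMap_ext (f := derivOdd u ∘ₗ mulOdd v) (g := -(mulOdd v ∘ₗ derivOdd u))
      (fun p => ?_) x
    have h' := Ne.symm h
    simp only [LinearMap.comp_apply, LinearMap.neg_apply, derivOdd_single, mulOdd_single]
    by_cases h1 : v ∈ p.2 <;> by_cases h2 : u ∈ p.2 <;>
      simp [h1, h2, derivOdd_single, mulOdd_single, h, h', oddSign_erase, oddSign_insert]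
    rw [Finset.erase_insert_of_ne h', ← Finsupp.single_neg]
    congr 1
    rcases lt_or_gt_of_ne h with h3 | h3 <;> simp [h3, h3.not_gt, mul_comm]

theorem mulEven_mulOdd (u : EvenJet n) (v : OddJet m) (x : Space n m) :
    mulEven u (mulOdd v x) = mulOdd v (mulEven u x) :=
  linearMap_ext (f := mulEven u ∘ₗ mulOdd v) (g := mulOdd v ∘ₗ mulEven u) (fun p => by
    by_cases h : v ∈ p.2 <;> simp [mulEven_single, mulOdd_single, h]) x

theorem mulEven_derivOdd (u : EvenJet n) (v : OddJet m) (x : Space n m) :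
    mulEven u (derivOdd v x) = derivOdd v (mulEven u x) :=
  linearMap_ext (f := mulEven u ∘ₗ derivOdd v) (g := derivOdd v ∘ₗ mulEven u) (fun p => by
    by_cases h : v ∈ p.2 <;> simp [mulEven_single, derivOdd_single, h]) x

theorem derivEven_mulOdd (u : EvenJet n) (v : OddJet m) (x : Space n m) :
    derivEven u (mulOdd v x) = mulOdd v (derivEven u x) :=
  linearMap_ext (f := derivEven u ∘ₗ mulOdd v) (g := mulOdd v ∘ₗ derivEven u) (fun p => by
    by_cases h : v ∈ p.2 <;> simp [derivEven_single, mulOdd_single, h, mul_comm]) x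

theorem derivEven_derivOdd (u : EvenJet n) (v : OddJet m) (x : Space n m) :
    derivEven u (derivOdd v x) = derivOdd v (derivEven u x) :=
  linearMap_ext (f := derivEven u ∘ₗ derivOdd v) (g := derivOdd v ∘ₗ derivEven u) (fun p => by
    by_cases h : v ∈ p.2 <;> simp [derivEven_single, derivOdd_single, h, mul_comm]) x

/-! ### The generating fields -/

/-- The cohomological degree of a generator. -/
def gdeg : Gen n m → ℤ
  | Sum.inl _ => 0
  | Sum.inr (_, b) => if b = true then 1 else -1

/-- The pairing of the generators. -/
def pair : Gen n m → Gen n m → ℂ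
  | Sum.inl (i, b), Sum.inl (j, c) => if i = j then (if b = c then 0 else if b then 1 else -1) else 0
  | Sum.inr (i, b), Sum.inr (j, c) => if i = j ∧ c = !b then 1 else 0
  | _, _ => 0

/-- The sign `(-1)^{pq}`. -/
def sgn (p q : ℤ) : ℤ := (Int.negOnePow (p * q) : ℤ)

theorem sgn_comm (p q : ℤ) : sgn p q = sgn q p := by rw [sgn, sgn, mul_comm]

theorem sgn_mul_self (p q : ℤ) : sgn p q * sgn p q = 1 := by
  simp [sgn, ← Units.val_mul]

theorem sgn_add_left (p q r : ℤ) : sgn (p + q) r = sgn p r * sgn q r := by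
  rw [sgn, add_mul, Int.negOnePow_add, Units.val_mul]; rfl

theorem sgn_add_right (p q r : ℤ) : sgn p (q + r) = sgn p q * sgn p r := by
  rw [sgn, mul_add, Int.negOnePow_add, Units.val_mul]; rfl

theorem sgn_zero_left (q : ℤ) : sgn 0 q = 1 := by simp [sgn]

theorem sgn_zero_right (q : ℤ) : sgn q 0 = 1 := by simp [sgn]

theorem sgn_odd (i j : Fin m) (b c : Bool) :
    sgn (gdeg (Sum.inr (i, b) : Gen n m)) (gdeg (Sum.inr (j, c) : Gen n m)) = -1 := by
  cases b <;> cases c <;> simp [sgn, gdeg]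

theorem oddJet_inj {i j : Fin m} {b c : Bool} {k l : ℕ} :
    oddJet i b k = oddJet j c l ↔ i = j ∧ b = c ∧ k = l := by
  simp [oddJet]

theorem create_create (u v : Gen n m) (k l : ℕ) (x : Space n m) :
    create u k (create v l x) = sgn (gdeg u) (gdeg v) • create v l (create u k x) := by
  rcases u with u | ⟨i, b⟩ <;> rcases v with v | ⟨j, c⟩
  · simp [create, gdeg, sgn_zero_left, mulEven_mulEven (u, k)]
  · simp [create, gdeg, sgn_zero_left, mulEven_mulOdd]
  · simp [create, gdeg, sgn_zero_right, mulEven_mulOdd]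
  · rw [sgn_odd]; simp [create, mulOdd_mulOdd (oddJet i b k)]

theorem annihilate_annihilate (u v : Gen n m) (k l : ℕ) (x : Space n m) :
    annihilate u k (annihilate v l x) = sgn (gdeg u) (gdeg v) • annihilate v l (annihilate u k x) := by
  rcases u with ⟨i, _ | _⟩ | ⟨i, b⟩ <;> rcases v with ⟨j, _ | _⟩ | ⟨j, c⟩
  all_goals first
    | rw [sgn_odd]; simp [annihilate, derivOdd_derivOdd (oddJet i (!b) k)]
    | simp [annihilate, gdeg, sgn_zero_left, sgn_zero_right, derivEven_derivOdd,
        derivEven_derivEven ((i, _), k)]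

theorem annihilate_create (u v : Gen n m) (k l : ℕ) (x : Space n m) :
    annihilate u k (create v l x) = sgn (gdeg u) (gdeg v) • create v l (annihilate u k x) +
      if k = l then pair u v • x else 0 := by
  rcases u with ⟨i, _ | _⟩ | ⟨i, b⟩ <;> rcases v with ⟨j, _ | _⟩ | ⟨j, c⟩
  all_goals first
    | rw [sgn_odd]
      simp only [annihilate, create, derivOdd_mulOdd, oddJet_inj, pair]
      by_cases h1 : i = j <;> by_cases h2 : k = l <;> cases b <;> cases c <;> simp [h1, h2]
    | simp only [annihilate, create, gdeg, sgn_zero_left, sgn_zero_right, derivEven_mulOdd,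
        mulEven_derivOdd, derivEven_mulEven, pair, LinearMap.neg_apply, map_neg, one_smul]
      by_cases h1 : i = j <;> by_cases h2 : k = l <;> simp [h1, h2] <;> abel
    | simp [annihilate, create, gdeg, sgn_zero_left, sgn_zero_right, derivEven_mulOdd,
        mulEven_derivOdd, pair]

theorem pair_symm (u v : Gen n m) : pair u v = -((sgn (gdeg u) (gdeg v) : ℤ) : ℂ) * pair v u := by
  rcases u with ⟨i, _ | _⟩ | ⟨i, b⟩ <;> rcases v with ⟨j, _ | _⟩ | ⟨j, c⟩
  all_goals first
    | rw [sgn_odd]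
      by_cases h1 : i = j
      · cases b <;> cases c <;> simp [h1, pair]
      · simp [pair, h1, Ne.symm h1]
    | by_cases h1 : i = j
      · simp [pair, h1, gdeg, sgn_zero_left]
      · simp [pair, h1, Ne.symm h1, gdeg, sgn_zero_left]
    | simp [pair]

/-- The modes of the field of a generator. -/
def genMode (u : Gen n m) (l : ℤ) : Space n m →ₗ[ℂ] Space n m :=
  if l < 0 then create u (-l - 1).toNat else annihilate u l.toNat

theorem genMode_neg (u : Gen n m) (k : ℕ) : genMode u (-k - 1) = create u k := by
  rw [genMode, if_pos (by omega)]
  congr 1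
  omega

theorem genMode_natCast (u : Gen n m) (k : ℕ) : genMode u k = annihilate u k := by
  rw [genMode, if_neg (by omega)]
  congr 1

theorem exists_mode (l : ℤ) : (∃ k : ℕ, l = -k - 1) ∨ ∃ k : ℕ, l = k := by
  by_cases h : l < 0
  · exact Or.inl ⟨(-l - 1).toNat, by omega⟩
  · exact Or.inr ⟨l.toNat, by omega⟩

/-- The canonical relations in a single formula: `[u_(k), v_(l)]` is the pairing times `δ_{k+l,-1}`.
The order creation before annihilation agrees with the other one because of `pair_symm`. -/
theorem genMode_genMode (u v : Gen n m) (k l : ℤ) (x : Space n m) :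
    genMode u k (genMode v l x) = sgn (gdeg u) (gdeg v) • genMode v l (genMode u k x) +
      if k + l = -1 then pair u v • x else 0 := by
  obtain ⟨k, rfl⟩ | ⟨k, rfl⟩ := exists_mode k <;> obtain ⟨l, rfl⟩ | ⟨l, rfl⟩ := exists_mode l <;>
    simp only [genMode_neg, genMode_natCast]
  · rw [create_create, if_neg (by omega), add_zero]
  · rw [annihilate_create v u, sgn_comm (gdeg v), smul_add, smul_smul, sgn_mul_self, one_smul,
      add_assoc, left_eq_add]
    by_cases h : l = k
    · rw [if_pos h, if_pos (by omega), pair_symm u v, ← Int.cast_smul_eq_zsmul ℂ, smul_smul,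
        ← add_smul]
      simp
    · rw [if_neg h, if_neg (by omega)]; simp
  · rw [annihilate_create]
    congr 1
    by_cases h : k = l
    · rw [if_pos h, if_pos (by omega)]
    · rw [if_neg h, if_neg (by omega)]
  · rw [annihilate_annihilate, if_neg (by omega), add_zero]

/-- A vector involves finitely many jets, so one bound serves all generators at once. -/
theorem exists_annihilate_eq_zero (v : Space n m) :
    ∃ N : ℕ, ∀ (u : Gen n m) (k : ℕ), N ≤ k → annihilate u k v = 0 := by
  induction v using Finsupp.induction_linear with
  | zero => exact ⟨0, by simp⟩
  | add v w hv hw =>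
    obtain ⟨N, hN⟩ := hv
    obtain ⟨M, hM⟩ := hw
    exact ⟨max N M, fun u k hk => by
      rw [map_add, hN u k ((le_max_left _ _).trans hk), hM u k ((le_max_right _ _).trans hk),
        add_zero]⟩
  | single p c =>
    obtain ⟨N, hN⟩ := (p.1.support.image fun u => u.2).exists_le
    obtain ⟨M, hM⟩ := (p.2.image fun u => (ofLex (ofLex u).2).2).exists_le
    refine ⟨max N M + 1, fun u k hk => ?_⟩
    have h1 : ∀ a, p.1 (a, k) = 0 := by
      intro a
      by_contra h
      have := hN k (Finset.mem_image.mpr ⟨(a, k), Finsupp.mem_support_iff.mpr h, rfl⟩)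
      have := le_max_left N M
      omega
    have h2 : ∀ i b, oddJet i b k ∉ p.2 := by
      intro i b h
      have := hM k (Finset.mem_image.mpr ⟨_, h, rfl⟩)
      have := le_max_right N M
      omega
    rcases u with ⟨i, _ | _⟩ | ⟨i, b⟩ <;>
      simp [annihilate, derivEven_single, derivOdd_single, h1, h2]

/-- The field of a generator. -/
def genField (u : Gen n m) : FieldOp (Space n m) where
  modes := genMode u
  trunc v := by
    obtain ⟨N, hN⟩ := exists_annihilate_eq_zero v
    refine ⟨N, fun l hl => ?_⟩
    rw [genMode, if_neg (by omega)]
    exact hN _ _ (by omega)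

/-- The commutator of modes depends only on `k + l`; it is a multiple of the delta function, which
`z - w` kills. -/
theorem local_genField (u v : Gen n m) : Local (sgn (gdeg u) (gdeg v)) (genField u) (genField v) := by
  rw [local_iff]
  refine ⟨1, fun x => ?_⟩
  have : FieldCalculus.comm (sgn (gdeg u) (gdeg v)) (genField u) (genField v) x =
      fun k l => if k + l = -1 then pair u v • x else 0 := by
    funext k l
    simp only [FieldCalculus.comm, genField, genMode_genMode u v k l, add_sub_cancel_left]
  rw [this]
  funext k l
  rw [Function.iterate_one, dif_apply, show k + 1 + l = k + (l + 1) by ring, sub_self]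
  rfl

end Chiral

/-! ### Fields that rescale under an operator, and the identity field -/

namespace FieldCalculus

variable {V : Type*} [AddCommGroup V] [Module ℂ V]

/-- The operator `S` commutes with the modes of `A` up to the factor `a`. -/
def Scales (S : V →ₗ[ℂ] V) (a : ℂ) (A : FieldOp V) : Prop :=
  ∀ n v, S (A.modes n v) = a • A.modes n (S v)

/-- Carries homogeneity from generators to all fields. The operator is later `degScale c`, with `c =
-1` for parity and `c = 2` for the degree. -/
theorem Scales.fprod {S : V →ₗ[ℂ] V} {a b : ℂ} {A B : FieldOp V} (hA : Scales S a A)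
    (hB : Scales S b B) (e n : ℤ) : Scales S (a * b) (fprod e n A B) := by
  intro k v
  have m1 := bsum_map (-1) n (ev_left A B k (0 + n) v) S.toAddMonoidHom
  have m2 := bsum_map (-1) n (ev_left B A 0 (n + k) v) S.toAddMonoidHom
  simp only [LinearMap.toAddMonoidHom_coe] at m1 m2
  simp only [fprod_modes, bor]
  rw [map_sub, map_zsmul, m1, m2, smul_sub, smul_comm (a * b) (e * _),
    ← bsum_smul _ _ (ev_left _ _ _ _ _), ← bsum_smul _ _ (ev_left _ _ _ _ _)]
  congr 3 <;> funext j
  · rw [hA, hB, map_smul, smul_smul]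
  · rw [hB, hA, map_smul, smul_smul, mul_comm b]

/-- The identity field. -/
def oneField : FieldOp V where
  modes l := if l = -1 then LinearMap.id else 0
  trunc v := ⟨0, fun n hn => by rw [if_neg (by omega)]; rfl⟩

theorem oneField_modes (l : ℤ) (v : V) : (oneField.modes l) v = if l = -1 then v else 0 := by
  simp only [oneField]
  split_ifs <;> rfl

theorem local_oneField (A : FieldOp V) : Local 1 oneField A := by
  rw [local_iff]
  refine ⟨0, fun v => ?_⟩
  funext m k
  simp only [comm, oneField_modes, Function.iterate_zero, id, one_smul]
  split_ifs <;> simp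

theorem covariant_oneField (T : V →ₗ[ℂ] V) : Covariant T oneField := by
  intro n v
  simp only [oneField_modes]
  by_cases h : n = -1
  · subst h; simp
  · rw [if_neg h, if_neg h]
    by_cases h0 : n = 0
    · simp [h0]
    · rw [if_neg (by omega)]; simp

theorem scales_oneField (S : V →ₗ[ℂ] V) : Scales S 1 oneField := by
  intro n v
  simp only [oneField_modes, one_smul]
  split_ifs <;> simp

end FieldCalculus

namespace Chiral

open FieldCalculus

variable {n m : ℕ}

/-! ### The translation operator -/

/-- The generator that pairs with a given one. -/
def dual : Gen n m → Gen n m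
  | Sum.inl (i, b) => Sum.inl (i, !b)
  | Sum.inr (i, b) => Sum.inr (i, !b)

/-- The sign for which `dualSign u • annihilate (dual u) k` is the derivative in `u^{(k)}`. -/
def dualSign : Gen n m → ℂ
  | Sum.inl (_, b) => if b then -1 else 1
  | Sum.inr _ => 1

theorem dual_dual (u : Gen n m) : dual (dual u) = u := by
  rcases u with ⟨i, b⟩ | ⟨i, b⟩ <;> simp [dual]

theorem gdeg_dual (u : Gen n m) : gdeg (dual u) = -gdeg u := by
  rcases u with ⟨i, b⟩ | ⟨i, _ | _⟩ <;> simp [dual, gdeg]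

theorem dualSign_mul_pair (u v : Gen n m) :
    dualSign u * pair (dual u) v = if u = v then 1 else 0 := by
  rcases u with ⟨i, _ | _⟩ | ⟨i, _ | _⟩ <;> rcases v with ⟨j, _ | _⟩ | ⟨j, _ | _⟩ <;>
    first
    | by_cases h : i = j <;> simp [dual, dualSign, pair, h]
    | simp [dual, dualSign, pair]

theorem sgn_gdeg_dual (u v : Gen n m) : sgn (gdeg (dual u)) (gdeg v) = sgn (gdeg u) (gdeg v) := by
  simp [sgn, gdeg_dual]

/-- The part of the translation operator that involves the jets of order less than `N`. -/
def translationBelow (N : ℕ) (v : Space n m) : Space n m :=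
  ∑ u : Gen n m, ∑ k ∈ Finset.range N,
    (((k : ℂ) + 1) * dualSign u) • create u (k + 1) (annihilate (dual u) k v)

theorem translation_single (p : Mono n m) (c : ℂ) : translation (Finsupp.single p c) =
    c • ((∑ u ∈ p.1.support, ((u.2 : ℂ) + 1) •
      mulEven (u.1, u.2 + 1) (derivEven u (Finsupp.single p (1 : ℂ)))) +
    (∑ u ∈ p.2, (((ofLex (ofLex u).2).2 : ℂ) + 1) •
      mulOdd (oddJet (ofLex u).1 (ofLex (ofLex u).2).1 ((ofLex (ofLex u).2).2 + 1))
        (derivOdd u (Finsupp.single p (1 : ℂ))))) := by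
  rw [translation, Finsupp.linearCombination_single]

/-- The defining sum of `T` ranges over variables depending on the monomial. A range depending only
on a bound, written with creation and annihilation operators, lets the commutators with `T` be
computed termwise. -/
theorem exists_translation_eq (v : Space n m) :
    ∃ N₀ : ℕ, ∀ N, N₀ ≤ N → translation v = translationBelow N v := by
  induction v using Finsupp.induction_linear with
  | zero => exact ⟨0, fun N _ => by simp [translationBelow]⟩
  | add v w hv hw =>
    obtain ⟨N, hN⟩ := hv
    obtain ⟨M, hM⟩ := hw
    refine ⟨max N M, fun K hK => ?_⟩
    rw [map_add, hN K ((le_max_left _ _).trans hK), hM K ((le_max_right _ _).trans hK)]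
    simp only [translationBelow, map_add, smul_add, Finset.sum_add_distrib]
  | single p c =>
    obtain ⟨N, hN⟩ := (p.1.support.image fun u => u.2).exists_le
    obtain ⟨M, hM⟩ := (p.2.image fun u => (ofLex (ofLex u).2).2).exists_le
    refine ⟨max N M + 1, fun K hK => ?_⟩
    have e1 : ∑ u ∈ p.1.support, ((u.2 : ℂ) + 1) •
        mulEven (u.1, u.2 + 1) (derivEven u (Finsupp.single p (1 : ℂ))) =
        ∑ u ∈ (Finset.univ : Finset (Fin n × Bool)) ×ˢ Finset.range K, ((u.2 : ℂ) + 1) •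
        mulEven (u.1, u.2 + 1) (derivEven u (Finsupp.single p (1 : ℂ))) := by
      refine Finset.sum_subset (fun u hu => ?_) fun u _ hu => ?_
      · have := hN _ (Finset.mem_image_of_mem _ hu)
        have := le_max_left N M
        simp only [Finset.mem_product, Finset.mem_univ, Finset.mem_range, true_and]
        omega
      · rw [derivEven_single, Finsupp.notMem_support_iff.mp hu]; simp
    let φ : (Fin m × Bool) × ℕ → OddJet m := fun u => oddJet u.1.1 u.1.2 u.2
    have hφ : Function.Injective φ := by
      rintro ⟨⟨i, b⟩, k⟩ ⟨⟨j, c⟩, l⟩ h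
      obtain ⟨rfl, rfl, rfl⟩ := oddJet_inj.mp h
      rfl
    have e2 : ∑ u ∈ p.2, (((ofLex (ofLex u).2).2 : ℂ) + 1) •
        mulOdd (oddJet (ofLex u).1 (ofLex (ofLex u).2).1 ((ofLex (ofLex u).2).2 + 1))
          (derivOdd u (Finsupp.single p (1 : ℂ))) =
        ∑ u ∈ (Finset.univ : Finset (Fin m × Bool)) ×ˢ Finset.range K, ((u.2 : ℂ) + 1) •
        mulOdd (oddJet u.1.1 u.1.2 (u.2 + 1))
          (derivOdd (oddJet u.1.1 u.1.2 u.2) (Finsupp.single p (1 : ℂ))) := by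
      rw [Finset.sum_subset (s₂ := ((Finset.univ : Finset (Fin m × Bool)) ×ˢ Finset.range K).image φ),
        Finset.sum_image hφ.injOn]
      · rfl
      · intro u hu
        have := hM _ (Finset.mem_image_of_mem _ hu)
        have := le_max_right N M
        refine Finset.mem_image.mpr ⟨(((ofLex u).1, (ofLex (ofLex u).2).1), (ofLex (ofLex u).2).2),
          ?_, rfl⟩
        simp only [Finset.mem_product, Finset.mem_univ, Finset.mem_range, true_and]
        omega
      · intro u _ hu
        rw [derivOdd_single, if_neg hu]; simp
    have hc : Finsupp.single p c = c • Finsupp.single p (1 : ℂ) := by simp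
    have hs : ∀ v : Space n m, translationBelow K (c • v) = c • translationBelow K v := fun v => by
      simp only [translationBelow, map_smul, Finset.smul_sum, smul_comm c]
    rw [translation_single, e1, e2, hc, hs, translationBelow, Fintype.sum_sum_type,
      Finset.sum_product, Finset.sum_product]
    refine congrArg _ (congrArg₂ _ ?_ ?_)
    · refine Finset.sum_congr rfl fun u _ => Finset.sum_congr rfl fun k _ => ?_
      obtain ⟨i, _ | _⟩ := u
      · simp [dual, dualSign, annihilate, create]
      · simp only [dual, dualSign, annihilate, create, Bool.not_true, LinearMap.neg_apply, map_neg,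
          if_true]
        module
    · refine Finset.sum_congr rfl fun u _ => Finset.sum_congr rfl fun k _ => ?_
      obtain ⟨i, b⟩ := u
      simp [dual, dualSign, annihilate, create]

theorem translation_create (u : Gen n m) (k : ℕ) (v : Space n m) :
    translation (create u k v) =
      create u k (translation v) + ((k : ℂ) + 1) • create u (k + 1) v := by
  obtain ⟨N, hN⟩ := exists_translation_eq v
  obtain ⟨M, hM⟩ := exists_translation_eq (create u k v)
  have hk : k ∈ Finset.range (max (max N M) (k + 1)) := Finset.mem_range.mpr (by omega)
  rw [hN (max (max N M) (k + 1)) (by omega), hM (max (max N M) (k + 1)) (by omega)]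
  simp only [translationBelow]
  have h : ∀ (w : Gen n m) (j : ℕ), (((j : ℂ) + 1) * dualSign w) •
      create w (j + 1) (annihilate (dual w) j (create u k v)) =
      create u k ((((j : ℂ) + 1) * dualSign w) • create w (j + 1) (annihilate (dual w) j v)) +
      if j = k then (if w = u then ((j : ℂ) + 1) • create w (j + 1) v else 0) else 0 := by
    intro w j
    rw [annihilate_create, map_add, map_zsmul, create_create w u, sgn_gdeg_dual, smul_smul,
      sgn_mul_self, one_smul, smul_add, map_smul]
    congr 1
    by_cases hj : j = k
    · rw [if_pos hj, if_pos hj, map_smul, smul_smul, mul_assoc, dualSign_mul_pair]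
      by_cases hw : w = u <;> simp [hw]
    · simp [hj]
  simp only [h, Finset.sum_add_distrib, ← map_sum]
  congr 1
  rw [Finset.sum_eq_single u, Finset.sum_eq_single k]
  · simp
  · intro j _ hj; simp [hj]
  · intro h; exact absurd hk h
  · intro w _ hw; simp [hw]
  · intro h; exact absurd (Finset.mem_univ u) h

theorem translation_annihilate (u : Gen n m) (k : ℕ) (v : Space n m) :
    translation (annihilate u k v) =
      annihilate u k (translation v) - (k : ℂ) • annihilate u (k - 1) v := by
  obtain ⟨N, hN⟩ := exists_translation_eq v
  obtain ⟨M, hM⟩ := exists_translation_eq (annihilate u k v)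
  rw [hN (max (max N M) (k + 1)) (by omega), hM (max (max N M) (k + 1)) (by omega)]
  simp only [translationBelow]
  have hpair : ∀ w : Gen n m, dualSign w * pair u w = if w = dual u then 1 else 0 := by
    intro w
    have := dualSign_mul_pair w (dual u)
    by_cases hw : w = dual u
    · subst hw
      rwa [dual_dual] at this
    · rw [if_neg hw]
      rcases u with ⟨i, _ | _⟩ | ⟨i, _ | _⟩ <;> rcases w with ⟨j, _ | _⟩ | ⟨j, _ | _⟩ <;>
        simp_all [dual, pair, eq_comm]
  have h : ∀ (w : Gen n m) (j : ℕ), (((j : ℂ) + 1) * dualSign w) •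
      create w (j + 1) (annihilate (dual w) j (annihilate u k v)) =
      annihilate u k ((((j : ℂ) + 1) * dualSign w) • create w (j + 1) (annihilate (dual w) j v)) -
      if k = j + 1 then (if w = dual u then ((j : ℂ) + 1) • annihilate (dual w) j v else 0)
        else 0 := by
    intro w j
    rw [annihilate_annihilate, map_zsmul, sgn_gdeg_dual, map_smul, annihilate_create u w,
      sgn_comm (gdeg u), smul_add, add_sub_assoc, left_eq_add]
    by_cases hj : k = j + 1
    · rw [if_pos hj, if_pos hj, smul_smul, mul_assoc, hpair]
      by_cases hw : w = dual u <;> simp [hw]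
    · simp [hj]
  simp only [h, Finset.sum_sub_distrib, ← map_sum]
  congr 1
  rw [Finset.sum_eq_single (dual u)]
  · cases k with
    | zero => simp
    | succ k =>
      rw [Finset.sum_eq_single k]
      · simp [dual_dual]
      · intro j _ hj; rw [if_neg (by omega)]
      · intro h; exact absurd (Finset.mem_range.mpr (by omega)) h
  · intro w _ hw; simp [hw]
  · intro h; exact absurd (Finset.mem_univ _) h

theorem covariant_genField (u : Gen n m) : Covariant translation (genField u) := by
  intro l v
  simp only [genField]
  obtain ⟨k, rfl⟩ | ⟨k, rfl⟩ := exists_mode l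
  · rw [show (-(k : ℤ) - 1 - 1) = -((k + 1 : ℕ) : ℤ) - 1 by push_cast; ring, genMode_neg,
      genMode_neg, translation_create, ← Int.cast_smul_eq_zsmul ℂ]
    push_cast
    module
  · rw [genMode_natCast, translation_annihilate]
    cases k with
    | zero => simp
    | succ k =>
      rw [show ((k + 1 : ℕ) : ℤ) - 1 = k by push_cast; ring, genMode_natCast,
        ← Int.cast_smul_eq_zsmul ℂ]
      simp

theorem translation_vacuum : translation (vacuum : Space n m) = 0 := by
  simp [vacuum, translation_single]

/-! ### The cohomological grading -/

/-- The operator that acts by `cᵖ` in degree `p`. -/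
def degScale (c : ℂ) : Space n m →ₗ[ℂ] Space n m :=
  Finsupp.linearCombination ℂ fun p : Mono n m => Finsupp.single p (c ^ cohDeg p)

theorem degScale_single (c : ℂ) (p : Mono n m) (a : ℂ) :
    degScale c (Finsupp.single p a) = Finsupp.single p (a * c ^ cohDeg p) := by
  simp [degScale]

theorem cohDeg_insert {p : EvenJet n →₀ ℕ} {S : Finset (OddJet m)} {i : Fin m} {b : Bool} {k : ℕ}
    (h : oddJet i b k ∉ S) : cohDeg (n := n) (p, insert (oddJet i b k) S) =
      gdeg (Sum.inr (i, b) : Gen n m) + cohDeg (n := n) (p, S) := by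
  simp only [cohDeg, Finset.sum_insert h]
  rfl

theorem scales_genField {c : ℂ} (hc : c ≠ 0) (u : Gen n m) :
    Scales (degScale c) (c ^ gdeg u) (genField u) := by
  have hcreate : ∀ (u : Gen n m) (k : ℕ) (v : Space n m),
      degScale c (create u k v) = c ^ gdeg u • create u k (degScale c v) := by
    intro u k v
    refine linearMap_ext (f := degScale c ∘ₗ create u k)
      (g := c ^ gdeg u • create u k ∘ₗ degScale c) (fun p => ?_) v
    rcases u with u | ⟨i, b⟩
    · simp [create, mulEven_single, degScale_single, gdeg, cohDeg]
    · by_cases h : oddJet i b k ∈ p.2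
      · simp [create, mulOdd_single, degScale_single, h]
      · simp only [create, mulOdd_single, degScale_single, h, LinearMap.comp_apply,
          LinearMap.smul_apply, if_false, cohDeg_insert h, zpow_add₀ hc, Finsupp.smul_single,
          smul_eq_mul]
        congr 1; ring
  have hann : ∀ (u : Gen n m) (k : ℕ) (v : Space n m),
      degScale c (annihilate u k v) = c ^ gdeg u • annihilate u k (degScale c v) := by
    intro u k v
    refine linearMap_ext (f := degScale c ∘ₗ annihilate u k)
      (g := c ^ gdeg u • annihilate u k ∘ₗ degScale c) (fun p => ?_) v
    rcases u with ⟨i, _ | _⟩ | ⟨i, b⟩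
    · simp [annihilate, derivEven_single, degScale_single, gdeg, cohDeg, mul_comm]
    · simp [annihilate, derivEven_single, degScale_single, gdeg, cohDeg, mul_comm]
    · by_cases h : oddJet i (!b) k ∈ p.2
      · have h1 : cohDeg p = -gdeg (Sum.inr (i, b) : Gen n m) +
            cohDeg (n := n) (p.1, p.2.erase (oddJet i (!b) k)) := by
          have := cohDeg_insert (p := p.1) (Finset.notMem_erase (oddJet i (!b) k) p.2)
          rw [Finset.insert_erase h] at this
          rw [← gdeg_dual]
          exact this
        simp only [annihilate, derivOdd_single, degScale_single, h, LinearMap.comp_apply,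
          LinearMap.smul_apply, if_true, h1, zpow_add₀ hc, Finsupp.smul_single,
          smul_eq_mul, zpow_neg]
        congr 1
        field_simp
      · simp [annihilate, derivOdd_single, degScale_single, h]
  intro l v
  obtain ⟨k, rfl⟩ | ⟨k, rfl⟩ := exists_mode l
  · simp only [genField, genMode_neg, hcreate]
  · simp only [genField, genMode_natCast, hann]

theorem parity_eq_degScale (v : Space n m) : parity v = degScale (-1) v := by
  refine linearMap_ext (fun p => ?_) v
  rw [parity_single, degScale_single]
  congr 2
  rw [cohDeg, ← zpow_natCast, Finset.card_eq_sum_ones]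
  obtain ⟨-, S⟩ := p
  simp only
  induction S using Finset.induction_on with
  | empty => simp
  | insert a S ha ih =>
    rw [Finset.sum_insert ha, Finset.sum_insert ha, Nat.cast_add, zpow_add₀ (by norm_num), ih,
      zpow_add₀ (by norm_num)]
    congr 1
    split_ifs <;> norm_num

/-- The space of elements of degree `q`. -/
def degSpace (n m : ℕ) (q : ℤ) : Submodule ℂ (Space n m) :=
  Finsupp.supported ℂ ℂ {p : Mono n m | cohDeg p = q}

/-- Homogeneity becomes an eigenvalue equation, which operators of known weight visibly respect. The
number `2` serves because its integral powers are distinct. -/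
theorem mem_degSpace_iff {q : ℤ} {v : Space n m} :
    v ∈ degSpace n m q ↔ degScale 2 v = (2 : ℂ) ^ q • v := by
  have h1 : ∀ p, degScale 2 v p = v p * 2 ^ cohDeg p := by
    intro p
    induction v using Finsupp.induction_linear with
    | zero => simp
    | add v w hv hw => rw [map_add, Finsupp.add_apply, hv, hw, Finsupp.add_apply, add_mul]
    | single p' c =>
      rw [degScale_single, Finsupp.single_apply, Finsupp.single_apply]
      split_ifs with h
      · rw [h]
      · simp
  rw [degSpace, Finsupp.mem_supported, Finsupp.ext_iff]
  constructor
  · intro h p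
    rw [h1, Finsupp.smul_apply, smul_eq_mul, mul_comm]
    by_cases hp : v p = 0
    · simp [hp]
    · rw [show cohDeg p = q from h (Finsupp.mem_support_iff.mpr hp)]
  · intro h p hp
    have := h p
    rw [h1, Finsupp.smul_apply, smul_eq_mul, mul_comm] at this
    have h2 := mul_right_cancel₀ (Finsupp.mem_support_iff.mp hp) this
    refine zpow_right_injective₀ (G₀ := ℝ) (a := 2) (by norm_num) (by norm_num) ?_
    have h3 := congrArg norm h2
    rwa [norm_zpow, norm_zpow, Complex.norm_ofNat] at h3

theorem degScale_of_mem {q : ℤ} {v : Space n m} (hv : v ∈ degSpace n m q) (c : ℂ) :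
    degScale c v = c ^ q • v := by
  rw [degSpace, Finsupp.mem_supported] at hv
  conv_lhs => rw [← Finsupp.sum_single v, Finsupp.sum, map_sum]
  conv_rhs => rw [← Finsupp.sum_single v, Finsupp.sum, Finset.smul_sum]
  refine Finset.sum_congr rfl fun p hp => ?_
  rw [degScale_single, show cohDeg p = q from hv hp, Finsupp.smul_single, smul_eq_mul, mul_comm]

end Chiral

namespace Chiral

open FieldCalculus

variable {n m : ℕ}

/-! ### The state-field correspondence -/

/-- The monomial in the jet variables given by a list. -/
def listMono (l : List (Gen n m × ℕ)) : Space n m := l.foldr (fun u v => create u.1 u.2 v) vacuum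

/-- The degree of a list of jet variables. -/
def listDeg (l : List (Gen n m × ℕ)) : ℤ := (l.map fun u => gdeg u.1).sum

/-- The field of the monomial given by a list. -/
def listField : List (Gen n m × ℕ) → FieldOp (Space n m)
  | [] => oneField
  | u :: l => fprod (sgn (gdeg u.1) (listDeg l)) (-u.2 - 1) (genField u.1) (listField l)

theorem foldr_mulOdd (l : List (OddJet m)) (hl : l.Pairwise (· < ·)) :
    l.foldr (fun u (v : Space n m) => mulOdd u v) vacuum = Finsupp.single (0, l.toFinset) 1 := by
  induction l with
  | nil => rfl
  | cons u l ih =>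
    rw [List.pairwise_cons] at hl
    rw [List.foldr_cons, ih hl.2, mulOdd_single, if_neg, List.toFinset_cons]
    · congr 1
      rw [oddSign, Finset.filter_eq_empty_iff.mpr]
      · simp
      · intro w hw
        exact (hl.1 w (List.mem_toFinset.mp hw)).not_gt
    · intro h
      exact lt_irrefl _ (hl.1 u (List.mem_toFinset.mp h))

theorem foldr_mulEven (l : List (EvenJet n)) (q : EvenJet n →₀ ℕ) (S : Finset (OddJet m)) :
    l.foldr (fun u (v : Space n m) => mulEven u v) (Finsupp.single (q, S) 1) =
      Finsupp.single (Multiset.toFinsupp (l : Multiset (EvenJet n)) + q, S) 1 := by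
  induction l with
  | nil => simp
  | cons u l ih =>
    rw [List.foldr_cons, ih, mulEven_single, ← Multiset.cons_coe, ← Multiset.singleton_add,
      Multiset.toFinsupp_add, Multiset.toFinsupp_singleton]
    rw [add_right_comm, add_comm (Finsupp.single u 1)]

/-- The largest odd variable acts first, so each further one is smaller than all those present and
no sign appears. -/
theorem listMono_factors (p : Mono n m) : listMono (factors p) = Finsupp.single p 1 := by
  rw [listMono, factors, List.foldr_append, List.foldr_map, List.foldr_map]
  have h := foldr_mulOdd (n := n) (p.2.sort (· ≤ ·)) (Finset.sortedLT_sort _).pairwise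
  rw [Finset.sort_toFinset] at h
  change List.foldr (fun u (v : Space n m) => mulEven u v)
    (List.foldr (fun u (v : Space n m) => mulOdd u v) vacuum (p.2.sort (· ≤ ·)))
    (Finsupp.toMultiset p.1).toList = _
  rw [h, foldr_mulEven, Multiset.coe_toList, Finsupp.toMultiset_toFinsupp, add_zero]

theorem listDeg_factors (p : Mono n m) : listDeg (factors p) = cohDeg p := by
  rw [listDeg, factors, List.map_append, List.sum_append, List.map_map, List.map_map]
  have h1 : (fun u : Gen n m × ℕ => gdeg u.1) ∘ (fun u : EvenJet n => (Sum.inl u.1, u.2)) =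
      fun _ => 0 := rfl
  rw [h1, List.map_const', List.sum_replicate, smul_zero, zero_add, cohDeg,
    ← Finset.sum_map_toList]
  exact ((Finset.sort_perm_toList _ _).map _).sum_eq

/-- The Fock space is spanned by iterated creations from the vacuum; identities of linear maps are
checked along these. -/
theorem space_induction {P : Space n m → Prop} (vac : P vacuum)
    (create : ∀ u k v, P v → P (create u k v)) (zero : P 0) (add : ∀ v w, P v → P w → P (v + w))
    (smul : ∀ (c : ℂ) v, P v → P (c • v)) (v : Space n m) : P v := by
  have hl : ∀ l : List (Gen n m × ℕ), P (listMono l) := by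
    intro l
    induction l with
    | nil => exact vac
    | cons u l ih => exact create u.1 u.2 _ ih
  induction v using Finsupp.induction_linear with
  | zero => exact zero
  | add v w hv hw => exact add v w hv hw
  | single p c =>
    have := smul c _ (hl (factors p))
    rwa [listMono_factors, Finsupp.smul_single, smul_eq_mul, mul_one] at this

theorem scales_listField {c : ℂ} (hc : c ≠ 0) (l : List (Gen n m × ℕ)) :
    Scales (degScale c) (c ^ listDeg l) (listField l) := by
  induction l with
  | nil =>
    have h0 : listDeg ([] : List (Gen n m × ℕ)) = 0 := rfl
    rw [h0, zpow_zero, listField]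
    exact scales_oneField (degScale c)
  | cons u l ih =>
    have : listDeg (u :: l) = gdeg u.1 + listDeg l := by simp [listDeg]
    rw [this, zpow_add₀ hc]
    rw [listField]
    exact Scales.fprod (scales_genField hc u.1) ih _ _

/-- Conjugation by the parity operator turns a field of degree `q` into `(-1)^q` times itself. This
is the Koszul sign of passing an odd generator. -/
theorem twist_eq {q : ℤ} {A : FieldOp (Space n m)} (hA : Scales (degScale (-1)) ((-1) ^ q) A)
    (u : Gen n m) (l : ℤ) (v : Space n m) :
    twist u (A.modes l) v = sgn (gdeg u) q • A.modes l v := by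
  have hpp : degScale (-1) (degScale (-1) v) = v := by
    have h := linearMap_ext (f := (degScale (-1) : Space n m →ₗ[ℂ] _) ∘ₗ degScale (-1))
      (g := LinearMap.id) (fun p => by
        rw [LinearMap.comp_apply, degScale_single, degScale_single, mul_assoc, ← mul_zpow]
        simp) v
    rwa [LinearMap.comp_apply, LinearMap.id_apply] at h
  rcases u with u | ⟨i, b⟩
  · simp [twist, gdeg, sgn_zero_left]
  · have h1 : sgn (gdeg (Sum.inr (i, b) : Gen n m)) q = (Int.negOnePow q : ℤ) := by
      cases b <;> simp [sgn, gdeg, Int.negOnePow_neg]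
    simp only [twist, parity_eq_degScale]
    rw [hA, hpp, h1, ← Int.cast_smul_eq_zsmul ℂ]
    congr 1
    rcases Int.even_or_odd q with h | h
    · rw [Int.negOnePow_even _ h, h.neg_one_zpow]; simp
    · rw [Int.negOnePow_odd _ h, h.neg_one_zpow]; simp

theorem neg_one_pow_mul_choose (k j : ℕ) :
    (-1 : ℤ) ^ j * Ring.choose (-k - 1 : ℤ) j = (k + j).choose j := by
  rw [show (-k - 1 : ℤ) = -(k + 1) by ring, Ring.choose_neg]
  rw [Int.negOnePow_def, show ((k : ℤ) + 1 + j - 1) = ((k + j : ℕ) : ℤ) by push_cast; ring,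
    Ring.choose_natCast]
  simp [Units.smul_def, ← mul_assoc, ← mul_pow]

/-- The normally ordered product with a divided derivative is the product of index `-k - 1`, because
`(-1)^j * choose (-k - 1) j = choose (k + j) j`. -/
theorem normalOrdered_eq {q : ℤ} {A : FieldOp (Space n m)}
    (hA : Scales (degScale (-1)) ((-1) ^ q) A) (u : Gen n m) (k : ℕ) (l : ℤ) (v : Space n m) :
    normalOrdered u k (fun l v => A.modes l v) l v =
      (fprod (sgn (gdeg u) q) (-k - 1) (genField u) A).modes l v := by
  have hc : ∀ (j : ℕ) (w : Space n m), (((k + j).choose j : ℕ) : ℂ) • w =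
      ((-1 : ℤ) ^ j * Ring.choose (-k - 1 : ℤ) j) • w := by
    intro j w
    rw [neg_one_pow_mul_choose, ← Int.cast_smul_eq_zsmul ℂ, Int.cast_natCast]
  have hs : (Int.negOnePow (-k - 1) : ℤ) = -(-1) ^ k := by
    rw [Int.negOnePow_sub, Int.negOnePow_neg]
    simp [Int.negOnePow_def]
  rw [normalOrdered, fprod_modes, bor, hs]
  simp only [hc]
  rw [mul_neg, neg_smul, sub_neg_eq_add]
  congr 1
  · refine finsum_congr fun j => ?_
    beta_reduce
    rw [show (0 : ℤ) + (-k - 1) - j = -((k + j : ℕ) : ℤ) - 1 by push_cast; ring]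
    simp only [genField, genMode_neg]
  · have : (-1 : ℂ) ^ k • (∑ᶠ j : ℕ, ((-1 : ℤ) ^ j * Ring.choose (-k - 1 : ℤ) j) •
        twist u (A.modes (l - k - 1 - j)) (annihilate u j v)) =
        (-1 : ℤ) ^ k • ∑ᶠ j : ℕ, ((-1 : ℤ) ^ j * Ring.choose (-k - 1 : ℤ) j) •
        twist u (A.modes (l - k - 1 - j)) (annihilate u j v) := by
      rw [← Int.cast_smul_eq_zsmul ℂ]; simp
    rw [this, mul_comm, mul_smul, bsum]
    congr 1
    rw [smul_finsum]
    refine finsum_congr fun j => ?_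
    rw [twist_eq hA, smul_comm, show -(k : ℤ) - 1 + l - j = l - k - 1 - j by ring, zero_add]
    simp only [genField, genMode_natCast]

theorem foldr_normalOrdered (L : List (Gen n m × ℕ)) :
    L.foldr (fun u B => normalOrdered u.1 u.2 B) idField = fun l v => (listField L).modes l v := by
  induction L with
  | nil =>
    funext l v
    simp [idField, listField, oneField_modes]
  | cons u L ih =>
    funext l v
    rw [List.foldr_cons, ih, normalOrdered_eq (scales_listField (by norm_num) L)]
    rfl

theorem field_eq (p : Mono n m) (l : ℤ) (v : Space n m) :
    field p l v = (listField (factors p)).modes l v := by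
  rw [field, foldr_normalOrdered]

theorem vprod_eq (l : ℤ) (a b : Space n m) :
    vprod l a b = a.sum fun p c => c • (listField (factors p)).modes l b := by
  simp only [vprod, field_eq]

theorem vprod_add_left (l : ℤ) (a b c : Space n m) :
    vprod l (a + b) c = vprod l a c + vprod l b c :=
  Finsupp.sum_add_index' (fun _ => zero_smul _ _) fun _ _ _ => add_smul _ _ _

theorem vprod_zero_left (l : ℤ) (c : Space n m) : vprod l 0 c = 0 := Finsupp.sum_zero_index

theorem vprod_smul_left (l : ℤ) (r : ℂ) (a c : Space n m) :
    vprod l (r • a) c = r • vprod l a c := by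
  refine (Finsupp.sum_smul_index (h := fun p (x : ℂ) => x • field p l c)
    fun _ => zero_smul _ _).trans ?_
  rw [vprod, Finsupp.smul_sum]
  simp only [mul_smul]

theorem vprod_single (l : ℤ) (p : Mono n m) (c : ℂ) (b : Space n m) :
    vprod l (Finsupp.single p c) b = c • (listField (factors p)).modes l b := by
  rw [vprod_eq]
  exact Finsupp.sum_single_index (zero_smul _ _)

/-- The field of an element. -/
def toField (a : Space n m) : FieldOp (Space n m) where
  modes l :=
    { toFun := vprod l a
      map_add' := fun b c => by
        simp only [vprod_eq, map_add, smul_add]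
        exact Finsupp.sum_add
      map_smul' := fun r b => by
        simp only [vprod_eq, map_smul, RingHom.id_apply, Finsupp.smul_sum, smul_comm r] }
  trunc v := by
    induction a using Finsupp.induction_linear with
    | zero => exact ⟨0, fun n _ => vprod_zero_left n v⟩
    | add a b ha hb =>
      obtain ⟨N, hN⟩ := ha
      obtain ⟨M, hM⟩ := hb
      refine ⟨max N M, fun k hk => ?_⟩
      have h1 := hN k ((le_max_left _ _).trans hk)
      have h2 := hM k ((le_max_right _ _).trans hk)
      change vprod k a v = 0 at h1
      change vprod k b v = 0 at h2
      change vprod k (a + b) v = 0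
      rw [vprod_add_left, h1, h2, add_zero]
    | single p c =>
      obtain ⟨N, hN⟩ := (listField (factors p)).trunc v
      refine ⟨N, fun k hk => ?_⟩
      change vprod k _ v = 0
      rw [vprod_single, hN k hk, smul_zero]

theorem toField_modes (a : Space n m) (l : ℤ) (v : Space n m) :
    (toField a).modes l v = vprod l a v := rfl

/-- A property of fields that is linear and holds for monomials of degree `q` holds for the fields
of all elements of degree `q`. -/
theorem toField_induction {P : FieldOp (Space n m) → Prop} {q : ℤ}
    (zero : ∀ A : FieldOp (Space n m), (∀ l v, A.modes l v = 0) → P A)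
    (add : ∀ A B C : FieldOp (Space n m), (∀ l v, C.modes l v = A.modes l v + B.modes l v) →
      P A → P B → P C)
    (smul : ∀ (c : ℂ) (A C : FieldOp (Space n m)), (∀ l v, C.modes l v = c • A.modes l v) →
      P A → P C)
    (list : ∀ L, listDeg L = q → P (listField L)) {a : Space n m} (ha : a ∈ degSpace n m q) :
    P (toField a) := by
  rw [degSpace, Finsupp.mem_supported] at ha
  induction a using Finsupp.induction with
  | zero => exact zero _ fun l v => vprod_zero_left l v
  | single_add p c a hp hc ih =>
    have hp0 : a p = 0 := Finsupp.notMem_support_iff.mp hp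
    have h1 : cohDeg p = q := ha (Finsupp.mem_support_iff.mpr (by simp [hp0, hc]))
    have h2 : (a.support : Set (Mono n m)) ⊆ {p | cohDeg p = q} := fun p' hp' => by
      have hne : p ≠ p' := by rintro rfl; exact hp hp'
      exact ha (Finsupp.mem_support_iff.mpr (by
        rw [Finsupp.add_apply, Finsupp.single_eq_of_ne hne.symm, zero_add]
        exact Finsupp.mem_support_iff.mp hp'))
    refine add (toField (Finsupp.single p c)) (toField a) _ (fun l v => vprod_add_left _ _ _ _) ?_
      (ih h2)
    exact smul c _ _ (fun l v => vprod_single _ _ _ _) (list _ ((listDeg_factors p).trans h1))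

theorem covariant_listField (L : List (Gen n m × ℕ)) : Covariant translation (listField L) := by
  induction L with
  | nil => exact covariant_oneField _
  | cons u L ih => exact (covariant_genField u.1).fprod ih _ _

theorem listDeg_cons (u : Gen n m × ℕ) (L : List (Gen n m × ℕ)) :
    listDeg (u :: L) = gdeg u.1 + listDeg L := by simp [listDeg]

theorem local_listField_of_local {q : ℤ} {A : FieldOp (Space n m)}
    (hA : ∀ u, Local (sgn q (gdeg u)) A (genField u))
    (hu : ∀ (u : Gen n m) (L), Local (sgn (gdeg u) (listDeg L)) (genField u) (listField L))
    (L : List (Gen n m × ℕ)) : Local (sgn (listDeg L) q) (listField L) A := by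
  induction L with
  | nil =>
    rw [show listDeg ([] : List (Gen n m × ℕ)) = 0 from rfl, sgn_zero_left]
    exact local_oneField A
  | cons u L ih =>
    rw [listDeg_cons, sgn_add_left]
    refine Local.fprod (hu u.1 L) ?_ ih _
    rw [sgn_comm]
    exact (hA u.1).symm (sgn_mul_self _ _)

/-- Dong's lemma along the list. It also needs the first factor to be local to the tail, which is
the inductive hypothesis for another generator with the roles exchanged; hence the generalization
over `v`. -/
theorem local_listField_genField (L : List (Gen n m × ℕ)) (v : Gen n m) :
    Local (sgn (listDeg L) (gdeg v)) (listField L) (genField v) := by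
  induction L generalizing v with
  | nil =>
    rw [show listDeg ([] : List (Gen n m × ℕ)) = 0 from rfl, sgn_zero_left]
    exact local_oneField _
  | cons u L ih =>
    rw [listDeg_cons, sgn_add_left]
    refine Local.fprod ?_ (local_genField u.1 v) (ih v) _
    rw [sgn_comm]
    exact (ih u.1).symm (sgn_mul_self _ _)

theorem local_genField_listField (u : Gen n m) (L : List (Gen n m × ℕ)) :
    Local (sgn (gdeg u) (listDeg L)) (genField u) (listField L) := by
  rw [sgn_comm]
  exact (local_listField_genField L u).symm (sgn_mul_self _ _)

theorem covariant_toField {q : ℤ} {a : Space n m} (ha : a ∈ degSpace n m q) :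
    Covariant translation (toField a) := by
  refine toField_induction (fun A hA l v => ?_) (fun A B C hC hA hB l v => ?_)
    (fun c A C hC hA l v => ?_) (fun L _ => covariant_listField L) ha
  · simp [hA]
  · simp only [hC, map_add, hA l, hB l]; module
  · simp only [hC, map_smul, hA l]; module

/-- By linearity the monomials suffice, and for these Dong's lemma needs only locality of `A` to the
generators. Using it twice gives locality of any two homogeneous elements. -/
theorem local_toField_of_local {q r : ℤ} {a : Space n m} (ha : a ∈ degSpace n m q)
    {A : FieldOp (Space n m)} (hA : ∀ u, Local (sgn r (gdeg u)) A (genField u)) :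
    Local (sgn q r) (toField a) A := by
  refine toField_induction (fun B hB => Local.of_zero hB) (fun _ _ _ hC hA hB => hA.of_add hC hB)
    (fun c _ _ hC hA => hA.of_smul c hC) (fun L hL => ?_) ha
  rw [← hL]
  exact local_listField_of_local hA local_genField_listField L

theorem local_toField_genField {q : ℤ} {a : Space n m} (ha : a ∈ degSpace n m q) (u : Gen n m) :
    Local (sgn q (gdeg u)) (toField a) (genField u) :=
  local_toField_of_local ha fun v => local_genField u v

theorem local_toField_toField {q r : ℤ} {a b : Space n m} (ha : a ∈ degSpace n m q)
    (hb : b ∈ degSpace n m r) : Local (sgn q r) (toField a) (toField b) :=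
  local_toField_of_local ha (local_toField_genField hb)

theorem scales_toField {q : ℤ} {a : Space n m} (ha : a ∈ degSpace n m q) {c : ℂ} (hc : c ≠ 0) :
    Scales (degScale c) (c ^ q) (toField a) := by
  refine toField_induction (fun A hA l v => ?_) (fun A B C hC hA hB l v => ?_)
    (fun c A C hC hA l v => ?_) (fun L hL => hL ▸ scales_listField hc L) ha
  · simp [hA]
  · simp only [hC, map_add, hA l, hB l]; module
  · simp only [hC, map_smul, hA l]; module

theorem vprod_mem {q r : ℤ} {a b : Space n m} (ha : a ∈ degSpace n m q) (hb : b ∈ degSpace n m r)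
    (l : ℤ) : vprod l a b ∈ degSpace n m (q + r) := by
  rw [mem_degSpace_iff] at hb ⊢
  rw [← toField_modes, scales_toField ha (by norm_num), hb, map_smul, smul_smul,
    zpow_add₀ (by norm_num)]

theorem listField_modes_vacuum (L : List (Gen n m × ℕ)) :
    (listField L).modes (-1) vacuum = listMono L := by
  induction L with
  | nil => simp [listField, oneField_modes, listMono]
  | cons u L ih =>
    rw [listField, fprod_modes_vac (covariant_genField _) (covariant_listField _)
      translation_vacuum, ih]
    simp only [genField, genMode_neg]
    rfl

theorem vprod_vacuum (a : Space n m) : vprod (-1) a vacuum = a := by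
  rw [vprod_eq]
  simp only [listField_modes_vacuum, listMono_factors, Finsupp.smul_single, smul_eq_mul, mul_one]
  exact Finsupp.sum_single a

/-- Goddard's uniqueness principle. Covariance gives agreement on the vacuum, and locality to the
generators carries agreement from `v` to each `u_(k) v`; these vectors span. -/
theorem modes_ext {q : ℤ} {A B : FieldOp (Space n m)} (hA : Covariant translation A)
    (hB : Covariant translation B) (hAl : ∀ u, Local (sgn q (gdeg u)) A (genField u))
    (hBl : ∀ u, Local (sgn q (gdeg u)) B (genField u))
    (h : A.modes (-1) vacuum = B.modes (-1) vacuum) (l : ℤ) (v : Space n m) :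
    A.modes l v = B.modes l v := by
  induction v using space_induction generalizing l with
  | vac => exact hA.vac_ext hB translation_vacuum h l
  | create u k v ih =>
    have := (hAl u).eq_of_eq (hBl u) (v := v) (fun n => ih n) l (-k - 1)
    simpa only [genField, genMode_neg] using this
  | zero => simp
  | add v w hv hw => simp only [map_add, hv, hw]
  | smul c v hv => simp only [map_smul, hv]

/-- The field of `a_(k) b` is the `k`-th product of the fields of `a` and `b`. -/
theorem fprod_toField {q r : ℤ} {a b : Space n m} (ha : a ∈ degSpace n m q)
    (hb : b ∈ degSpace n m r) (k l : ℤ) (v : Space n m) :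
    (fprod (sgn q r) k (toField a) (toField b)).modes l v = vprod l (vprod k a b) v := by
  -- Both fields are covariant and local to the generators, the product by Dong's lemma, and both
  -- send the vacuum to `a_(k) b`.
  refine modes_ext (q := q + r) (B := toField (vprod k a b))
    ((covariant_toField ha).fprod (covariant_toField hb) _ _) (covariant_toField (vprod_mem ha hb k))
    (fun u => ?_) (local_toField_genField (vprod_mem ha hb k)) ?_ l v
  · rw [sgn_add_left]
    exact (local_toField_toField ha hb).fprod (local_toField_genField ha u)
      (local_toField_genField hb u) k
  · rw [fprod_modes_vac (covariant_toField ha) (covariant_toField hb) translation_vacuum]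
    simp only [toField_modes, vprod_vacuum]

theorem vprod_borcherds {q r : ℤ} {a b : Space n m} (ha : a ∈ degSpace n m q)
    (hb : b ∈ degSpace n m r) (k p l : ℤ) (c : Space n m) :
    bsum 1 p (fun j => vprod (p + k - j) (vprod (l + j) a b) c) =
      bsum (-1) l (fun j => vprod (p + l - j) a (vprod (k + j) b c)) -
        (sgn q r * (Int.negOnePow l : ℤ)) •
          bsum (-1) l fun j => vprod (l + k - j) b (vprod (p + j) a c) := by
  have := borcherds_of_local (local_toField_toField ha hb) k p l c
  simp only [fprod_toField ha hb] at this
  exact this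

end Chiral

namespace Chiral

open FieldCalculus

variable {n m : ℕ}

/-! ### The chiral Koszul complex is a dg vertex algebra -/

theorem homogeneous_induction {P : Space n m → Prop}
    (hom : ∀ q, ∀ v ∈ degSpace n m q, P v) (add : ∀ v w, P v → P w → P (v + w))
    (v : Space n m) : P v := by
  induction v using Finsupp.induction_linear with
  | zero => exact hom 0 _ (zero_mem _)
  | add v w hv hw => exact add v w hv hw
  | single p c => exact hom (cohDeg p) _ (Finsupp.single_mem_supported ℂ c rfl)

/-- The degree pieces are eigenspaces for the distinct eigenvalues `2^q`, hence independent;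
monomials are homogeneous, hence they span. -/
theorem isInternal_degSpace : DirectSum.IsInternal (degSpace n m) := by
  refine DirectSum.isInternal_submodule_of_iSupIndep_of_iSup_eq_top ?_ ?_
  · have h1 := Module.End.eigenspaces_iSupIndep (degScale 2 : Module.End ℂ (Space n m))
    have h2 : Function.Injective fun q : ℤ => (2 : ℂ) ^ q := by
      intro p q h
      refine zpow_right_injective₀ (G₀ := ℝ) (a := 2) (by norm_num) (by norm_num) ?_
      have h3 := congrArg norm h
      simpa [norm_zpow] using h3
    convert h1.comp h2 using 1
    funext q
    ext v
    rw [mem_degSpace_iff]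
    exact Module.End.mem_eigenspace_iff.symm
  · rw [eq_top_iff]
    intro v _
    refine homogeneous_induction (P := fun v => v ∈ ⨆ q, degSpace n m q) (fun q v hv => ?_)
      (fun v w => add_mem) v
    exact Submodule.mem_iSup_of_mem q hv

theorem vacuum_mem : (vacuum : Space n m) ∈ degSpace n m 0 :=
  Finsupp.single_mem_supported ℂ _ (by simp [cohDeg])

/-- The element of the vertex algebra given by a generator. -/
def gen (u : Gen n m) : Space n m := create u 0 vacuum

theorem genMode_mem {u : Gen n m} {q : ℤ} {v : Space n m} (hv : v ∈ degSpace n m q) (l : ℤ) :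
    genMode u l v ∈ degSpace n m (gdeg u + q) := by
  rw [mem_degSpace_iff] at hv ⊢
  have := scales_genField (n := n) (m := m) (c := 2) (by norm_num) u l v
  rw [hv, map_smul, smul_smul, ← zpow_add₀ (by norm_num)] at this
  exact this

theorem create_mem {u : Gen n m} {q : ℤ} {v : Space n m} (hv : v ∈ degSpace n m q) (k : ℕ) :
    create u k v ∈ degSpace n m (gdeg u + q) := by
  rw [← genMode_neg]
  exact genMode_mem hv _

theorem gen_mem (u : Gen n m) : gen u ∈ degSpace n m (gdeg u) := by
  have := create_mem (u := u) (vacuum_mem (n := n) (m := m)) 0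
  rwa [add_zero] at this

/-- Both fields have the value `u` at the vacuum, so uniqueness identifies them. This confirms the
prescribed modes of the generators. -/
theorem vprod_gen (u : Gen n m) (l : ℤ) (v : Space n m) : vprod l (gen u) v = genMode u l v := by
  refine modes_ext (A := toField (gen u)) (B := genField u) (covariant_toField (gen_mem u))
    (covariant_genField u) (local_toField_genField (gen_mem u)) (local_genField u) ?_ l v
  rw [toField_modes, vprod_vacuum]
  exact (congrFun (congrArg _ (genMode_neg u 0)) _).symm

theorem create_eq_vprod (u : Gen n m) (k : ℕ) (v : Space n m) :
    create u k v = vprod (-k - 1) (gen u) v := by rw [vprod_gen, genMode_neg]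

theorem annihilate_eq_vprod (u : Gen n m) (k : ℕ) (v : Space n m) :
    annihilate u k v = vprod k (gen u) v := by rw [vprod_gen, genMode_natCast]

theorem vacuum_vprod (l : ℤ) (v : Space n m) : vprod l vacuum v = if l = -1 then v else 0 := by
  rw [← oneField_modes]
  refine modes_ext (q := 0) (A := toField vacuum) (covariant_toField vacuum_mem)
    (covariant_oneField _) (local_toField_genField vacuum_mem) (fun u => ?_) ?_ l v
  · rw [sgn_zero_left]; exact local_oneField _
  · rw [toField_modes, vprod_vacuum, oneField_modes, if_pos rfl]

theorem vprod_add_right (l : ℤ) (a b c : Space n m) :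
    vprod l a (b + c) = vprod l a b + vprod l a c := map_add ((toField a).modes l) b c

theorem vprod_smul_right (l : ℤ) (r : ℂ) (a c : Space n m) :
    vprod l a (r • c) = r • vprod l a c := map_smul ((toField a).modes l) r c

theorem vprod_zero_right (l : ℤ) (a : Space n m) : vprod l a 0 = 0 :=
  map_zero ((toField a).modes l)

theorem vprod_neg_right (l : ℤ) (a c : Space n m) : vprod l a (-c) = -vprod l a c :=
  map_neg ((toField a).modes l) c

theorem vprod_sum_right {ι : Type*} (s : Finset ι) (l : ℤ) (a : Space n m) (c : ι → Space n m) :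
    vprod l a (∑ i ∈ s, c i) = ∑ i ∈ s, vprod l a (c i) := map_sum ((toField a).modes l) c s

/-- The linear map `a ↦ a_(l) c`. -/
def vprodLeft (l : ℤ) (c : Space n m) : Space n m →ₗ[ℂ] Space n m where
  toFun a := vprod l a c
  map_add' a b := vprod_add_left l a b c
  map_smul' r a := vprod_smul_left l r a c

theorem vprod_neg_left (l : ℤ) (a c : Space n m) : vprod l (-a) c = -vprod l a c :=
  map_neg (vprodLeft l c) a

theorem vprod_vacuum_nonneg {l : ℤ} (hl : 0 ≤ l) (a : Space n m) : vprod l a vacuum = 0 := by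
  induction a using homogeneous_induction with
  | hom q a ha => exact (covariant_toField ha).modes_vac translation_vacuum hl
  | add a b ha hb => rw [vprod_add_left, ha, hb, add_zero]

theorem translation_vprod (l : ℤ) (a b : Space n m) :
    translation (vprod l a b) = vprod l a (translation b) - l • vprod (l - 1) a b := by
  induction a using homogeneous_induction with
  | hom q a ha => exact covariant_toField ha l b
  | add a c ha hc =>
    simp only [vprod_add_left, map_add, ha, hc]
    module

theorem translation_eq (a : Space n m) : translation a = vprod (-2) a vacuum := by
  have := translation_vprod (-1) a vacuum
  rw [vprod_vacuum, translation_vacuum, vprod_zero_right] at this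
  rw [this]
  norm_num

theorem vprod_translation (l : ℤ) (a c : Space n m) :
    vprod l (translation a) c = -l • vprod (l - 1) a c := by
  induction a using homogeneous_induction with
  | add a b ha hb => simp only [vprod_add_left, map_add, ha, hb, smul_add]
  | hom q a ha =>
    have hc : ∀ j : ℕ, (-1 : ℤ) ^ j * Ring.choose (-2 : ℤ) j = j + 1 := by
      intro j
      have := neg_one_pow_mul_choose 1 j
      rw [show (-((1 : ℕ) : ℤ) - 1) = -2 by norm_num] at this
      rw [this, add_comm 1 j, Nat.choose_succ_self_right]
      push_cast
      ring
    rw [translation_eq, ← fprod_toField ha vacuum_mem, fprod_modes, bor, bsum, bsum]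
    simp only [toField_modes, vacuum_vprod, hc, sgn_zero_right, one_mul]
    rw [Int.negOnePow_even _ (by decide), Units.val_one, one_smul]
    -- As the vacuum has the identity field, one index at most survives: `j = -1 - l` in the first
    -- sum if `l < 0`, `j = l - 1` in the second if `l > 0`, none if `l = 0`.
    rcases lt_trichotomy l 0 with h | h | h
    · rw [finsum_eq_single _ (-1 - l).toNat, finsum_eq_zero_of_forall_eq_zero]
      · rw [if_pos (by omega), sub_zero, show ((-1 - l).toNat : ℤ) = -1 - l by omega]
        congr 2 <;> ring_nf
      · intro j
        rw [if_neg (by omega), smul_zero]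
      · intro j hj
        rw [if_neg (by omega), vprod_zero_right, smul_zero]
    · rw [finsum_eq_zero_of_forall_eq_zero, finsum_eq_zero_of_forall_eq_zero]
      · simp [h]
      · intro j
        rw [if_neg (by omega), smul_zero]
      · intro j
        rw [if_neg (by omega), vprod_zero_right, smul_zero]
    · rw [finsum_eq_zero_of_forall_eq_zero, finsum_eq_single _ (l - 1).toNat]
      · rw [if_pos (by omega), zero_sub, show ((l - 1).toNat : ℤ) = l - 1 by omega, neg_smul]
        congr 2 <;> ring_nf
      · intro j hj
        rw [if_neg (by omega), smul_zero]
      · intro j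
        rw [if_neg (by omega), vprod_zero_right, smul_zero]

/-- The commutator formula for a zero mode. -/
theorem vprod_zero_vprod {q r : ℤ} {a b : Space n m} (ha : a ∈ degSpace n m q)
    (hb : b ∈ degSpace n m r) (k : ℤ) (c : Space n m) :
    vprod 0 a (vprod k b c) = vprod k (vprod 0 a b) c + sgn q r • vprod k b (vprod 0 a c) := by
  have h := vprod_borcherds ha hb k 0 0 c
  rw [bsum_zero_left, bsum_zero_left, bsum_zero_left] at h
  simp at h
  rw [h]
  abel

/-- Skew-symmetry, when there is only one term. -/
theorem vprod_skew {q r : ℤ} {a b : Space n m} (ha : a ∈ degSpace n m q)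
    (hb : b ∈ degSpace n m r) (l : ℤ) (h : ∀ j : ℕ, vprod (l + (j + 1)) a b = 0) :
    vprod l a b = -((sgn q r * (Int.negOnePow l : ℤ)) • vprod l b a) := by
  have h1 := vprod_borcherds ha hb 0 (-1) l vacuum
  rw [bsum_eq_range (J := 1), bsum_eq_range (J := 0), bsum_eq_range (J := 1)] at h1
  · simpa [vprod_vacuum] using h1
  · intro j hj
    rw [vprod_vacuum_nonneg (by omega), vprod_zero_right]
  · intro j hj
    rw [vprod_vacuum_nonneg (by omega), vprod_zero_right]
  · intro j hj
    have := h (j - 1)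
    rw [show (((j - 1 : ℕ) : ℤ) + 1) = j by omega] at this
    rw [this, vprod_zero_left]

/-- The action of a zero mode on a generator. -/
theorem vprod_zero_gen {q : ℤ} {a : Space n m} (ha : a ∈ degSpace n m q) {u : Gen n m}
    (h : ∀ k : ℕ, annihilate u (k + 1) a = 0) :
    vprod 0 a (gen u) = -(sgn q (gdeg u) • annihilate u 0 a) := by
  have h1 := vprod_skew (gen_mem u) ha 0 fun j => by
    have := h j
    rw [annihilate_eq_vprod] at this
    rw [← this]
    congr 1
    push_cast
    ring
  rw [annihilate_eq_vprod, Nat.cast_zero, h1, sgn_comm (gdeg u)]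
  simp [smul_smul, sgn_mul_self]

theorem vprod_zero_create {q : ℤ} {a : Space n m} (ha : a ∈ degSpace n m q) (u : Gen n m)
    (k : ℕ) (v : Space n m) :
    vprod 0 a (create u k v) =
      vprod (-k - 1) (vprod 0 a (gen u)) v + sgn q (gdeg u) • create u k (vprod 0 a v) := by
  rw [create_eq_vprod, create_eq_vprod, vprod_zero_vprod ha (gen_mem u)]

/-- The field of `u_(-k-1) a`. -/
theorem vprod_create {q : ℤ} {a : Space n m} (ha : a ∈ degSpace n m q) (u : Gen n m) (k : ℕ)
    (l : ℤ) (v : Space n m) :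
    vprod l (create u k a) v =
      bsum (-1) (-k - 1) (fun j => create u (k + j) (vprod (l + j) a v)) +
        (sgn (gdeg u) q * (-1) ^ k) •
          bsum (-1) (-k - 1) fun j => vprod (l - k - 1 - j) a (annihilate u j v) := by
  have hs : (Int.negOnePow (-k - 1) : ℤ) = -(-1) ^ k := by
    rw [Int.negOnePow_sub, Int.negOnePow_neg]
    simp [Int.negOnePow_def]
  rw [create_eq_vprod, ← fprod_toField (gen_mem u) ha, fprod_modes, bor, hs, mul_neg, neg_smul,
    sub_neg_eq_add]
  congr 3 <;> funext j
  · rw [create_eq_vprod]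
    simp only [toField_modes]
    congr 1
    push_cast
    ring
  · rw [annihilate_eq_vprod]
    simp only [toField_modes, zero_add]
    congr 1
    ring

/-! ### The differential -/

/-- The linear map underlying `ofPoly`. -/
def ofPolyLinear : MvPolynomial (Fin n) ℂ →ₗ[ℂ] Space n m :=
  (MvPolynomial.basisMonomials (Fin n) ℂ).constr ℂ fun s =>
    Finsupp.single (s.mapDomain (fun i => ((i, false), 0)), ∅) 1

theorem ofPolyLinear_monomial (s : Fin n →₀ ℕ) (c : ℂ) :
    (ofPolyLinear (MvPolynomial.monomial s c) : Space n m) =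
      Finsupp.single (s.mapDomain (fun i => ((i, false), 0)), ∅) c := by
  have h : MvPolynomial.monomial s c = c • MvPolynomial.basisMonomials (Fin n) ℂ s := by
    rw [MvPolynomial.coe_basisMonomials, MvPolynomial.smul_monomial, smul_eq_mul, mul_one]
  rw [h, map_smul, ofPolyLinear, Module.Basis.constr_basis, Finsupp.smul_single, smul_eq_mul, mul_one]

theorem ofPoly_eq (f : MvPolynomial (Fin n) ℂ) : (ofPoly f : Space n m) = ofPolyLinear f := by
  conv_rhs => rw [← MvPolynomial.support_sum_monomial_coeff f]
  rw [map_sum, ofPoly]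
  exact Finset.sum_congr rfl fun s _ => (ofPolyLinear_monomial _ _).symm

theorem ofPoly_add (f g : MvPolynomial (Fin n) ℂ) :
    (ofPoly (f + g) : Space n m) = ofPoly f + ofPoly g := by simp only [ofPoly_eq, map_add]

theorem ofPoly_neg (f : MvPolynomial (Fin n) ℂ) :
    (ofPoly (-f) : Space n m) = -ofPoly f := by simp only [ofPoly_eq, map_neg]

theorem ofPoly_zero : (ofPoly 0 : Space n m) = 0 := by simp only [ofPoly_eq, map_zero]

theorem ofPoly_smul (c : ℂ) (f : MvPolynomial (Fin n) ℂ) :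
    (ofPoly (c • f) : Space n m) = c • ofPoly f := by simp only [ofPoly_eq, map_smul]

theorem ofPoly_C (c : ℂ) : (ofPoly (MvPolynomial.C c) : Space n m) = c • vacuum := by
  rw [ofPoly_eq, MvPolynomial.C_apply, ofPolyLinear_monomial]
  simp [vacuum]

theorem ofPoly_mul_X (f : MvPolynomial (Fin n) ℂ) (i : Fin n) :
    (ofPoly (f * MvPolynomial.X i) : Space n m) = create (Sum.inl (i, false)) 0 (ofPoly f) := by
  induction f using MvPolynomial.induction_on' with
  | add p q hp hq => rw [add_mul, ofPoly_add, hp, hq, ofPoly_add, map_add]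
  | monomial s c =>
    rw [MvPolynomial.X, MvPolynomial.monomial_mul, ofPoly_eq, ofPoly_eq, ofPolyLinear_monomial,
      ofPolyLinear_monomial, create, mulEven_single, mul_one, Finsupp.mapDomain_add,
      Finsupp.mapDomain_single]

theorem ofPoly_X (i : Fin n) :
    (ofPoly (MvPolynomial.X i) : Space n m) = gen (Sum.inl (i, false)) := by
  have := ofPoly_mul_X (m := m) (MvPolynomial.C 1) i
  rwa [ofPoly_C, one_smul, map_one, one_mul] at this

theorem ofPoly_induction {P : MvPolynomial (Fin n) ℂ → Prop} (one : P 1)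
    (smul : ∀ (c : ℂ) f, P f → P (c • f)) (add : ∀ f g, P f → P g → P (f + g))
    (mul_X : ∀ f i, P f → P (f * MvPolynomial.X i)) (f : MvPolynomial (Fin n) ℂ) : P f := by
  induction f using MvPolynomial.induction_on with
  | C c =>
    have := smul c 1 one
    rwa [MvPolynomial.smul_eq_C_mul, mul_one] at this
  | add f g hf hg => exact add f g hf hg
  | mul_X f i hf => exact mul_X f i hf

theorem ofPoly_one : (ofPoly 1 : Space n m) = vacuum := by
  rw [← map_one MvPolynomial.C, ofPoly_C, one_smul]

theorem ofPoly_mem (f : MvPolynomial (Fin n) ℂ) : (ofPoly f : Space n m) ∈ degSpace n m 0 := by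
  induction f using ofPoly_induction with
  | one => rw [ofPoly_one]; exact vacuum_mem
  | smul c f hf => rw [ofPoly_smul]; exact Submodule.smul_mem _ _ hf
  | add f g hf hg => rw [ofPoly_add]; exact add_mem hf hg
  | mul_X f i hf => rw [ofPoly_mul_X]; simpa [gdeg] using create_mem (u := Sum.inl (i, false)) hf 0

theorem annihilate_vacuum (u : Gen n m) (k : ℕ) : annihilate u k vacuum = 0 := by
  rw [annihilate_eq_vprod, vprod_vacuum_nonneg (by omega)]

/-- The partial derivative of a polynomial by the generator that pairs with `u`. -/
def gderiv (u : Gen n m) (f : MvPolynomial (Fin n) ℂ) : MvPolynomial (Fin n) ℂ :=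
  match u with
  | Sum.inl (i, true) => MvPolynomial.pderiv i f
  | _ => 0

theorem annihilate_ofPoly (u : Gen n m) (k : ℕ) (f : MvPolynomial (Fin n) ℂ) :
    annihilate u k (ofPoly f : Space n m) = if k = 0 then ofPoly (gderiv u f) else 0 := by
  have hz : ∀ (u : Gen n m) (f g : MvPolynomial (Fin n) ℂ),
      gderiv u (f + g) = gderiv u f + gderiv u g := by
    rintro (⟨i, _ | _⟩ | ⟨i, b⟩) f g <;> simp [gderiv]
  have hs : ∀ (u : Gen n m) (c : ℂ) (f : MvPolynomial (Fin n) ℂ),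
      gderiv u (c • f) = c • gderiv u f := by
    rintro (⟨i, _ | _⟩ | ⟨i, b⟩) c f <;> simp [gderiv]
  induction f using ofPoly_induction with
  | one =>
    rw [ofPoly_one, annihilate_vacuum]
    have : gderiv u 1 = 0 := by
      rcases u with ⟨i, _ | _⟩ | ⟨i, b⟩ <;> simp [gderiv]
    rw [this, ofPoly_zero, ite_self]
  | smul c f hf => rw [ofPoly_smul, map_smul, hf, hs, ofPoly_smul, smul_ite, smul_zero]
  | add f g hf hg =>
    rw [ofPoly_add, map_add, hf, hg, hz, ofPoly_add]
    split_ifs <;> simp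
  | mul_X f i hf =>
    rw [ofPoly_mul_X, annihilate_create, hf]
    rcases u with ⟨j, _ | _⟩ | ⟨j, b⟩
    · simp [gderiv, ofPoly_zero, pair]
    · by_cases hk : k = 0
      · simp only [hk, if_true, gderiv, gdeg, sgn_zero_left, one_smul, pair, Derivation.leibniz,
          MvPolynomial.pderiv_X, ofPoly_add, smul_eq_mul, ← ofPoly_mul_X]
        by_cases hij : j = i
        · subst hij
          simp [add_comm, mul_comm]
        · simp [hij, Ne.symm hij, ofPoly_zero, mul_comm]
      · simp [hk]
    · simp [gderiv, ofPoly_zero, pair]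

/-- Polynomials act on vectors without `∂_x` by multiplication. -/
theorem vprod_ofPoly {b : Space n m} (hb : ∀ i k, annihilate (Sum.inl (i, false)) k b = 0)
    (f : MvPolynomial (Fin n) ℂ) :
    (∀ l : ℤ, 0 ≤ l → vprod l (ofPoly f) b = 0) ∧ ∀ i, vprod (-1) (ofPoly (f * MvPolynomial.X i)) b =
      create (Sum.inl (i, false)) 0 (vprod (-1) (ofPoly f) b) := by
  -- The hypothesis on `b` removes the annihilation half of the normally ordered product, leaving
  -- only creation operators.
  have key : ∀ (f : MvPolynomial (Fin n) ℂ) (i : Fin n) (l : ℤ),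
      vprod l (ofPoly (f * MvPolynomial.X i)) b = bsum (-1) (-(0 : ℕ) - 1) fun j =>
        create (Sum.inl (i, false)) (0 + j) (vprod (l + j) (ofPoly f) b) := by
    intro f i l
    rw [ofPoly_mul_X, vprod_create (ofPoly_mem f)]
    simp only [hb, vprod_zero_right, bsum_zero, smul_zero, add_zero]
  have h0 : ∀ f : MvPolynomial (Fin n) ℂ, ∀ l : ℤ, 0 ≤ l → vprod l (ofPoly f) b = 0 := by
    intro f
    induction f using ofPoly_induction with
    | one => intro l hl; rw [ofPoly_one, vacuum_vprod, if_neg (by omega)]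
    | smul c f hf => intro l hl; rw [ofPoly_smul, vprod_smul_left, hf l hl, smul_zero]
    | add f g hf hg => intro l hl; rw [ofPoly_add, vprod_add_left, hf l hl, hg l hl, add_zero]
    | mul_X f i hf =>
      intro l hl
      rw [key, bsum_eq_range (J := 0)]
      · simp
      · intro j _
        rw [hf _ (by omega), map_zero]
  refine ⟨h0 f, fun i => ?_⟩
  rw [key, bsum_eq_range (J := 1)]
  · simp
  · intro j hj
    rw [h0 f _ (by omega), map_zero]

theorem vprod_ofPoly_ofPoly (f g : MvPolynomial (Fin n) ℂ) :
    vprod (-1) (ofPoly f) (ofPoly g : Space n m) = ofPoly (f * g) := by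
  have hb : ∀ i k, annihilate (Sum.inl (i, false)) k (ofPoly g : Space n m) = 0 := by
    intro i k
    rw [annihilate_ofPoly]
    simp [gderiv, ofPoly_zero]
  induction f using ofPoly_induction with
  | one => rw [ofPoly_one, vacuum_vprod, if_pos rfl, one_mul]
  | smul c f hf => rw [ofPoly_smul, vprod_smul_left, hf, smul_mul_assoc, ofPoly_smul]
  | add f g hf hg => rw [ofPoly_add, vprod_add_left, hf, hg, add_mul, ofPoly_add]
  | mul_X f i hf => rw [(vprod_ofPoly hb f).2, hf, ← ofPoly_mul_X]; congr 1; ring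

/-- The generator `∂_{ξᵢ}`. -/
abbrev dxi (i : Fin m) : Gen n m := Sum.inr (i, true)

theorem vprod_ofPoly_gen_dxi (f : MvPolynomial (Fin n) ℂ) (i : Fin m) :
    vprod (-1) (ofPoly f) (gen (dxi i) : Space n m) = create (dxi i) 0 (ofPoly f) := by
  have hb : ∀ j k, annihilate (Sum.inl (j, false)) k (gen (dxi i) : Space n m) = 0 := by
    intro j k
    rw [gen, annihilate_create, annihilate_vacuum]
    simp [pair]
  induction f using ofPoly_induction with
  | one => rw [ofPoly_one, vacuum_vprod, if_pos rfl]; rfl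
  | smul c f hf => rw [ofPoly_smul, vprod_smul_left, hf, map_smul]
  | add f g hf hg => rw [ofPoly_add, vprod_add_left, hf, hg, map_add]
  | mul_X f j hf =>
    rw [(vprod_ofPoly hb f).2, hf, ofPoly_mul_X, create_create]
    simp [gdeg, sgn_zero_left]

/-- The factors are exchanged so that `∂_ξ` is the creation operator applied to a polynomial; no
sign arises because the polynomial is even. -/
theorem differentialElement_eq (f : Fin m → MvPolynomial (Fin n) ℂ) :
    differentialElement f = ∑ i, create (dxi i) 0 (ofPoly (f i)) := by
  refine Finset.sum_congr rfl fun i _ => ?_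
  rw [← vprod_ofPoly_gen_dxi]
  congr 1
  simp [gen, create, vacuum, mulOdd_single, oddSign]

theorem differentialElement_mem (f : Fin m → MvPolynomial (Fin n) ℂ) :
    differentialElement f ∈ degSpace n m 1 := by
  rw [differentialElement_eq]
  exact sum_mem fun i _ => by simpa [gdeg] using create_mem (u := dxi i) (ofPoly_mem (f i)) 0

theorem annihilate_differentialElement (f : Fin m → MvPolynomial (Fin n) ℂ) (u : Gen n m) (k : ℕ) :
    annihilate u k (differentialElement f) =
      if k = 0 then ∑ i, (sgn (gdeg u) 1 • create (dxi i) 0 (ofPoly (gderiv u (f i))) +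
        pair u (dxi i) • ofPoly (f i)) else 0 := by
  rw [differentialElement_eq, map_sum]
  simp only [annihilate_create, annihilate_ofPoly]
  split_ifs <;> simp [gdeg]

theorem differential_gen (f : Fin m → MvPolynomial (Fin n) ℂ) (u : Gen n m) :
    vprod 0 (differentialElement f) (gen u) =
      -(sgn 1 (gdeg u) • ∑ i, (sgn (gdeg u) 1 • create (dxi i) 0 (ofPoly (gderiv u (f i))) +
        pair u (dxi i) • ofPoly (f i))) := by
  rw [vprod_zero_gen (differentialElement_mem f), annihilate_differentialElement, if_pos rfl]
  intro k
  rw [annihilate_differentialElement, if_neg (by omega)]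

theorem differential_x (f : Fin m → MvPolynomial (Fin n) ℂ) (i : Fin n) :
    vprod 0 (differentialElement f) (gen (Sum.inl (i, false))) = 0 := by
  simp [differential_gen, gderiv, pair, ofPoly_zero]

theorem differential_dxi (f : Fin m → MvPolynomial (Fin n) ℂ) (i : Fin m) :
    vprod 0 (differentialElement f) (gen (dxi i)) = 0 := by
  simp [differential_gen, gderiv, pair, ofPoly_zero]

theorem differential_xi (f : Fin m → MvPolynomial (Fin n) ℂ) (i : Fin m) :
    vprod 0 (differentialElement f) (gen (Sum.inr (i, false))) = ofPoly (f i) := by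
  rw [differential_gen]
  simp [gderiv, pair, ofPoly_zero, gdeg, sgn]

theorem differential_dx (f : Fin m → MvPolynomial (Fin n) ℂ) (i : Fin n) :
    vprod 0 (differentialElement f) (gen (Sum.inl (i, true))) =
      -∑ j, create (dxi j) 0 (ofPoly (MvPolynomial.pderiv i (f j))) := by
  rw [differential_gen]
  simp [gderiv, pair, gdeg, sgn_zero_left, sgn_zero_right]

theorem differential_ofPoly (f : Fin m → MvPolynomial (Fin n) ℂ) (g : MvPolynomial (Fin n) ℂ) :
    vprod 0 (differentialElement f) (ofPoly g) = 0 := by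
  induction g using ofPoly_induction with
  | one => rw [ofPoly_one, vprod_vacuum_nonneg le_rfl]
  | smul c f hf => rw [ofPoly_smul, vprod_smul_right, hf, smul_zero]
  | add f g hf hg => rw [ofPoly_add, vprod_add_right, hf, hg, add_zero]
  | mul_X f i hf =>
    rw [ofPoly_mul_X, vprod_zero_create (differentialElement_mem _), differential_x, hf,
      vprod_zero_left, map_zero, smul_zero, add_zero]

theorem differential_differentialElement (f g : Fin m → MvPolynomial (Fin n) ℂ) :
    vprod 0 (differentialElement f) (differentialElement g) = 0 := by
  rw [differentialElement_eq g, vprod_sum_right]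
  refine Finset.sum_eq_zero fun i _ => ?_
  rw [vprod_zero_create (differentialElement_mem f), differential_dxi, differential_ofPoly,
    vprod_zero_left, map_zero, smul_zero, add_zero]

/-- For an odd element the commutator formula reads `2 (Q_(0))² = (Q_(0) Q)_(0)`, and `Q_(0) Q = 0`.
-/
theorem differential_differential (f : Fin m → MvPolynomial (Fin n) ℂ) (v : Space n m) :
    vprod 0 (differentialElement f) (vprod 0 (differentialElement f) v) = 0 := by
  have h := vprod_zero_vprod (differentialElement_mem f) (differentialElement_mem f) 0 v
  rw [differential_differentialElement, vprod_zero_left, zero_add,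
    show sgn 1 1 = -1 by simp [sgn], neg_one_smul, eq_neg_iff_add_eq_zero, ← two_smul ℂ] at h
  exact (smul_eq_zero.mp h).resolve_left two_ne_zero

theorem translation_mem {q : ℤ} {a : Space n m} (ha : a ∈ degSpace n m q) :
    translation a ∈ degSpace n m q := by
  rw [translation_eq]
  simpa only [add_zero] using vprod_mem ha vacuum_mem (-2)

/-- The chiral Koszul complex is a dg vertex algebra. -/
theorem isDGVertexAlgebra (f : Fin m → MvPolynomial (Fin n) ℂ) :
    (chiralKoszul f).IsDGVertexAlgebra where
  isInternal := isInternal_degSpace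
  vac_mem := vacuum_mem
  prod_mem l p q a b ha hb := vprod_mem ha hb l
  T_mem _ _ ha := translation_mem ha
  d_mem p a ha := by
    have := vprod_mem (differentialElement_mem f) ha 0
    rwa [add_comm] at this
  prod_linear_left l b := ⟨fun a a' => vprod_add_left l a a' b, fun c a => vprod_smul_left l c a b⟩
  prod_linear_right l a := ⟨fun b b' => vprod_add_right l a b b', fun c b => vprod_smul_right l c a b⟩
  T_linear := translation.isLinear
  d_linear := ⟨fun b b' => vprod_add_right 0 _ b b', fun c b => vprod_smul_right 0 c _ b⟩
  truncation a b := (toField a).trunc b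
  vac_prod l a := vacuum_vprod l a
  prod_vac_neg_one a := vprod_vacuum a
  prod_vac_nonneg l a hl := vprod_vacuum_nonneg hl a
  T_eq a := translation_eq a
  T_prod l a b := by
    have h1 := translation_vprod l a b
    have h2 := vprod_translation l a b
    change translation (vprod l a b) = vprod l (translation a) b + vprod l a (translation b)
    rw [h1, h2, neg_smul]
    abel
  borcherds p q a b c ha hb k l j := by
    have h := vprod_borcherds ha hb k l j c
    simp only [bsum, one_pow, one_mul] at h
    refine h.trans ?_
    congr 1
    rw [smul_finsum]
    refine finsum_congr fun i => ?_
    rw [smul_smul, Int.negOnePow_add, sgn, Units.val_mul]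
    congr 1
    ring
  d_prod l p a b ha := by
    have h := vprod_zero_vprod (differentialElement_mem f) ha l b
    rwa [sgn, one_mul] at h
  d_d a := differential_differential f a

end Chiral

namespace Chiral

open FieldCalculus

variable {n m n' m' n'' m'' : ℕ}

/-! ### Maps out of the Fock space -/

section Lift

variable {W : Type*} [AddCommGroup W] [Module ℂ W] (c : Gen n m → ℕ → W →ₗ[ℂ] W)

/-- The operator of an odd jet variable. -/
def oddOp (u : OddJet m) : W →ₗ[ℂ] W :=
  c (Sum.inr ((ofLex u).1, (ofLex (ofLex u).2).1)) (ofLex (ofLex u).2).2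

/-- The value at a product of odd jet variables. -/
def oddLift (w₀ : W) (S : Finset (OddJet m)) : W := (S.sort (· ≤ ·)).foldr (fun u w => oddOp c u w) w₀

/-- The value at a product of even jet variables and a vector. -/
def evenLift (p : EvenJet n →₀ ℕ) (w : W) : W :=
  (Finsupp.toMultiset p).toList.foldr (fun u w => c (Sum.inl u.1) u.2 w) w

variable {c}
variable (hc : ∀ u v k l w, c u k (c v l w) = sgn (gdeg u) (gdeg v) • c v l (c u k w))

include hc

theorem oddOp_oddOp (u v : OddJet m) (w : W) : oddOp c u (oddOp c v w) = -oddOp c v (oddOp c u w) := by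
  rw [oddOp, oddOp, hc, sgn_odd, neg_one_smul]

theorem oddOp_self (u : OddJet m) (w : W) : oddOp c u (oddOp c u w) = 0 := by
  have h := oddOp_oddOp hc u u w
  rw [eq_neg_iff_add_eq_zero, ← two_smul ℂ] at h
  exact (smul_eq_zero.mp h).resolve_left two_ne_zero

/-- Sorts the new operator into an increasing product. Each smaller variable passed contributes a
minus sign, and meeting an equal one gives zero since anticommuting operators square to zero. -/
theorem oddOp_oddLift (w₀ : W) (u : OddJet m) (S : Finset (OddJet m)) :
    oddOp c u (oddLift c w₀ S) = if u ∈ S then 0 else oddSign u S • oddLift c w₀ (insert u S) := by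
  have hins : ∀ (a : OddJet m) (S : Finset (OddJet m)), (∀ x ∈ S, a < x) →
      oddLift c w₀ (insert a S) = oddOp c a (oddLift c w₀ S) := by
    intro a S h
    rw [oddLift, Finset.sort_insert (r := (· ≤ ·)) (fun b hb => (h b hb).le) fun ha => lt_irrefl _ (h a ha)]
    rfl
  induction S using Finset.induction_on_min with
  | empty =>
    rw [hins _ _ (by simp)]
    simp [oddSign]
  | insert a S ha ih =>
    have haS : a ∉ S := fun h => lt_irrefl _ (ha a h)
    rcases lt_trichotomy u a with h | h | h
    · have hu : ∀ x ∈ insert a S, u < x := by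
        intro x hx
        rcases Finset.mem_insert.mp hx with rfl | hx
        · exact h
        · exact h.trans (ha x hx)
      rw [if_neg fun hu' => lt_irrefl _ (hu u hu'), hins u _ hu, oddSign,
        Finset.filter_eq_empty_iff.mpr fun x hx => (hu x hx).not_gt]
      simp
    · subst h
      rw [if_pos (Finset.mem_insert_self _ _), hins _ _ ha, oddOp_self hc]
    · rw [hins _ _ ha, oddOp_oddOp hc, ih, oddSign_insert _ _ haS, if_pos h]
      by_cases hu : u ∈ S
      · simp [hu]
      · have h1 : ∀ x ∈ insert u S, a < x := by
          intro x hx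
          rcases Finset.mem_insert.mp hx with rfl | hx
          · exact h
          · exact ha x hx
        rw [if_neg hu, if_neg (by simp [hu, h.ne']), Finset.insert_comm, hins _ _ h1, map_smul]
        simp

theorem evenOp_evenLift (u : EvenJet n) (p : EvenJet n →₀ ℕ) (w : W) :
    c (Sum.inl u.1) u.2 (evenLift c p w) = evenLift c (p + Finsupp.single u 1) w := by
  have hp : (u :: (Finsupp.toMultiset p).toList).Perm
      (Finsupp.toMultiset (p + Finsupp.single u 1)).toList := by
    rw [← Multiset.coe_eq_coe, Multiset.coe_toList, map_add, Finsupp.toMultiset_single,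
      ← Multiset.cons_coe, Multiset.coe_toList, one_smul, add_comm, Multiset.singleton_add]
  refine List.Perm.foldr_eq' (f := fun (u : EvenJet n) w => c (Sum.inl u.1) u.2 w) hp ?_ w
  intro x _ y _ w
  rw [hc]
  simp [gdeg, sgn_zero_left]

theorem oddOp_evenLift (i : Fin m) (b : Bool) (k : ℕ) (p : EvenJet n →₀ ℕ) (w : W) :
    c (Sum.inr (i, b)) k (evenLift c p w) = evenLift c p (c (Sum.inr (i, b)) k w) := by
  rw [evenLift, evenLift]
  induction (Finsupp.toMultiset p).toList with
  | nil => rfl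
  | cons u L ih =>
    rw [List.foldr_cons, List.foldr_cons, hc, ih]
    simp [gdeg, sgn_zero_right]

omit hc in
theorem evenLift_smul (a : ℂ) (p : EvenJet n →₀ ℕ) (w : W) :
    evenLift c p (a • w) = a • evenLift c p w := by
  rw [evenLift, evenLift]
  induction (Finsupp.toMultiset p).toList with
  | nil => rfl
  | cons u L ih => rw [List.foldr_cons, List.foldr_cons, ih, map_smul]

omit hc in
theorem evenLift_zero (p : EvenJet n →₀ ℕ) : evenLift c p (0 : W) = 0 := by
  simpa using evenLift_smul (c := c) 0 p (0 : W)

/-- Operators with the commutation rules of the jet variables define a linear map. -/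
theorem exists_lift (w₀ : W) : ∃ φ : Space n m →ₗ[ℂ] W, φ vacuum = w₀ ∧
    ∀ u k v, φ (create u k v) = c u k (φ v) := by
  let φ : Space n m →ₗ[ℂ] W :=
    Finsupp.linearCombination ℂ fun p : Mono n m => evenLift c p.1 (oddLift c w₀ p.2)
  have hφ : ∀ p : Mono n m, ∀ a, φ (Finsupp.single p a) = a • evenLift c p.1 (oddLift c w₀ p.2) :=
    fun p a => Finsupp.linearCombination_single _ _ _
  refine ⟨φ, ?_, fun u k v => ?_⟩
  · rw [vacuum, hφ]
    simp [evenLift, oddLift]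
  · refine linearMap_ext (f := φ ∘ₗ create u k) (g := c u k ∘ₗ φ) (fun p => ?_) v
    rw [LinearMap.comp_apply, LinearMap.comp_apply, hφ, one_smul]
    rcases u with u | ⟨i, b⟩
    · rw [create, mulEven_single, hφ, one_smul]
      exact (evenOp_evenLift hc (u, k) _ _).symm
    · rw [create, mulOdd_single, oddOp_evenLift hc]
      have := oddOp_oddLift hc w₀ (oddJet i b k) p.2
      change c (Sum.inr (i, b)) k (oddLift c w₀ p.2) = _ at this
      rw [this]
      split_ifs with h
      · rw [map_zero, evenLift_zero]
      · rw [hφ, evenLift_smul, one_mul]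

end Lift

theorem linearMap_ext_create {W : Type*} [AddCommGroup W] [Module ℂ W] {f g : Space n m →ₗ[ℂ] W}
    (h0 : f vacuum = g vacuum)
    (h : ∀ u k v, f v = g v → f (create u k v) = g (create u k v)) (v : Space n m) : f v = g v := by
  induction v using space_induction with
  | vac => exact h0
  | create u k v ih => exact h u k v ih
  | zero => rw [map_zero, map_zero]
  | add v w hv hw => rw [map_add, map_add, hv, hw]
  | smul c v hv => rw [map_smul, map_smul, hv]

/-- A linear map that is compatible with the creation operators and the pairing is compatible with
the annihilation operators. -/
theorem map_annihilate {θ : Space n m →ₗ[ℂ] Space n' m'} (h0 : θ vacuum = vacuum)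
    {u : Gen n m} {u' : Gen n' m'} {χ : ℂ} (hdeg : gdeg u' = gdeg u)
    (h : ∀ w, ((∀ k v, θ (create w k v) = 0) ∧ pair u w = 0) ∨ ∃ (w' : Gen n' m') (s : ℂ),
      gdeg w' = gdeg w ∧ (∀ k v, θ (create w k v) = s • create w' k (θ v)) ∧
        pair u w = χ * s * pair u' w') (k : ℕ) (v : Space n m) :
    θ (annihilate u k v) = χ • annihilate u' k (θ v) := by
  refine linearMap_ext_create (f := θ ∘ₗ annihilate u k) (g := χ • annihilate u' k ∘ₗ θ) ?_ ?_ v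
  · simp [annihilate_vacuum, h0]
  · intro w l v ih
    simp only [LinearMap.comp_apply, LinearMap.smul_apply] at ih ⊢
    rw [annihilate_create, map_add, map_zsmul]
    rcases h w with ⟨hw, hp⟩ | ⟨w', s, hd, hw, hp⟩
    · rw [hw, hw, hp]; simp
    · have hif : θ (if k = l then pair u w • v else 0) =
          χ • s • (if k = l then pair u' w' • θ v else 0) := by
        split_ifs
        · rw [map_smul, hp]; module
        · simp
      rw [hif, hw, hw, ih, map_smul, map_smul, annihilate_create, hdeg, hd]
      module

/-- If `θ` intertwines the modes of the images of the generators under two maps, then it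
intertwines the modes of the images of all elements. -/
theorem map_vprod_of_gen {α : Space n m →ₗ[ℂ] Space n' m'} {β : Space n m →ₗ[ℂ] Space n'' m''}
    {θ : Space n' m' →ₗ[ℂ] Space n'' m''} {α₀ : Gen n m → Space n' m'} {β₀ : Gen n m → Space n'' m''}
    (hα₀ : ∀ u, α₀ u ∈ degSpace n' m' (gdeg u)) (hβ₀ : ∀ u, β₀ u ∈ degSpace n'' m'' (gdeg u))
    (hαv : α vacuum = vacuum) (hβv : β vacuum = vacuum)
    (hα : ∀ u (k : ℕ) v, α (create u k v) = vprod (-k - 1) (α₀ u) (α v))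
    (hβ : ∀ u (k : ℕ) v, β (create u k v) = vprod (-k - 1) (β₀ u) (β v))
    (h : ∀ u l v, θ (vprod l (α₀ u) v) = vprod l (β₀ u) (θ v))
    (l : ℤ) (a : Space n m) (v : Space n' m') : θ (vprod l (α a) v) = vprod l (β a) (θ v) := by
  -- The Borcherds identity with `m = 0` expresses the modes of `a_(k) b` by those of `a` and `b`,
  -- so intertwining passes from generators to monomials by induction on length.
  have assoc : ∀ {n m : ℕ} {q r : ℤ} {a b : Space n m} (_ : a ∈ degSpace n m q)
      (_ : b ∈ degSpace n m r) (k l : ℤ) (c : Space n m), vprod l (vprod k a b) c =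
        bsum (-1) k (fun j => vprod (0 + k - j) a (vprod (l + j) b c)) -
          (sgn q r * (Int.negOnePow k : ℤ)) •
            bsum (-1) k fun j => vprod (k + l - j) b (vprod (0 + j) a c) := by
    intro n m q r a b ha hb k l c
    rw [← vprod_borcherds ha hb l 0 k c, bsum_zero_left]
    simp
  have hL : ∀ L : List (Gen n m × ℕ), α (listMono L) ∈ degSpace n' m' (listDeg L) ∧
      β (listMono L) ∈ degSpace n'' m'' (listDeg L) ∧
      ∀ (l : ℤ) v, θ (vprod l (α (listMono L)) v) = vprod l (β (listMono L)) (θ v) := by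
    intro L
    induction L with
    | nil =>
      change α vacuum ∈ _ ∧ β vacuum ∈ _ ∧ ∀ (l : ℤ) v, θ (vprod l (α vacuum) v) = vprod l (β vacuum) (θ v)
      rw [hαv, hβv]
      refine ⟨vacuum_mem, vacuum_mem, fun l v => ?_⟩
      rw [vacuum_vprod, vacuum_vprod]
      split_ifs <;> simp
    | cons u L ih =>
      obtain ⟨h1, h2, h3⟩ := ih
      have e : listMono (u :: L) = create u.1 u.2 (listMono L) := rfl
      rw [e, hα, hβ, listDeg_cons]
      refine ⟨vprod_mem (hα₀ _) h1 _, vprod_mem (hβ₀ _) h2 _, fun l v => ?_⟩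
      rw [assoc (hα₀ _) h1, assoc (hβ₀ _) h2, map_sub, map_zsmul]
      have m1 := bsum_map (-1) (-u.2 - 1) (ev_left (toField (α₀ u.1)) (toField (α (listMono L)))
        l (0 + (-u.2 - 1)) v) θ.toAddMonoidHom
      have m2 := bsum_map (-1) (-u.2 - 1) (ev_left (toField (α (listMono L))) (toField (α₀ u.1))
        0 (-u.2 - 1 + l) v) θ.toAddMonoidHom
      simp only [LinearMap.toAddMonoidHom_coe, toField_modes] at m1 m2
      rw [m1, m2]
      simp only [h, h3]
  induction a using Finsupp.induction_linear with
  | zero => rw [map_zero, map_zero, vprod_zero_left, vprod_zero_left, map_zero]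
  | add a b ha hb => rw [map_add, map_add, vprod_add_left, vprod_add_left, map_add, ha, hb]
  | single p c =>
    have : Finsupp.single p c = c • listMono (factors p) := by
      rw [listMono_factors]; simp
    rw [this, map_smul, map_smul, vprod_smul_left, vprod_smul_left, map_smul, (hL _).2.2]

/-! ### Homomorphisms -/

/-- A homomorphism of vertex algebras. -/
structure IsVertexHom (φ : Space n m →ₗ[ℂ] Space n' m') : Prop where
  map_vacuum : φ vacuum = vacuum
  map_vprod : ∀ l a b, φ (vprod l a b) = vprod l (φ a) (φ b)

theorem IsVertexHom.map_create {φ : Space n m →ₗ[ℂ] Space n' m'} (h : IsVertexHom φ) (u : Gen n m)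
    (k : ℕ) (v : Space n m) : φ (create u k v) = vprod (-k - 1) (φ (gen u)) (φ v) := by
  rw [create_eq_vprod, h.map_vprod]

theorem IsVertexHom.comp {φ : Space n m →ₗ[ℂ] Space n' m'} {ψ : Space n' m' →ₗ[ℂ] Space n'' m''}
    (hψ : IsVertexHom ψ) (hφ : IsVertexHom φ) : IsVertexHom (ψ ∘ₗ φ) where
  map_vacuum := by rw [LinearMap.comp_apply, hφ.map_vacuum, hψ.map_vacuum]
  map_vprod l a b := by
    simp only [LinearMap.comp_apply, hφ.map_vprod, hψ.map_vprod]

theorem IsVertexHom.ext_gen {φ ψ : Space n m →ₗ[ℂ] Space n' m'} (hφ : IsVertexHom φ)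
    (hψ : IsVertexHom ψ) (h : ∀ u, φ (gen u) = ψ (gen u)) (v : Space n m) : φ v = ψ v :=
  linearMap_ext_create (hφ.map_vacuum.trans hψ.map_vacuum.symm)
    (fun u k v ih => by rw [hφ.map_create, hψ.map_create, h, ih]) v

theorem IsVertexHom.map_translation {φ : Space n m →ₗ[ℂ] Space n' m'} (h : IsVertexHom φ)
    (a : Space n m) : φ (translation a) = translation (φ a) := by
  rw [translation_eq, translation_eq, h.map_vprod, h.map_vacuum]

theorem IsVertexHom.map_mem {φ : Space n m →ₗ[ℂ] Space n' m'} (h : IsVertexHom φ)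
    (hgen : ∀ u, φ (gen u) ∈ degSpace n' m' (gdeg u)) {q : ℤ} {a : Space n m}
    (ha : a ∈ degSpace n m q) : φ a ∈ degSpace n' m' q := by
  rw [mem_degSpace_iff] at ha ⊢
  rw [← map_smul, ← ha]
  refine linearMap_ext_create (f := degScale 2 ∘ₗ φ) (g := φ ∘ₗ degScale 2) ?_ ?_ a
  · have h1 := mem_degSpace_iff.mp (vacuum_mem (n := n) (m := m))
    have h2 := mem_degSpace_iff.mp (vacuum_mem (n := n') (m := m'))
    rw [LinearMap.comp_apply, LinearMap.comp_apply, h.map_vacuum, h1, h2, map_smul, h.map_vacuum]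
  · intro u k v ih
    rw [LinearMap.comp_apply, LinearMap.comp_apply] at ih ⊢
    have h1 := scales_toField (gen_mem u) (c := 2) (by norm_num) (-k - 1) v
    have h2 := scales_toField (hgen u) (c := 2) (by norm_num) (-k - 1) (φ v)
    simp only [toField_modes] at h1 h2
    rw [h.map_create, h2, ih, create_eq_vprod, h1, map_smul, h.map_vprod]

theorem IsVertexHom.isDGVertexHom {φ : Space n m →ₗ[ℂ] Space n' m'} (h : IsVertexHom φ)
    (hgen : ∀ u, φ (gen u) ∈ degSpace n' m' (gdeg u)) {f : Fin m → MvPolynomial (Fin n) ℂ}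
    {f' : Fin m' → MvPolynomial (Fin n') ℂ}
    (hQ : φ (differentialElement f) = differentialElement f') :
    IsDGVertexHom (chiralKoszul f) (chiralKoszul f') φ where
  map_deg _ _ ha := h.map_mem hgen ha
  map_vac := h.map_vacuum
  map_prod := h.map_vprod
  map_T := h.map_translation
  map_d a := by
    have := h.map_vprod 0 (differentialElement f) a
    rwa [hQ] at this

/-- Elements whose modes have the commutators of the generators define a homomorphism. -/
theorem exists_isVertexHom {b : Gen n m → Space n' m'} (hb : ∀ u, b u ∈ degSpace n' m' (gdeg u))
    (h : ∀ u v k l w, vprod k (b u) (vprod l (b v) w) =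
      sgn (gdeg u) (gdeg v) • vprod l (b v) (vprod k (b u) w) +
        if k + l = -1 then pair u v • w else 0) :
    ∃ φ : Space n m →ₗ[ℂ] Space n' m', IsVertexHom φ ∧ ∀ u, φ (gen u) = b u := by
  obtain ⟨φ, h0, h1⟩ := exists_lift (c := fun u k => (toField (b u)).modes (-k - 1)) (fun u v k l w => by
    rw [toField_modes, toField_modes, h, if_neg (by omega), add_zero]; rfl) vacuum
  simp only [toField_modes] at h1
  -- Nonnegative modes on both sides kill the vacuum and have the same commutators with the creation
  -- operators, so they correspond under `φ`.
  have h2 : ∀ u (k : ℕ) v, φ (annihilate u k v) = vprod k (b u) (φ v) := by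
    intro u k v
    refine linearMap_ext_create (f := φ ∘ₗ annihilate u k) (g := (toField (b u)).modes k ∘ₗ φ) ?_ ?_ v
    · simp only [LinearMap.comp_apply, toField_modes]
      rw [annihilate_vacuum, map_zero, h0, vprod_vacuum_nonneg (by omega)]
    · intro w l v ih
      simp only [LinearMap.comp_apply, toField_modes] at ih ⊢
      rw [annihilate_create, map_add, map_zsmul, h1, ih, h1, h u w]
      congr 1
      by_cases hkl : k = l
      · rw [if_pos hkl, if_pos (by omega), map_smul]
      · rw [if_neg hkl, if_neg (by omega), map_zero]
  refine ⟨φ, ⟨h0, fun l a v => ?_⟩, fun u => ?_⟩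
  · refine map_vprod_of_gen (α := LinearMap.id) (α₀ := gen) gen_mem hb rfl h0
      (fun u k v => create_eq_vprod u k v) h1 (fun u l v => ?_) l a v
    obtain ⟨k, rfl⟩ | ⟨k, rfl⟩ := exists_mode l
    · rw [← create_eq_vprod, h1]
    · rw [← annihilate_eq_vprod, h2]
  · rw [gen, h1, h0, Nat.cast_zero, neg_zero, zero_sub, vprod_vacuum]

/-- The differentials are zero modes of the two elements, so matching these elements is all that
compatibility with them requires. -/
theorem isomorphic_of_isVertexHom {φ : Space n m →ₗ[ℂ] Space n' m'}
    {ψ : Space n' m' →ₗ[ℂ] Space n m} (hφ : IsVertexHom φ) (hψ : IsVertexHom ψ)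
    (h1 : ∀ u, ψ (φ (gen u)) = gen u) (h2 : ∀ u, φ (ψ (gen u)) = gen u)
    (hgen : ∀ u, φ (gen u) ∈ degSpace n' m' (gdeg u)) {f : Fin m → MvPolynomial (Fin n) ℂ}
    {f' : Fin m' → MvPolynomial (Fin n') ℂ}
    (hQ : φ (differentialElement f) = differentialElement f') :
    (chiralKoszul f).Isomorphic (chiralKoszul f') := by
  have hid : ∀ {n m : ℕ}, IsVertexHom (LinearMap.id : Space n m →ₗ[ℂ] Space n m) :=
    ⟨rfl, fun _ _ _ => rfl⟩
  refine ⟨LinearEquiv.ofLinearMap (M := Space n m) (M₂ := Space n' m') φ ψ ?_ ?_, hφ.isDGVertexHom hgen hQ⟩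
  · exact LinearMap.ext ((hφ.comp hψ).ext_gen hid h2)
  · exact LinearMap.ext ((hψ.comp hφ).ext_gen hid h1)

theorem IsVertexHom.map_ofPoly {φ : Space n m →ₗ[ℂ] Space n' m'} (h : IsVertexHom φ)
    {σ : Fin n → MvPolynomial (Fin n') ℂ} (hσ : ∀ i, φ (gen (Sum.inl (i, false))) = ofPoly (σ i))
    (g : MvPolynomial (Fin n) ℂ) : φ (ofPoly g) = ofPoly (MvPolynomial.aeval σ g) := by
  induction g using ofPoly_induction with
  | one => rw [ofPoly_one, map_one, ofPoly_one, h.map_vacuum]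
  | smul c f hf => rw [ofPoly_smul, map_smul, map_smul, ofPoly_smul, hf]
  | add f g hf hg => rw [ofPoly_add, map_add, map_add, ofPoly_add, hf, hg]
  | mul_X f i hf =>
    rw [ofPoly_mul_X, h.map_create, hf, hσ, Nat.cast_zero, neg_zero, zero_sub, vprod_ofPoly_ofPoly,
      map_mul, MvPolynomial.aeval_X, mul_comm]

theorem IsVertexHom.map_differentialElement {φ : Space n m →ₗ[ℂ] Space n' m'} (h : IsVertexHom φ)
    {σ : Fin n → MvPolynomial (Fin n') ℂ} (hσ : ∀ i, φ (gen (Sum.inl (i, false))) = ofPoly (σ i))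
    (f : Fin m → MvPolynomial (Fin n) ℂ) : φ (differentialElement f) =
      ∑ i, vprod (-1) (φ (gen (dxi i))) (ofPoly (MvPolynomial.aeval σ (f i))) := by
  rw [differentialElement_eq, map_sum]
  refine Finset.sum_congr rfl fun i _ => ?_
  rw [h.map_create, h.map_ofPoly hσ, Nat.cast_zero, neg_zero, zero_sub]

end Chiral

namespace Chiral

open FieldCalculus

variable {n m : ℕ}

/-! ### Exponentials of zero modes -/

/-- The exponential of the derivation `a_(0)`, if the square of `a_(0)` kills the generators. -/
theorem exists_isVertexHom_exp {a : Space n m} (ha : a ∈ degSpace n m 0)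
    (h : ∀ u, vprod 0 a (vprod 0 a (gen u)) = 0) :
    ∃ φ : Space n m →ₗ[ℂ] Space n m, IsVertexHom φ ∧ ∀ u, φ (gen u) = gen u + vprod 0 a (gen u) := by
  have hD : ∀ {q : ℤ} {b : Space n m} (_ : b ∈ degSpace n m q) (k : ℤ) (c : Space n m),
      vprod 0 a (vprod k b c) = vprod k (vprod 0 a b) c + vprod k b (vprod 0 a c) := by
    intro q b hb k c
    rw [vprod_zero_vprod ha hb, sgn_zero_left, one_smul]
  have hm : ∀ u : Gen n m, vprod 0 a (gen u) ∈ degSpace n m (gdeg u) := fun u => by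
    simpa only [zero_add] using vprod_mem ha (gen_mem u) 0
  refine exists_isVertexHom (fun u => add_mem (gen_mem u) (hm u)) fun u v k l w => ?_
  have e0 : ∀ w, vprod k (gen u) (vprod l (gen v) w) =
      sgn (gdeg u) (gdeg v) • vprod l (gen v) (vprod k (gen u) w) +
        if k + l = -1 then pair u v • w else 0 := fun w => by
    simp only [vprod_gen, genMode_genMode u v]
  have dsmul : ∀ (s : ℤ) (x : Space n m), vprod 0 a (s • x) = s • vprod 0 a x := fun s x =>
    map_zsmul ((toField a).modes 0) s x
  -- The derivation `D = a_(0)` applied to the commutator of two generators: the pairing is a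
  -- constant, so `[Du, v] + [u, Dv] = 0`.
  have e1 : ∀ w, vprod k (vprod 0 a (gen u)) (vprod l (gen v) w) +
      vprod k (gen u) (vprod l (vprod 0 a (gen v)) w) =
      sgn (gdeg u) (gdeg v) • (vprod l (vprod 0 a (gen v)) (vprod k (gen u) w) +
        vprod l (gen v) (vprod k (vprod 0 a (gen u)) w)) := by
    intro w
    have h1 := congrArg (vprod 0 a) (e0 w)
    have hif : vprod 0 a (if k + l = -1 then pair u v • w else 0) =
        if k + l = -1 then pair u v • vprod 0 a w else 0 := by
      split_ifs
      · rw [vprod_smul_right]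
      · rw [vprod_zero_right]
    rw [vprod_add_right, hif, dsmul, hD (gen_mem u), hD (gen_mem v), hD (gen_mem v),
      hD (gen_mem u), vprod_add_right, vprod_add_right, e0 (vprod 0 a w)] at h1
    rw [← sub_eq_zero] at h1 ⊢
    rw [← h1]
    module
  -- Applying `D` once more and using `D² = 0` on generators leaves `2 [Du, Dv] = 0`. Therefore `u +
  -- Du` and `v + Dv` have the commutator of `u` and `v`.
  have e2 : vprod k (vprod 0 a (gen u)) (vprod l (vprod 0 a (gen v)) w) =
      sgn (gdeg u) (gdeg v) • vprod l (vprod 0 a (gen v)) (vprod k (vprod 0 a (gen u)) w) := by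
    have h1 := congrArg (vprod 0 a) (e1 w)
    have h2 := e1 (vprod 0 a w)
    simp only [vprod_add_right, dsmul, hD (gen_mem u), hD (gen_mem v), hD (hm u), hD (hm v), h,
      vprod_zero_left, smul_add] at h1 h2
    simp only [vprod_zero_right, smul_zero, zero_add] at h1
    rw [← sub_eq_zero]
    refine (smul_eq_zero.mp (?_ : (2 : ℂ) • _ = (0 : Space n m))).resolve_left two_ne_zero
    rw [← sub_eq_zero] at h1 h2
    rw [← sub_zero (0 : Space n m)]
    nth_rewrite 1 [← h1]
    rw [← h2]
    module
  have h1 := e1 w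
  simp only [vprod_add_left, vprod_add_right, e2, e0 w]
  rw [← sub_eq_zero] at h1 ⊢
  rw [← h1]
  module

/-- The inverse is the exponential for `-a`. The composite is computed from `ψ(a_(0) u) = (ψ a)_(0)
(ψ u)`, which is why both exponentials must fix `a`; `hfix` holds when `a` is built from generators
that `a_(0)` kills. -/
theorem isomorphic_of_exp {a : Space n m} (ha : a ∈ degSpace n m 0)
    (h : ∀ u, vprod 0 a (vprod 0 a (gen u)) = 0)
    (hfix : ∀ φ : Space n m →ₗ[ℂ] Space n m, IsVertexHom φ →
      (∀ u, vprod 0 a (gen u) = 0 → φ (gen u) = gen u) → φ a = a)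
    {q : Fin n → MvPolynomial (Fin n) ℂ}
    (hq : ∀ i, vprod 0 a (gen (Sum.inl (i, false))) = ofPoly (q i))
    {f f' : Fin m → MvPolynomial (Fin n) ℂ}
    (hQ : ∑ i, vprod (-1) (gen (dxi i) + vprod 0 a (gen (dxi i)))
      (ofPoly (MvPolynomial.aeval (fun j => MvPolynomial.X j + q j) (f i))) =
        (differentialElement f' : Space n m)) :
    (chiralKoszul f).Isomorphic (chiralKoszul f') := by
  obtain ⟨φ, hφ, hφg⟩ := exists_isVertexHom_exp ha h
  obtain ⟨ψ, hψ, hψg⟩ := exists_isVertexHom_exp (a := -a) (neg_mem ha) (fun u => by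
    rw [vprod_neg_left, vprod_neg_left, vprod_neg_right, neg_neg, h])
  simp only [vprod_neg_left] at hψg
  have hφa : φ a = a := hfix φ hφ fun u hu => by rw [hφg, hu, add_zero]
  have hψa : ψ a = a := hfix ψ hψ fun u hu => by rw [hψg, hu, neg_zero, add_zero]
  refine isomorphic_of_isVertexHom hφ hψ (fun u => ?_) (fun u => ?_) (fun u => ?_) ?_
  · rw [hφg, map_add, hψ.map_vprod, hψa, hψg, vprod_add_right, vprod_neg_right, h]
    abel
  · rw [hψg, map_add, map_neg, hφ.map_vprod, hφa, hφg, vprod_add_right, h]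
    abel
  · rw [hφg]
    refine add_mem (gen_mem u) ?_
    simpa only [zero_add] using vprod_mem ha (gen_mem u) 0
  · rw [← hQ, hφ.map_differentialElement (σ := fun j => MvPolynomial.X j + q j) fun i => by
      rw [hφg, hq, ofPoly_add, ofPoly_X]]
    simp only [hφg]

theorem vprod_zero_ofPoly {a : Space n m} (ha : a ∈ degSpace n m 0)
    {q : Fin n → MvPolynomial (Fin n) ℂ}
    (hq : ∀ i, vprod 0 a (gen (Sum.inl (i, false))) = ofPoly (q i)) (g : MvPolynomial (Fin n) ℂ) :
    vprod 0 a (ofPoly g) = ofPoly (MvPolynomial.mkDerivation ℂ q g) := by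
  induction g using ofPoly_induction with
  | one => rw [ofPoly_one, vprod_vacuum_nonneg le_rfl, Derivation.map_one_eq_zero, ofPoly_zero]
  | smul c f hf => rw [ofPoly_smul, vprod_smul_right, hf, Derivation.map_smul, ofPoly_smul]
  | add f g hf hg => rw [ofPoly_add, vprod_add_right, hf, hg, map_add, ofPoly_add]
  | mul_X f i hf =>
    rw [ofPoly_mul_X, vprod_zero_create ha, hq, hf, sgn_zero_left, one_smul, ← ofPoly_mul_X,
      Nat.cast_zero, neg_zero, zero_sub, vprod_ofPoly_ofPoly, ← ofPoly_add, Derivation.leibniz,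
      MvPolynomial.mkDerivation_X, smul_eq_mul, smul_eq_mul, mul_comm (q i), mul_comm _ (MvPolynomial.X i)]

theorem map_ofPoly_of_fixed {φ : Space n m →ₗ[ℂ] Space n m} (hφ : IsVertexHom φ)
    {p : MvPolynomial (Fin n) ℂ}
    (h : ∀ j ∈ p.vars, φ (gen (Sum.inl (j, false))) = gen (Sum.inl (j, false))) :
    φ (ofPoly p) = ofPoly p := by
  obtain ⟨S, hS⟩ : ∃ S : Set (Fin n), S = p.vars := ⟨_, rfl⟩
  have hp := MvPolynomial.mem_supported_vars p
  replace h : ∀ j ∈ S, φ (gen (Sum.inl (j, false))) = gen (Sum.inl (j, false)) := by simpa [hS] using h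
  rw [← hS, MvPolynomial.supported] at hp
  clear hS
  induction hp using Algebra.adjoin_induction with
  | mem x hx =>
    obtain ⟨j, hj, rfl⟩ := hx
    rw [ofPoly_X, h j hj]
  | algebraMap r =>
    rw [MvPolynomial.algebraMap_eq, ofPoly_C, map_smul, hφ.map_vacuum]
  | add x y _ _ hx hy => rw [ofPoly_add, map_add, hx, hy]
  | mul x y _ _ hx hy => rw [← vprod_ofPoly_ofPoly, hφ.map_vprod, hx, hy]

theorem vprod_zero_gen_of_deg_zero {a : Space n m} (ha : a ∈ degSpace n m 0) {u : Gen n m}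
    (h : ∀ k : ℕ, annihilate u (k + 1) a = 0) : vprod 0 a (gen u) = -annihilate u 0 a := by
  rw [vprod_zero_gen ha h, sgn_zero_left, one_smul]

theorem pderiv_comm (i j : Fin n) (p : MvPolynomial (Fin n) ℂ) :
    MvPolynomial.pderiv i (MvPolynomial.pderiv j p) =
      MvPolynomial.pderiv j (MvPolynomial.pderiv i p) := by
  have h : ⁅(MvPolynomial.pderiv i : Derivation ℂ (MvPolynomial (Fin n) ℂ) _),
      (MvPolynomial.pderiv j : Derivation ℂ (MvPolynomial (Fin n) ℂ) _)⁆ = 0 := by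
    refine MvPolynomial.derivation_ext fun k => ?_
    simp [Derivation.commutator_apply, MvPolynomial.pderiv_X, Pi.single_apply, apply_ite]
  have h1 := congrArg (fun D : Derivation ℂ (MvPolynomial (Fin n) ℂ) (MvPolynomial (Fin n) ℂ) => D p) h
  simpa [Derivation.commutator_apply, sub_eq_zero] using h1

/-- The substitution `xᵢ ↦ xᵢ + p`, where `p` does not involve `xᵢ`. -/
theorem isomorphic_shear (f : Fin m → MvPolynomial (Fin n) ℂ) (i : Fin n)
    {p : MvPolynomial (Fin n) ℂ} (hp : i ∉ p.vars) :
    (chiralKoszul f).Isomorphic (chiralKoszul fun j =>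
      MvPolynomial.aeval (fun k => MvPolynomial.X k + if k = i then p else 0) (f j)) := by
  have hpi := MvPolynomial.pderiv_eq_zero_of_notMem_vars hp
  -- The vector field `p ∂_{xᵢ}`. As `p` does not involve `xᵢ`, its zero mode kills both `p` and
  -- `∂_{xᵢ}`, and so has square zero on generators.
  set a : Space n m := create (Sum.inl (i, true)) 0 (ofPoly p) with ha'
  have ha : a ∈ degSpace n m 0 := by
    simpa [gdeg] using create_mem (u := Sum.inl (i, true)) (ofPoly_mem p) 0
  have hann : ∀ u k, annihilate u k a = create (Sum.inl (i, true)) 0 (annihilate u k (ofPoly p)) +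
      if k = 0 then pair u (Sum.inl (i, true)) • ofPoly p else 0 := fun u k => by
    rw [ha', annihilate_create]
    simp [gdeg, sgn_zero_right]
  have hD : ∀ u, vprod 0 a (gen u) = -(create (Sum.inl (i, true)) 0 (ofPoly (gderiv u p)) +
      pair u (Sum.inl (i, true)) • ofPoly p) := fun u => by
    rw [vprod_zero_gen_of_deg_zero ha fun k => by rw [hann, annihilate_ofPoly]; simp, hann,
      annihilate_ofPoly]
    simp
  have hq : ∀ k, vprod 0 a (gen (Sum.inl (k, false))) = ofPoly (if k = i then p else 0) := by
    intro k
    rw [hD]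
    by_cases hk : k = i <;> simp [gderiv, pair, ofPoly_zero, hk]
  have hpoly : ∀ g, vprod 0 a (ofPoly g) = ofPoly (p * MvPolynomial.pderiv i g) := by
    intro g
    rw [vprod_zero_ofPoly ha hq]
    congr 1
    have : MvPolynomial.mkDerivation ℂ (fun k => if k = i then p else 0) =
        p • (MvPolynomial.pderiv i : Derivation ℂ (MvPolynomial (Fin n) ℂ) _) := by
      refine MvPolynomial.derivation_ext fun k => ?_
      rw [MvPolynomial.mkDerivation_X, Derivation.smul_apply, MvPolynomial.pderiv_X, Pi.single_apply]
      by_cases hk : k = i <;> simp [hk]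
    rw [this]
    rfl
  have hDi : vprod 0 a (gen (Sum.inl (i, true))) = 0 := by
    rw [hD]; simp [gderiv, pair, hpi, ofPoly_zero]
  refine isomorphic_of_exp ha (fun u => ?_) (fun φ hφ hfix => ?_) hq ?_
  · have hpp : vprod 0 a (ofPoly p) = 0 := by rw [hpoly, hpi, mul_zero, ofPoly_zero]
    have hpd : vprod 0 a (ofPoly (gderiv u p)) = 0 := by
      rw [hpoly]
      rcases u with ⟨j, _ | _⟩ | ⟨j, b⟩ <;> simp [gderiv, ofPoly_zero, pderiv_comm i, hpi]
    rw [hD, vprod_neg_right, vprod_add_right, vprod_smul_right, hpp, vprod_zero_create ha, hDi, hpd]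
    simp [vprod_zero_left]
  · rw [ha', hφ.map_create, hfix _ hDi, map_ofPoly_of_fixed hφ, ← create_eq_vprod]
    intro j hj
    refine hfix _ ?_
    rw [hq, if_neg (by rintro rfl; exact hp hj), ofPoly_zero]
  · rw [differentialElement_eq]
    refine Finset.sum_congr rfl fun j _ => ?_
    have : vprod 0 a (gen (dxi j)) = 0 := by rw [hD]; simp [gderiv, pair, ofPoly_zero]
    rw [this, add_zero, create_eq_vprod]
    simp

theorem vprod_create_dxi_ofPoly (i : Fin m) (p g : MvPolynomial (Fin n) ℂ) :
    vprod (-1) (create (dxi i) 0 (ofPoly p)) (ofPoly g : Space n m) =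
      create (dxi i) 0 (ofPoly (p * g)) := by
  rw [vprod_create (ofPoly_mem p), bsum_eq_range (J := 1), bsum_eq_range (J := 0)]
  · simp [vprod_ofPoly_ofPoly]
  · intro j _
    rw [annihilate_ofPoly]
    split_ifs <;> simp [gderiv, ofPoly_zero, vprod_zero_right]
  · intro j hj
    have hb : ∀ i k, annihilate (Sum.inl (i, false)) k (ofPoly g : Space n m) = 0 := by
      intro i k
      rw [annihilate_ofPoly]
      simp [gderiv, ofPoly_zero]
    rw [(vprod_ofPoly hb p).1 _ (by omega), map_zero]

/-- The replacement of `fᵢ` by `fᵢ - p fₗ`, where `i ≠ l`. -/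
theorem isomorphic_exchange (f : Fin m → MvPolynomial (Fin n) ℂ) {i l : Fin m} (hil : i ≠ l)
    (p : MvPolynomial (Fin n) ℂ) :
    (chiralKoszul f).Isomorphic (chiralKoszul fun j => f j - if j = i then p * f l else 0) := by
  set w : Gen n m := Sum.inr (l, false)
  set b : Space n m := create (dxi i) 0 (ofPoly p) with hb'
  -- The element `ξₗ p ∂_{ξᵢ}`. Its zero mode sends `∂_{ξₗ}` to `-p ∂_{ξᵢ}`, which alters the `i`-th
  -- relation; because `i ≠ l`, it kills all the factors of `a`.
  set a : Space n m := create w 0 b with ha'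
  have hb : b ∈ degSpace n m 1 := by simpa [gdeg] using create_mem (u := dxi i) (ofPoly_mem p) 0
  have ha : a ∈ degSpace n m 0 := by simpa [gdeg, w] using create_mem (u := w) hb 0
  have hannb : ∀ u k, annihilate u k b = if k = 0 then
      sgn (gdeg u) 1 • create (dxi i) 0 (ofPoly (gderiv u p)) + pair u (dxi i) • ofPoly p else 0 :=
    fun u k => by
      rw [hb', annihilate_create, annihilate_ofPoly]
      split_ifs <;> simp [gdeg]
  have hanna : ∀ u k, annihilate u k a = if k = 0 then
      sgn (gdeg u) (-1) • create w 0 (sgn (gdeg u) 1 • create (dxi i) 0 (ofPoly (gderiv u p)) +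
        pair u (dxi i) • ofPoly p) + pair u w • b else 0 :=
    fun u k => by
      rw [ha', annihilate_create, hannb]
      split_ifs <;> simp [gdeg, w]
  have hD : ∀ u, vprod 0 a (gen u) = -(sgn (gdeg u) (-1) • create w 0
      (sgn (gdeg u) 1 • create (dxi i) 0 (ofPoly (gderiv u p)) +
        pair u (dxi i) • ofPoly p) + pair u w • b) := fun u => by
    rw [vprod_zero_gen_of_deg_zero ha fun k => by rw [hanna, if_neg (by omega)], hanna, if_pos rfl]
  have hq : ∀ k, vprod 0 a (gen (Sum.inl (k, false))) = ofPoly 0 := by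
    intro k
    rw [hD]
    simp [gderiv, pair, ofPoly_zero, w]
  have hpoly : ∀ g, vprod 0 a (ofPoly g) = 0 := by
    intro g
    rw [vprod_zero_ofPoly ha hq]
    have : MvPolynomial.mkDerivation ℂ (fun _ : Fin n => (0 : MvPolynomial (Fin n) ℂ)) = 0 :=
      MvPolynomial.derivation_ext fun k => by simp
    rw [this, Derivation.zero_apply, ofPoly_zero]
  have hDi : vprod 0 a (gen (dxi i)) = 0 := by
    rw [hD]; simp [gderiv, pair, ofPoly_zero, w, hil]
  have hDw : vprod 0 a (gen w) = 0 := by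
    rw [hD]; simp [gderiv, pair, ofPoly_zero, w, hil.symm]
  have hcw : ∀ v, vprod 0 a v = 0 → vprod 0 a (create w 0 v) = 0 := fun v hv => by
    rw [vprod_zero_create ha, hDw, hv, vprod_zero_left, map_zero, smul_zero, add_zero]
  have hci : ∀ v, vprod 0 a v = 0 → vprod 0 a (create (dxi i) 0 v) = 0 := fun v hv => by
    rw [vprod_zero_create ha, hDi, hv, vprod_zero_left, map_zero, smul_zero, add_zero]
  have hsmul : ∀ (s : ℤ) v, vprod 0 a v = 0 → vprod 0 a (s • v) = 0 := fun s v hv => by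
    rw [← Int.cast_smul_eq_zsmul ℂ, vprod_smul_right, hv, smul_zero]
  refine isomorphic_of_exp ha (fun u => ?_) (fun φ hφ hfix => ?_) hq ?_
  · rw [hD, vprod_neg_right, vprod_add_right, vprod_smul_right, hci _ (hpoly p), smul_zero,
      hsmul _ _ (hcw _ ?_), add_zero, neg_zero]
    rw [vprod_add_right, vprod_smul_right, hpoly, hsmul _ _ (hci _ (hpoly _)), smul_zero, add_zero]
  · rw [ha', hb', hφ.map_create, hφ.map_create, hfix _ hDi, hfix _ hDw, map_ofPoly_of_fixed hφ,
      ← create_eq_vprod, ← create_eq_vprod]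
    intro j _
    exact hfix _ (by rw [hq, ofPoly_zero])
  · have hDj : ∀ j, vprod 0 a (gen (dxi j)) = if j = l then -b else 0 := by
      intro j
      rw [hD]
      by_cases hj : j = l <;> simp [gderiv, pair, ofPoly_zero, w, hj]
    have haeval : ∀ g : MvPolynomial (Fin n) ℂ,
        MvPolynomial.aeval (fun j => MvPolynomial.X j + (fun _ => (0 : MvPolynomial (Fin n) ℂ)) j) g = g := by
      intro g
      simp
    simp only [haeval, hDj, vprod_add_left, differentialElement_eq, sub_eq_add_neg, ofPoly_add,
      ofPoly_neg, map_add, map_neg, Finset.sum_add_distrib]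
    congr 1
    · refine Finset.sum_congr rfl fun j _ => ?_
      rw [create_eq_vprod]
      simp
    · rw [Finset.sum_eq_single l, Finset.sum_eq_single i]
      · rw [if_pos rfl, if_pos rfl, vprod_neg_left, vprod_create_dxi_ofPoly]
      · intro j _ hj
        rw [if_neg hj, ofPoly_zero, map_zero, neg_zero]
      · simp
      · intro j _ hj
        rw [if_neg hj, vprod_zero_left]
      · simp

/-- Rescaling the variables and the `fᵢ`. -/
theorem isomorphic_scale (f : Fin m → MvPolynomial (Fin n) ℂ) (c : Fin n → ℂ) (hc : ∀ i, c i ≠ 0)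
    (d : Fin m → ℂ) (hd : ∀ i, d i ≠ 0) :
    (chiralKoszul f).Isomorphic (chiralKoszul fun i =>
      d i • MvPolynomial.aeval (fun j => c j • MvPolynomial.X j) (f i)) := by
  -- Dual generators receive inverse factors, so the pairing, and with it every commutator, is
  -- preserved.
  let χ : Gen n m → ℂ := fun u => match u with
    | Sum.inl (i, b) => if b then (c i)⁻¹ else c i
    | Sum.inr (i, b) => if b then d i else (d i)⁻¹
  have hχ : ∀ u, χ u ≠ 0 := by
    rintro (⟨i, _ | _⟩ | ⟨i, _ | _⟩) <;> simp [χ, hc, hd]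
  have hpair : ∀ u v, χ u * χ v * pair u v = pair u v := by
    rintro (⟨i, _ | _⟩ | ⟨i, _ | _⟩) (⟨j, _ | _⟩ | ⟨j, _ | _⟩) <;>
      first
      | simp [pair]; done
      | by_cases h : i = j
        · subst h
          simp [pair, χ, hc, hd]
        · simp [pair, h]
  have key : ∀ χ : Gen n m → ℂ, (∀ u v, χ u * χ v * pair u v = pair u v) →
      ∃ φ : Space n m →ₗ[ℂ] Space n m, IsVertexHom φ ∧ ∀ u, φ (gen u) = χ u • gen u := by
    intro χ hp
    refine exists_isVertexHom (fun u => Submodule.smul_mem _ _ (gen_mem u)) fun u v k l w => ?_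
    simp only [vprod_smul_left, vprod_smul_right, vprod_gen, genMode_genMode u v]
    split_ifs
    · nth_rewrite 2 [← hp u v]
      module
    · module
  obtain ⟨φ, hφ, hφg⟩ := key χ hpair
  obtain ⟨ψ, hψ, hψg⟩ := key (fun u => (χ u)⁻¹) fun u v => by
    nth_rewrite 1 [← hpair u v]
    field_simp [hχ u, hχ v]
  refine isomorphic_of_isVertexHom hφ hψ (fun u => ?_) (fun u => ?_) (fun u => ?_) ?_
  · rw [hφg, map_smul, hψg, smul_smul, mul_inv_cancel₀ (hχ u), one_smul]
  · rw [hψg, map_smul, hφg, smul_smul, inv_mul_cancel₀ (hχ u), one_smul]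
  · rw [hφg]
    exact Submodule.smul_mem _ _ (gen_mem u)
  · rw [hφ.map_differentialElement (σ := fun j => c j • MvPolynomial.X j) fun i => by
      rw [hφg, ofPoly_smul, ofPoly_X]; rfl, differentialElement_eq]
    refine Finset.sum_congr rfl fun i _ => ?_
    rw [hφg, vprod_smul_left, ofPoly_smul, map_smul, create_eq_vprod]
    simp [χ]

end Chiral

/-! ### Retracts of dg vertex algebras -/

/-- For closed `b` the difference `b - ι (π b)` is closed and killed by `π`, hence exact. So `ι` and
`π` are inverse to each other on cohomology. -/
theorem IsChiralRetract.of_acyclic {M V : DGVertexData} (hM : M.IsDGVertexAlgebra)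
    (hV : V.IsDGVertexAlgebra) {ι : M.carrier →ₗ[ℂ] V.carrier} {π : V.carrier →ₗ[ℂ] M.carrier}
    (hι : IsDGVertexHom M V ι)
    (π_deg : ∀ (p : ℤ) (v : V.carrier), v ∈ V.deg p → π v ∈ M.deg p)
    (π_d : ∀ v : V.carrier, π (V.d v) = M.d (π v))
    (π_T : ∀ v : V.carrier, π (V.T v) = M.T (π v))
    (π_prod : ∀ (n : ℤ) (a : M.carrier) (v : V.carrier),
      π (V.prod n (ι a) v) = M.prod n a (π v))
    (π_ι : ∀ a : M.carrier, π (ι a) = a)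
    (acyclic : ∀ v, V.d v = 0 → π v = 0 → ∃ w, v = V.d w) : IsChiralRetract M V ι π where
  isHom := hι
  π_deg := π_deg
  π_d := π_d
  π_T := π_T
  π_prod := π_prod
  π_ι := π_ι
  ι_quasiIso := by
    refine ⟨fun a _ ⟨c, hc⟩ => ⟨π c, ?_⟩, fun b hb => ⟨π b, ?_, ?_⟩⟩
    · rw [← π_d, ← hc, π_ι]
    · rw [← π_d, hb, map_zero]
    · obtain ⟨w, hw⟩ := acyclic (b - ι (π b)) (by
        rw [hV.d_linear.map_sub, ← hι.map_d, ← π_d, hb, map_zero, map_zero, sub_zero]) (by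
        rw [map_sub, π_ι, sub_self])
      exact ⟨w, by rw [← hw]; abel⟩
  π_quasiIso := by
    refine ⟨fun v hv ⟨c, hc⟩ => ?_, fun b hb => ⟨ι b, ?_, 0, ?_⟩⟩
    · obtain ⟨w, hw⟩ := acyclic (v - V.d (ι c)) (by
        rw [hV.d_linear.map_sub, hv, hV.d_d, sub_zero]) (by
        rw [map_sub, π_d, π_ι, hc, sub_self])
      exact ⟨w + ι c, by rw [hV.d_linear.map_add, ← hw]; abel⟩
    · rw [← hι.map_d, hb, map_zero]
    · rw [π_ι, hM.d_linear.map_zero, add_zero]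

theorem IsDGVertexHom.comp {U V W : DGVertexData} {φ : V.carrier →ₗ[ℂ] W.carrier}
    {ψ : U.carrier →ₗ[ℂ] V.carrier} (hφ : IsDGVertexHom V W φ) (hψ : IsDGVertexHom U V ψ) :
    IsDGVertexHom U W (φ ∘ₗ ψ) where
  map_deg p a ha := hφ.map_deg p _ (hψ.map_deg p a ha)
  map_vac := by rw [LinearMap.comp_apply, hψ.map_vac, hφ.map_vac]
  map_prod n a b := by simp only [LinearMap.comp_apply, hψ.map_prod, hφ.map_prod]
  map_T a := by simp only [LinearMap.comp_apply, hψ.map_T, hφ.map_T]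
  map_d a := by simp only [LinearMap.comp_apply, hψ.map_d, hφ.map_d]

theorem DGVertexData.Isomorphic.trans {U V W : DGVertexData} (h1 : U.Isomorphic V)
    (h2 : V.Isomorphic W) : U.Isomorphic W := by
  obtain ⟨φ, hφ⟩ := h1
  obtain ⟨ψ, hψ⟩ := h2
  exact ⟨φ.trans ψ, hψ.comp hφ⟩

theorem DGVertexData.Isomorphic.refl (V : DGVertexData) : V.Isomorphic V :=
  ⟨LinearEquiv.refl ℂ _, ⟨fun _ _ h => h, rfl, fun _ _ _ => rfl, fun _ => rfl, fun _ => rfl⟩⟩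

theorem IsDGVertexHom.symm {V W : DGVertexData} {φ : V.carrier ≃ₗ[ℂ] W.carrier}
    (h : IsDGVertexHom V W φ.toLinearMap)
    (hdeg : ∀ (p : ℤ) (a : W.carrier), a ∈ W.deg p → φ.symm a ∈ V.deg p) :
    IsDGVertexHom W V φ.symm.toLinearMap where
  map_deg := hdeg
  map_vac := φ.symm_apply_eq.mpr h.map_vac.symm
  map_prod n a b := φ.symm_apply_eq.mpr (by
    have := h.map_prod n (φ.symm a) (φ.symm b)
    simpa using this.symm)
  map_T a := φ.symm_apply_eq.mpr (by
    have := h.map_T (φ.symm a)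
    simpa using this.symm)
  map_d a := φ.symm_apply_eq.mpr (by
    have := h.map_d (φ.symm a)
    simpa using this.symm)

/-- A retract followed by an isomorphism. -/
theorem IsChiralRetract.comp_isomorphism {M V W : DGVertexData} (hM : M.IsDGVertexAlgebra)
    (hW : W.IsDGVertexAlgebra) {ι : M.carrier →ₗ[ℂ] V.carrier} {π : V.carrier →ₗ[ℂ] M.carrier}
    (h : IsChiralRetract M V ι π) {φ : V.carrier ≃ₗ[ℂ] W.carrier}
    (hφ : IsDGVertexHom V W φ.toLinearMap) (hφ' : IsDGVertexHom W V φ.symm.toLinearMap) :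
    IsChiralRetract M W (φ.toLinearMap ∘ₗ ι) (π ∘ₗ φ.symm.toLinearMap) := by
  refine IsChiralRetract.of_acyclic hM hW (hφ.comp h.isHom) (fun p v hv => ?_) (fun v => ?_)
    (fun v => ?_) (fun n a v => ?_) (fun a => ?_) fun v hv hπ => ?_
  · exact h.π_deg p _ (hφ'.map_deg p v hv)
  · rw [LinearMap.comp_apply, LinearMap.comp_apply, hφ'.map_d, h.π_d]
  · rw [LinearMap.comp_apply, LinearMap.comp_apply, hφ'.map_T, h.π_T]
  · rw [LinearMap.comp_apply, LinearMap.comp_apply, LinearMap.comp_apply, hφ'.map_prod, ← h.π_prod]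
    simp
  · simp [h.π_ι]
  · obtain ⟨w, hw⟩ := h.π_quasiIso.1 (φ.symm v) (by
      have := hφ'.map_d v
      rw [hv, map_zero] at this
      exact this.symm) ⟨0, by
        rw [hM.d_linear.map_zero]
        exact hπ⟩
    refine ⟨φ w, ?_⟩
    have := hφ.map_d w
    rw [← hw] at this
    simpa using this

namespace Chiral

open FieldCalculus

variable {n m r s : ℕ}

/-- A map preserving degrees commutes with `degScale 2`, hence so does its inverse, and membership
in a degree is an eigenvalue equation. -/
theorem symm_mem_degSpace {n' m' : ℕ} {φ : Space n m ≃ₗ[ℂ] Space n' m'}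
    (h : ∀ p, ∀ a ∈ degSpace n m p, φ a ∈ degSpace n' m' p) (p : ℤ) (a : Space n' m')
    (ha : a ∈ degSpace n' m' p) : φ.symm a ∈ degSpace n m p := by
  have hs : ∀ v, φ (degScale 2 v) = degScale 2 (φ v) := by
    intro v
    induction v using homogeneous_induction with
    | hom q v hv => rw [mem_degSpace_iff.mp hv, mem_degSpace_iff.mp (h q v hv), map_smul]
    | add v w hv hw => simp only [map_add, hv, hw]
  refine mem_degSpace_iff.mpr (φ.injective ?_)
  rw [hs, map_smul, φ.apply_symm_apply]
  exact mem_degSpace_iff.mp ha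

theorem isDGVertexHom_symm {n' m' : ℕ} {f : Fin m → MvPolynomial (Fin n) ℂ}
    {f' : Fin m' → MvPolynomial (Fin n') ℂ}
    {φ : (chiralKoszul f).carrier ≃ₗ[ℂ] (chiralKoszul f').carrier}
    (h : IsDGVertexHom (chiralKoszul f) (chiralKoszul f') φ.toLinearMap) :
    IsDGVertexHom (chiralKoszul f') (chiralKoszul f) φ.symm.toLinearMap :=
  h.symm (symm_mem_degSpace (φ := φ) h.map_deg)

theorem isomorphic_symm {n' m' : ℕ} {f : Fin m → MvPolynomial (Fin n) ℂ}
    {f' : Fin m' → MvPolynomial (Fin n') ℂ} (h : (chiralKoszul f).Isomorphic (chiralKoszul f')) :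
    (chiralKoszul f').Isomorphic (chiralKoszul f) := by
  obtain ⟨φ, hφ⟩ := h
  exact ⟨φ.symm, isDGVertexHom_symm hφ⟩

theorem exists_isChiralRetract_of_isomorphic {n' m' : ℕ} {f : Fin m → MvPolynomial (Fin n) ℂ}
    {f' : Fin m' → MvPolynomial (Fin n') ℂ} {M : DGVertexData} (hM : M.IsDGVertexAlgebra)
    (h : ∃ ι π, IsChiralRetract M (chiralKoszul f) ι π)
    (hf : (chiralKoszul f).Isomorphic (chiralKoszul f')) :
    ∃ ι π, IsChiralRetract M (chiralKoszul f') ι π := by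
  obtain ⟨ι, π, h⟩ := h
  obtain ⟨φ, hφ⟩ := hf
  exact ⟨_, _, h.comp_isomorphism hM (isDGVertexAlgebra f') hφ (isDGVertexHom_symm hφ)⟩

/-! ### Stabilization -/

/-- The inclusion of the generators of a smaller Fock space. -/
def genMap (e : Fin r → Fin n) (e' : Fin s → Fin m) : Gen r s → Gen n m
  | Sum.inl (i, b) => Sum.inl (e i, b)
  | Sum.inr (i, b) => Sum.inr (e' i, b)

section Stabilization

variable {e : Fin r → Fin n} {e' : Fin s → Fin m}

theorem gdeg_genMap (u : Gen r s) : gdeg (genMap e e' u) = gdeg u := by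
  rcases u with ⟨i, b⟩ | ⟨i, b⟩ <;> rfl

theorem genMap_injective (he : Function.Injective e) (he' : Function.Injective e') :
    Function.Injective (genMap e e') := by
  rintro (⟨i, b⟩ | ⟨i, b⟩) (⟨j, c⟩ | ⟨j, c⟩) h <;> simp [genMap] at h ⊢
  · exact ⟨he h.1, h.2⟩
  · exact ⟨he' h.1, h.2⟩

theorem pair_genMap (he : Function.Injective e) (he' : Function.Injective e') (u v : Gen r s) :
    pair (genMap e e' u) (genMap e e' v) = pair u v := by
  rcases u with ⟨i, b⟩ | ⟨i, b⟩ <;> rcases v with ⟨j, c⟩ | ⟨j, c⟩ <;>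
    simp [genMap, pair, he.eq_iff, he'.eq_iff]

theorem pair_genMap_eq_zero {w : Gen n m} (hw : w ∉ Set.range (genMap e e')) (u : Gen r s) :
    pair (genMap e e' u) w = 0 := by
  rcases u with ⟨i, b⟩ | ⟨i, b⟩ <;> rcases w with ⟨j, c⟩ | ⟨j, c⟩ <;> simp only [genMap, pair]
  · rw [if_neg]
    rintro rfl
    exact hw ⟨Sum.inl (i, c), rfl⟩
  · rw [if_neg]
    rintro ⟨rfl, -⟩
    exact hw ⟨Sum.inr (i, c), rfl⟩

theorem exists_inclusion (he : Function.Injective e) (he' : Function.Injective e') :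
    ∃ ι : Space r s →ₗ[ℂ] Space n m, IsVertexHom ι ∧
      ∀ u k v, ι (create u k v) = create (genMap e e' u) k (ι v) := by
  obtain ⟨ι, hι, h⟩ := exists_isVertexHom (b := fun u : Gen r s => (gen (genMap e e' u) : Space n m))
    (fun u => by rw [← gdeg_genMap (e := e) (e' := e')]; exact gen_mem _) (fun u v k l w => by
      rw [vprod_gen, vprod_gen, genMode_genMode, pair_genMap he he', gdeg_genMap, gdeg_genMap,
        vprod_gen, vprod_gen])
  exact ⟨ι, hι, fun u k v => by rw [hι.map_create, h, create_eq_vprod]⟩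

open Classical in
-- Setting the additional variables to zero. The result need not respect all products; it is
-- compatible with the operators of the remaining generators, which yields linearity over the
-- smaller vertex algebra.
theorem exists_projection (he : Function.Injective e) (he' : Function.Injective e') :
    ∃ π : Space n m →ₗ[ℂ] Space r s, π vacuum = vacuum ∧
      (∀ u k v, π (create (genMap e e' u) k v) = create u k (π v)) ∧
      ∀ w, w ∉ Set.range (genMap e e') → ∀ k v, π (create w k v) = 0 := by
  obtain ⟨π, h0, h⟩ := exists_lift (c := fun (w : Gen n m) (k : ℕ) =>
      if h : ∃ u, genMap e e' u = w then (create h.choose k : Space r s →ₗ[ℂ] Space r s) else 0)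
    (fun u v k l w => by
      by_cases hu : ∃ u', genMap e e' u' = u
      · by_cases hv : ∃ v', genMap e e' v' = v
        · simp only [dif_pos hu, dif_pos hv]
          have h1 := hu.choose_spec
          have h2 := hv.choose_spec
          rw [create_create]
          congr 2
          · conv_rhs => rw [← h1, gdeg_genMap]
          · conv_rhs => rw [← h2, gdeg_genMap]
        · simp only [dif_neg hv, LinearMap.zero_apply, map_zero, smul_zero]
      · simp only [dif_neg hu, LinearMap.zero_apply, map_zero, smul_zero]) vacuum
  refine ⟨π, h0, fun u k v => ?_, fun w hw k v => ?_⟩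
  · have hu : ∃ u', genMap e e' u' = genMap e e' u := ⟨u, rfl⟩
    rw [h, dif_pos hu, genMap_injective he he' hu.choose_spec]
  · rw [h, dif_neg (show ¬∃ u, genMap e e' u = w from hw)]
    rfl

end Stabilization

end Chiral

/-! ### Parity and homotopies on the Fock space -/

namespace Chiral

open FieldCalculus

variable {n m r s : ℕ}

theorem parity_parity (v : Space n m) : parity (parity v) = v := by
  refine linearMap_ext (f := parity ∘ₗ parity) (g := LinearMap.id) (fun p => ?_) v
  rw [LinearMap.comp_apply, parity_single, parity_single, mul_assoc, ← mul_pow]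
  simp

theorem parity_vacuum : parity (vacuum : Space n m) = vacuum := by
  rw [vacuum, parity_single]
  simp

theorem parity_genMode (u : Gen n m) (l : ℤ) (v : Space n m) :
    parity (genMode u l v) = sgn 1 (gdeg u) • genMode u l (parity v) := by
  rw [parity_eq_degScale, parity_eq_degScale]
  have := scales_genField (n := n) (m := m) (c := -1) (by norm_num) u l v
  refine this.trans ?_
  have h : ((-1 : ℂ) ^ gdeg u) = (sgn 1 (gdeg u) : ℤ) := by
    rcases u with _ | ⟨i, _ | _⟩ <;> simp [gdeg, sgn]
  rw [h, Int.cast_smul_eq_zsmul]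
  rfl

theorem parity_create (u : Gen n m) (k : ℕ) (v : Space n m) :
    parity (create u k v) = sgn 1 (gdeg u) • create u k (parity v) := by
  rw [← genMode_neg, parity_genMode]

theorem parity_annihilate (u : Gen n m) (k : ℕ) (v : Space n m) :
    parity (annihilate u k v) = sgn 1 (gdeg u) • annihilate u k (parity v) := by
  rw [← genMode_natCast, parity_genMode]

theorem parity_of_mem {q : ℤ} {v : Space n m} (hv : v ∈ degSpace n m q) :
    parity v = (-1 : ℂ) ^ q • v := by
  rw [parity_eq_degScale, degScale_of_mem hv]

theorem parity_differential (f : Fin m → MvPolynomial (Fin n) ℂ) (v : Space n m) :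
    parity (vprod 0 (differentialElement f) v) = -vprod 0 (differentialElement f) (parity v) := by
  induction v using homogeneous_induction with
  | hom q v hv =>
    rw [parity_of_mem hv, parity_of_mem (vprod_mem (differentialElement_mem f) hv 0),
      vprod_smul_right, zpow_add₀ (by norm_num)]
    simp
  | add v w hv hw => rw [vprod_add_right, map_add, map_add, vprod_add_right, hv, hw, neg_add]

/-- The derivation `u^{(k)} ↦ η(u) τ(u)^{(k)}` of degree `-1`, composed with the parity operator. -/
theorem exists_homotopy (η : Gen n m → ℂ) (τ : Gen n m → Gen n m)
    (hτ : ∀ u, η u ≠ 0 → gdeg (τ u) = gdeg u - 1) :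
    ∃ θ : Space n m →ₗ[ℂ] Space n m, θ vacuum = 0 ∧
      ∀ u k v, θ (create u k v) = create u k (θ v) + η u • create (τ u) k (parity v) := by
  have hcomm : ∀ (u v : Gen n m) k l x, create u k (η v • create (τ v) l x) =
      (sgn (gdeg u) (gdeg v) * sgn 1 (gdeg u)) • η v • create (τ v) l (create u k x) := by
    intro u v k l x
    by_cases hv : η v = 0
    · simp [hv]
    · rw [map_smul, create_create, hτ v hv, smul_comm (η v), sub_eq_add_neg, sgn_add_right]
      congr 2
      rcases u with _ | ⟨i, _ | _⟩ <;> simp [gdeg, sgn]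
  -- A derivation is obtained as a homomorphism over dual numbers: the first coordinate is the
  -- identity, and the second records the derivative.
  obtain ⟨φ, h0, h⟩ := exists_lift (W := Space n m × Space n m) (c := fun u k =>
    ((create u k).comp (LinearMap.fst ℂ _ _)).prod ((create u k).comp (LinearMap.snd ℂ _ _) +
      η u • (create (τ u) k).comp (parity.comp (LinearMap.fst ℂ _ _)))) (by
    rintro u v k l ⟨x, y⟩
    refine Prod.ext (create_create u v k l x) ?_
    change create u k (create v l y + η v • create (τ v) l (parity x)) +
        η u • create (τ u) k (parity (create v l x)) = sgn (gdeg u) (gdeg v) •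
      (create v l (create u k y + η u • create (τ u) k (parity x)) +
        η v • create (τ v) l (parity (create u k x)))
    simp only [map_add, parity_create, map_zsmul]
    rw [hcomm u v, smul_comm (η u), create_create u v k l y]
    have h2 := hcomm v u l k (parity x)
    rw [h2, smul_add, smul_add, smul_smul, sgn_comm (gdeg v), ← mul_assoc, sgn_mul_self, one_mul]
    rw [smul_comm (η v) (sgn 1 (gdeg u)), mul_smul]
    abel) (vacuum, 0)
  have h1 : ∀ v, (φ v).1 = v := fun v => linearMap_ext_create
    (f := (LinearMap.fst ℂ _ _).comp φ) (g := LinearMap.id) (by simp [h0]) (fun u k v ih => by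
      simp only [LinearMap.comp_apply, h] at ih ⊢
      exact congrArg _ ih) v
  refine ⟨(LinearMap.snd ℂ _ _).comp φ, by simp [h0], fun u k v => ?_⟩
  simp [h, h1]

/-! ### The retract of a stabilization -/

section Stabilization

variable {e : Fin r → Fin n} (E : Fin s ⊕ {k // k ∉ Set.range e} ≃ Fin m)

/-- The generators `z`, `∂_z` (`o = false`) and `ζ`, `∂_ζ` (`o = true`) of a contractible factor. -/
def contractibleGen (k : {k // k ∉ Set.range e}) (o b : Bool) : Gen n m :=
  if o then Sum.inr (E (Sum.inr k), b) else Sum.inl (k.1, b)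

/-- The generators of the two factors. -/
def splitGen : Gen r s ⊕ ({k // k ∉ Set.range e} × Bool × Bool) → Gen n m
  | Sum.inl u => genMap e (fun j => E (Sum.inl j)) u
  | Sum.inr (k, o, b) => contractibleGen E k o b

theorem splitGen_bijective (he : Function.Injective e) : Function.Bijective (splitGen E) := by
  have he' : Function.Injective fun j => E (Sum.inl j) := E.injective.comp Sum.inl_injective
  constructor
  · rintro (u | ⟨k, o, b⟩) (v | ⟨l, o', c⟩) h
    · exact congrArg _ (genMap_injective he he' h)
    · rcases u with ⟨i, b⟩ | ⟨i, b⟩ <;> cases o' <;>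
        simp [splitGen, contractibleGen, genMap] at h
      exact absurd ⟨i, h.1⟩ l.2
    · rcases v with ⟨i, b⟩ | ⟨i, b⟩ <;> cases o <;>
        simp [splitGen, contractibleGen, genMap] at h
      exact absurd ⟨i, h.1.symm⟩ k.2
    · cases o <;> cases o' <;> simp [splitGen, contractibleGen] at h ⊢
      · exact ⟨Subtype.ext h.1, h.2⟩
      · exact h
  · rintro (⟨i, b⟩ | ⟨j, b⟩)
    · by_cases h : i ∈ Set.range e
      · obtain ⟨i, rfl⟩ := h
        exact ⟨Sum.inl (Sum.inl (i, b)), rfl⟩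
      · exact ⟨Sum.inr (⟨i, h⟩, false, b), rfl⟩
    · obtain ⟨j | k, rfl⟩ := E.surjective j
      · exact ⟨Sum.inl (Sum.inr (j, b)), rfl⟩
      · exact ⟨Sum.inr (k, true, b), rfl⟩

theorem gdeg_contractibleGen (k : {k // k ∉ Set.range e}) (o b : Bool) :
    gdeg (contractibleGen (m := m) E k o b) = if o then (if b then 1 else -1) else 0 := by
  cases o <;> rfl

/-- The relations of the contractible factor, with zeros added. -/
def contractibleRelations (j : Fin m) : MvPolynomial (Fin n) ℂ :=
  Sum.elim (fun _ => 0) (fun k => MvPolynomial.X k.1) (E.symm j)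

theorem differential_genMap (u : Gen r s) :
    vprod 0 (differentialElement (contractibleRelations E))
      (gen (genMap e (fun j => E (Sum.inl j)) u)) = 0 := by
  rcases u with ⟨i, _ | _⟩ | ⟨j, _ | _⟩
  · exact differential_x _ _
  · refine (differential_dx _ _).trans ?_
    rw [Finset.sum_eq_zero, neg_zero]
    intro j _
    obtain ⟨j | k, rfl⟩ := E.surjective j
    · simp [contractibleRelations, ofPoly_zero]
    · have : e i ≠ k.1 := fun h => k.2 ⟨i, h⟩
      simp [contractibleRelations, MvPolynomial.pderiv_X, this.symm, ofPoly_zero]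
  · refine (differential_xi _ _).trans ?_
    simp [contractibleRelations, ofPoly_zero]
  · exact differential_dxi _ _

/-- The factor carries `ζ ↦ z` and `∂_z ↦ -∂_ζ`, the other two generators being closed. It consists
of two acyclic pairs. -/
theorem differential_contractibleGen (k : {k // k ∉ Set.range e}) (o b : Bool) :
    vprod 0 (differentialElement (contractibleRelations E)) (gen (contractibleGen E k o b)) =
      (if o = b then 0 else if o then 1 else -1 : ℂ) • gen (contractibleGen E k (!o) b) := by
  cases o <;> cases b
  · simpa [contractibleGen] using differential_x _ _
  · refine (differential_dx _ _).trans ?_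
    rw [Finset.sum_eq_single (E (Sum.inr k))]
    · simp [contractibleRelations, contractibleGen, gen, dxi, ofPoly_one]
    · intro j _ hj
      obtain ⟨j | l, rfl⟩ := E.surjective j
      · simp [contractibleRelations, ofPoly_zero]
      · have : l ≠ k := fun h => hj (by rw [h])
        have : l.1 ≠ k.1 := fun h => this (Subtype.ext h)
        simp [contractibleRelations, MvPolynomial.pderiv_X, this, ofPoly_zero]
    · simp
  · refine (differential_xi _ _).trans ?_
    simp [contractibleRelations, contractibleGen, ofPoly_X]
  · simpa [contractibleGen] using differential_dxi _ _

open Classical in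
/-- A homotopy on the contractible factor: its anticommutator with the differential counts the
variables of the contractible factor. -/
theorem exists_contracting_homotopy (he : Function.Injective e) :
    ∃ θ C : Space n m →ₗ[ℂ] Space n m, θ vacuum = 0 ∧ C vacuum = 0 ∧
      (∀ v, C v = vprod 0 (differentialElement (contractibleRelations E)) (θ (parity v)) +
        θ (parity (vprod 0 (differentialElement (contractibleRelations E)) v))) ∧
      (∀ (u : Gen r s) l v, θ (vprod l (gen (genMap e (fun j => E (Sum.inl j)) u)) v) =
        vprod l (gen (genMap e (fun j => E (Sum.inl j)) u)) (θ v)) ∧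
      ∀ w k v, C (create w k v) = create w k (C v) +
        if w ∈ Set.range (genMap e (fun j => E (Sum.inl j))) then 0 else create w k v := by
  have he' : Function.Injective fun j => E (Sum.inl j) := E.injective.comp Sum.inl_injective
  let Φ := Equiv.ofBijective _ (splitGen_bijective E he)
  have Φl : ∀ u, Φ.symm (genMap e (fun j => E (Sum.inl j)) u) = Sum.inl u :=
    fun u => Φ.symm_apply_eq.mpr rfl
  have Φr : ∀ k o b, Φ.symm (contractibleGen E k o b) = Sum.inr (k, o, b) :=
    fun k o b => Φ.symm_apply_eq.mpr rfl
  have hrange : ∀ k o b, contractibleGen E k o b ∉ Set.range (genMap e (fun j => E (Sum.inl j))) := by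
    rintro k o b ⟨u, hu⟩
    have := Φr k o b
    rw [← hu, Φl] at this
    cases this
  -- The homotopy reverses the differential: `z ↦ ζ` and `∂_ζ ↦ ∂_z`. The differential has a minus
  -- sign on `∂_z`, and the parity operator compensates it, so each of the four generators is
  -- counted with weight one.
  let η : Gen n m → ℂ := fun w => match Φ.symm w with
    | Sum.inl _ => 0
    | Sum.inr (_, o, b) => if o = b then 1 else 0
  let τ : Gen n m → Gen n m := fun w => match Φ.symm w with
    | Sum.inl _ => w
    | Sum.inr (k, o, b) => contractibleGen E k (!o) b
  have ηl : ∀ u, η (genMap e (fun j => E (Sum.inl j)) u) = 0 := fun u => by simp only [η, Φl]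
  have ηr : ∀ k o b, η (contractibleGen E k o b) = if o = b then 1 else 0 := fun k o b => by
    simp only [η, Φr]
  have τr : ∀ k o b, τ (contractibleGen E k o b) = contractibleGen E k (!o) b := fun k o b => by
    simp only [τ, Φr]
  have cases_gen : ∀ w : Gen n m, (∃ u, w = genMap e (fun j => E (Sum.inl j)) u) ∨
      ∃ k o b, w = contractibleGen E k o b := by
    intro w
    obtain ⟨u | ⟨k, o, b⟩, rfl⟩ := (splitGen_bijective E he).surjective w
    · exact Or.inl ⟨u, rfl⟩
    · exact Or.inr ⟨k, o, b, rfl⟩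
  obtain ⟨θ, hθ0, hθ⟩ := exists_homotopy η τ (fun w hw => by
    rcases cases_gen w with ⟨u, rfl⟩ | ⟨k, o, b, rfl⟩
    · exact absurd (ηl u) hw
    · rw [τr, gdeg_contractibleGen, gdeg_contractibleGen]
      rw [ηr] at hw
      cases o <;> cases b <;> simp at hw ⊢)
  have hθl : ∀ (u : Gen r s) k v, θ (create (genMap e (fun j => E (Sum.inl j)) u) k v) =
      create (genMap e (fun j => E (Sum.inl j)) u) k (θ v) := fun u k v => by
    rw [hθ, ηl, zero_smul, add_zero]
  have hθa : ∀ (u : Gen r s) k v, θ (annihilate (genMap e (fun j => E (Sum.inl j)) u) k v) =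
      annihilate (genMap e (fun j => E (Sum.inl j)) u) k (θ v) := by
    intro u k v
    refine linearMap_ext_create (f := θ ∘ₗ annihilate _ k) (g := annihilate _ k ∘ₗ θ) ?_ ?_ v
    · simp [annihilate_vacuum, hθ0]
    · intro w l v ih
      simp only [LinearMap.comp_apply] at ih ⊢
      have hif : ∀ c : ℂ, θ (if k = l then c • v else 0) = if k = l then c • θ v else 0 := fun c => by
        split_ifs <;> simp
      rw [annihilate_create, map_add, map_zsmul, hθ, hθ, ih, map_add, map_smul, annihilate_create,
        hif, parity_annihilate]
      rcases cases_gen w with ⟨u', rfl⟩ | ⟨j, o, b, rfl⟩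
      · rw [ηl]; simp
      · have hs : (if o = b then (1 : ℂ) else 0) • sgn (gdeg (genMap e (fun j => E (Sum.inl j)) u))
            (gdeg (contractibleGen E j o b)) • sgn 1 (gdeg (genMap e (fun j => E (Sum.inl j)) u)) •
              create (contractibleGen E j (!o) b) l (annihilate (genMap e (fun j => E (Sum.inl j)) u) k
                (parity v)) = (if o = b then (1 : ℂ) else 0) • sgn (gdeg (genMap e (fun j => E (Sum.inl j)) u))
            (gdeg (contractibleGen E j (!o) b)) • create (contractibleGen E j (!o) b) l
              (annihilate (genMap e (fun j => E (Sum.inl j)) u) k (parity v)) := by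
          rw [gdeg_contractibleGen, gdeg_contractibleGen, gdeg_genMap]
          rcases u with _ | ⟨i, _ | _⟩ <;> cases o <;> cases b <;> simp [gdeg, sgn]
        rw [ηr, τr, annihilate_create, pair_genMap_eq_zero (hrange _ _ _),
          pair_genMap_eq_zero (hrange _ _ _)]
        simp only [zero_smul, ite_self, add_zero, map_zsmul, smul_add]
        rw [← hs]
        module
  set D : Space n m →ₗ[ℂ] Space n m :=
    (toField (differentialElement (contractibleRelations E))).modes 0 with hD
  have hDv : ∀ v, vprod 0 (differentialElement (contractibleRelations E)) v = D v := fun v => rfl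
  have hPD : ∀ v, parity (D v) = -D (parity v) := fun v => parity_differential _ v
  have hDl : ∀ (u : Gen r s) l v, D (create (genMap e (fun j => E (Sum.inl j)) u) l v) =
      sgn 1 (gdeg u) • create (genMap e (fun j => E (Sum.inl j)) u) l (D v) := fun u l v => by
    rw [← hDv, vprod_zero_create (differentialElement_mem _), differential_genMap, vprod_zero_left,
      zero_add, gdeg_genMap, hDv]
  have hDr : ∀ k o b l v, D (create (contractibleGen E k o b) l v) =
      (if o = b then 0 else if o then 1 else -1 : ℂ) • create (contractibleGen E k (!o) b) l v +
        sgn 1 (if o then (if b then 1 else -1) else 0) • create (contractibleGen E k o b) l (D v) :=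
    fun k o b l v => by
      rw [← hDv, vprod_zero_create (differentialElement_mem _), differential_contractibleGen,
        vprod_smul_left, gdeg_contractibleGen, ← create_eq_vprod, hDv]
  have hPr : ∀ k o b l v, parity (create (contractibleGen (m := m) E k o b) l v) =
      sgn 1 (if o then (if b then 1 else -1) else 0) •
        create (contractibleGen E k o b) l (parity v) := fun k o b l v => by
    rw [parity_create, gdeg_contractibleGen]
  have hθr : ∀ k o b l v, θ (create (contractibleGen E k o b) l v) =
      create (contractibleGen E k o b) l (θ v) +
        (if o = b then 1 else 0 : ℂ) • create (contractibleGen E k (!o) b) l (parity v) :=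
    fun k o b l v => by rw [hθ, ηr, τr]
  refine ⟨θ, D ∘ₗ θ ∘ₗ parity + θ ∘ₗ parity ∘ₗ D, hθ0, ?_, fun v => rfl, fun u l v => ?_,
    fun w k v => ?_⟩
  · have : D vacuum = 0 := vprod_vacuum_nonneg le_rfl _
    simp [parity_vacuum, hθ0, this]
  · rw [vprod_gen, vprod_gen]
    obtain ⟨k, rfl⟩ | ⟨k, rfl⟩ := exists_mode l
    · rw [genMode_neg, hθl]
    · rw [genMode_natCast, hθa]
  · simp only [LinearMap.add_apply, LinearMap.comp_apply]
    rcases cases_gen w with ⟨u, rfl⟩ | ⟨j, o, b, rfl⟩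
    · rw [if_pos ⟨u, rfl⟩, parity_create, map_zsmul, hθl, gdeg_genMap, map_zsmul, hDl, hDl,
        map_zsmul, parity_create, gdeg_genMap, map_zsmul, map_zsmul, hθl, smul_smul, smul_smul,
        sgn_mul_self, map_add]
      module
    · rw [if_neg (hrange _ _ _)]
      cases o <;> cases b <;>
        simp [hDr, hPr, hθr, hPD, parity_parity, sgn] <;> abel

/-- The differential splits as that of `g`, acting through `ι`, plus that of the contractible
factor. -/
theorem differentialElement_stabilization {f : Fin m → MvPolynomial (Fin n) ℂ}
    {g : Fin s → MvPolynomial (Fin r) ℂ}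
    (hf1 : ∀ j, f (E (Sum.inl j)) = MvPolynomial.rename e (g j))
    (hf2 : ∀ k, f (E (Sum.inr k)) = MvPolynomial.X k.1) {ι : Space r s →ₗ[ℂ] Space n m}
    (hι : IsVertexHom ι)
    (hιc : ∀ u k v, ι (create u k v) = create (genMap e (fun j => E (Sum.inl j)) u) k (ι v)) :
    (differentialElement f : Space n m) =
      ι (differentialElement g) + differentialElement (contractibleRelations E) := by
  have hgen : ∀ u, ι (gen u) = gen (genMap e (fun j => E (Sum.inl j)) u) := fun u => by
    rw [gen, hιc, hι.map_vacuum, gen]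
  rw [hι.map_differentialElement (σ := fun i => MvPolynomial.X (e i)) fun i => by
    rw [hgen, ofPoly_X]; rfl, differentialElement_eq, differentialElement_eq, ← E.sum_comp,
    ← E.sum_comp, Fintype.sum_sum_type, Fintype.sum_sum_type]
  simp only [hf1, hf2, contractibleRelations, Equiv.symm_apply_apply, Sum.elim_inl, Sum.elim_inr,
    ofPoly_zero, map_zero, Finset.sum_const_zero, zero_add]
  congr 1
  refine Finset.sum_congr rfl fun j _ => ?_
  have hr : MvPolynomial.rename e = MvPolynomial.aeval fun i : Fin r =>
      (MvPolynomial.X (e i) : MvPolynomial (Fin n) ℂ) :=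
    MvPolynomial.algHom_ext fun i => by simp
  rw [hgen, create_eq_vprod, Nat.cast_zero, neg_zero, zero_sub, hr]
  rfl

open Polynomial in
/-- A closed vector that is killed by a polynomial in the anticommutator with nonzero constant
coefficient is exact. -/
theorem exists_eq_of_aeval_eq_zero {V : Type*} [AddCommGroup V] [Module ℂ V]
    {d h C : Module.End ℂ V} (hC : C = d * h + h * d) (hd : d * d = 0) {q : ℂ[X]}
    (hq : q.coeff 0 ≠ 0) {v : V} (hv : d v = 0) (hqv : aeval C q v = 0) : ∃ w, v = d w := by
  have hcomm : Commute d C := by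
    rw [hC, commute_iff_eq, mul_add, add_mul, ← mul_assoc, hd, mul_assoc h, hd, zero_mul, mul_zero,
      zero_add, add_zero, mul_assoc]
  set p := aeval C q.divX with hp
  have hpd : d * p = p * d := by
    have : ∀ x : ℂ[X], Commute d (aeval C x) := by
      intro x
      induction x using Polynomial.induction_on' with
      | add x y hx hy => rw [map_add]; exact hx.add_right hy
      | monomial k a =>
        rw [aeval_monomial]
        exact (Algebra.commute_algebraMap_right a d).mul_right (hcomm.pow_right k)
    exact this _
  -- Write `q = X · divX q + q₀`. As `d` commutes with `C` and kills `v`, the vector `C (p v)`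
  -- equals `d (h (p v))`, and division by `q₀ ≠ 0` exhibits `v` as exact.
  have h1 : C (p v) + q.coeff 0 • v = 0 := by
    rw [← X_mul_divX_add q, map_add, map_mul, aeval_X, aeval_C] at hqv
    simpa using hqv
  have h2 : d (p v) = 0 := by
    rw [← Module.End.mul_apply, hpd, Module.End.mul_apply, hv, map_zero]
  have h3 : C (p v) = d (h (p v)) := by
    rw [hC, LinearMap.add_apply, Module.End.mul_apply, Module.End.mul_apply, h2, map_zero, add_zero]
  refine ⟨-(q.coeff 0)⁻¹ • h (p v), ?_⟩
  rw [map_smul, ← h3, eq_neg_of_add_eq_zero_left h1, neg_smul, smul_neg, neg_neg, smul_smul,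
    inv_mul_cancel₀ hq, one_smul]

/-- The homotopy of the contractible factor is linear over the smaller vertex algebra, so it has the
same anticommutator with the whole differential. That operator is semisimple with eigenvalue the
number of contractible variables, and only eigenvalue zero survives in cohomology. -/
theorem exists_isChiralRetract_of_stabilization {f : Fin m → MvPolynomial (Fin n) ℂ}
    {g : Fin s → MvPolynomial (Fin r) ℂ} (he : Function.Injective e)
    (hf1 : ∀ j, f (E (Sum.inl j)) = MvPolynomial.rename e (g j))
    (hf2 : ∀ k, f (E (Sum.inr k)) = MvPolynomial.X k.1) :
    ∃ ι π, IsChiralRetract (chiralKoszul g) (chiralKoszul f) ι π ∧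
      (Function.Surjective e → (chiralKoszul g).Isomorphic (chiralKoszul f)) := by
  classical
  have he' : Function.Injective fun j => E (Sum.inl j) := E.injective.comp Sum.inl_injective
  obtain ⟨ι, hι, hιc⟩ := exists_inclusion he he'
  obtain ⟨π, hπ0, hπc, hπz⟩ := exists_projection he he'
  obtain ⟨θ, C, hθ0, hC0, hC, hθ, hCc⟩ := exists_contracting_homotopy E he
  set Γ := genMap e (fun j => E (Sum.inl j)) with hΓ
  have hgen : ∀ u, ι (gen u) = gen (Γ u) := fun u => by rw [gen, hιc, hι.map_vacuum, gen]
  have hQ := differentialElement_stabilization E hf1 hf2 hι hιc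
  have hmem : ∀ u : Gen r s, (gen (Γ u) : Space n m) ∈ degSpace n m (gdeg u) := fun u => by
    rw [← gdeg_genMap (e := e) (e' := fun j => E (Sum.inl j))]
    exact gen_mem _
  have hDι : ∀ a, vprod 0 (differentialElement (contractibleRelations E)) (ι a) = 0 := fun a =>
    linearMap_ext_create (f := (toField (differentialElement (contractibleRelations E))).modes 0 ∘ₗ ι)
      (g := 0) (by
        simp only [LinearMap.comp_apply, toField_modes, hι.map_vacuum]
        exact vprod_vacuum_nonneg le_rfl _) (fun u k v ih => by
        simp only [LinearMap.comp_apply, toField_modes, LinearMap.zero_apply] at ih ⊢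
        rw [hιc, vprod_zero_create (differentialElement_mem _), differential_genMap, ih, map_zero,
          vprod_zero_left, smul_zero, add_zero]) a
  have hιh : IsDGVertexHom (chiralKoszul g) (chiralKoszul f) ι := by
    refine ⟨fun p a ha => hι.map_mem (fun u => by rw [hgen]; exact hmem u) ha, hι.map_vacuum,
      hι.map_vprod, hι.map_translation, ?_⟩
    have hd : ∀ a : Space r s, ι (vprod 0 (differentialElement g) a) =
        vprod 0 (differentialElement f) (ι a) := fun a => by
      rw [hQ, vprod_add_left, hDι, add_zero, hι.map_vprod]
    exact hd
  have hπa : ∀ u k v, π (annihilate (Γ u) k v) = annihilate u k (π v) := by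
    intro u k v
    have := map_annihilate (θ := π) hπ0 (u := Γ u) (u' := u) (χ := 1) (gdeg_genMap u).symm
      (fun w => by
        by_cases hw : w ∈ Set.range Γ
        · obtain ⟨w, rfl⟩ := hw
          exact Or.inr ⟨w, 1, (gdeg_genMap w).symm, fun k v => by rw [hπc, one_smul], by
            rw [pair_genMap he he']; ring⟩
        · exact Or.inl ⟨hπz w hw, pair_genMap_eq_zero hw u⟩) k v
    rwa [one_smul] at this
  have hπι : ∀ a, π (ι a) = a := fun a => linearMap_ext_create (f := π ∘ₗ ι) (g := LinearMap.id)
    (by simp [hι.map_vacuum, hπ0]) (fun u k v ih => by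
      simp only [LinearMap.comp_apply, hιc, hπc] at ih ⊢
      rw [ih]; rfl) a
  have hπp : ∀ l a v, π (vprod l (ι a) v) = vprod l a (π v) := fun l a v =>
    map_vprod_of_gen (α := ι) (β := LinearMap.id) (θ := π) hmem gen_mem hι.map_vacuum rfl
      (fun u k v => by rw [hιc, create_eq_vprod]) (fun u k v => create_eq_vprod u k v)
      (fun u l v => by
        rw [vprod_gen, vprod_gen]
        obtain ⟨k, rfl⟩ | ⟨k, rfl⟩ := exists_mode l
        · rw [genMode_neg, genMode_neg, hπc]
        · rw [genMode_natCast, genMode_natCast, hπa]) l a v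
  have hθι : ∀ l a v, θ (vprod l (ι a) v) = vprod l (ι a) (θ v) := fun l a v =>
    map_vprod_of_gen (α := ι) (β := ι) (θ := θ) hmem hmem hι.map_vacuum hι.map_vacuum
      (fun u k v => by rw [hιc, create_eq_vprod]) (fun u k v => by rw [hιc, create_eq_vprod])
      hθ l a v
  have hcases : ∀ w : Gen n m, w ∈ Set.range Γ ∨ (w ∉ Set.range Γ ∧
      ∃ (c : ℂ) (w' : Gen n m), w' ∉ Set.range Γ ∧
        vprod 0 (differentialElement (contractibleRelations E)) (gen w) = c • gen w') := by
    intro w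
    obtain ⟨u | ⟨k, o, b⟩, rfl⟩ := (splitGen_bijective E he).surjective w
    · exact Or.inl ⟨u, rfl⟩
    · have hz : ∀ o, contractibleGen E k o b ∉ Set.range Γ := fun o ⟨u, hu⟩ => by
        have := (splitGen_bijective E he).injective (show splitGen E (Sum.inl u) =
          splitGen E (Sum.inr (k, o, b)) from hu)
        cases this
      exact Or.inr ⟨hz o, _, _, hz _, differential_contractibleGen E k o b⟩
  have hπD : ∀ v, π (vprod 0 (differentialElement (contractibleRelations E)) v) = 0 := fun v =>
    linearMap_ext_create (f := π ∘ₗ (toField (differentialElement (contractibleRelations E))).modes 0)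
      (g := 0) (by
        simp only [LinearMap.comp_apply, toField_modes, LinearMap.zero_apply]
        rw [vprod_vacuum_nonneg le_rfl, map_zero]) (fun w k v ih => by
        simp only [LinearMap.comp_apply, toField_modes, LinearMap.zero_apply] at ih ⊢
        rw [vprod_zero_create (differentialElement_mem _), map_add, map_zsmul]
        rcases hcases w with ⟨u, rfl⟩ | ⟨hw, c, w', hw', h⟩
        · rw [differential_genMap, vprod_zero_left, map_zero, hπc, ih, map_zero, smul_zero, add_zero]
        · rw [h, vprod_smul_left, map_smul, ← create_eq_vprod, hπz w' hw', hπz w hw, smul_zero,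
            smul_zero, add_zero]) v
  have hd : ∀ v, vprod 0 (differentialElement f) v = vprod 0 (ι (differentialElement g)) v +
      vprod 0 (differentialElement (contractibleRelations E)) v := fun v => by
    rw [hQ, vprod_add_left]
  -- The part of the differential coming from `g` drops out: `θ` commutes with the modes of `ι Q`,
  -- whereas parity anticommutes with this odd zero mode.
  have hanti : ∀ v, C v = vprod 0 (differentialElement f) (θ (parity v)) +
      θ (parity (vprod 0 (differentialElement f) v)) := by
    intro v
    have h1 : parity (vprod 0 (ι (differentialElement g)) v) =
        -vprod 0 (ι (differentialElement g)) (parity v) := by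
      have h2 : ι (differentialElement g) =
          differentialElement f - differentialElement (contractibleRelations E) := by
        rw [hQ, add_sub_cancel_right]
      rw [h2, sub_eq_add_neg, vprod_add_left, vprod_add_left, vprod_neg_left, vprod_neg_left, map_add,
        map_neg, parity_differential, parity_differential]
      abel
    rw [hC, hd, hd, map_add, map_add, h1, map_neg, hθι]
    abel
  -- The eigenvalue `c` counts the contractible variables in the monomial. For `c = 0` the monomial
  -- lies in the image of `ι`, and otherwise `π` kills it.
  have hmono : ∀ L : List (Gen n m × ℕ), ∃ c : ℕ, C (listMono L) = (c : ℂ) • listMono L ∧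
      (c = 0 → ι (π (listMono L)) = listMono L) ∧ (c ≠ 0 → π (listMono L) = 0) := by
    intro L
    induction L with
    | nil => exact ⟨0, by simp [listMono, hC0], by simp [listMono, hπ0, hι.map_vacuum], by simp⟩
    | cons w L ih =>
      obtain ⟨c, h1, h2, h3⟩ := ih
      have e : listMono (w :: L) = create w.1 w.2 (listMono L) := rfl
      by_cases hw : w.1 ∈ Set.range Γ
      · refine ⟨c, ?_, ?_, ?_⟩
        · rw [e, hCc, if_pos hw, h1, map_smul, add_zero]
        · obtain ⟨u, hu⟩ := hw
          intro hc
          rw [e, ← hu, hπc, hιc, h2 hc]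
        · obtain ⟨u, hu⟩ := hw
          intro hc
          rw [e, ← hu, hπc, h3 hc, map_zero]
      · refine ⟨c + 1, ?_, by simp, fun _ => hπz _ hw _ _⟩
        rw [e, hCc, if_neg hw, h1, map_smul]
        push_cast
        module
  -- On a monomial the factor `X - c` with `c ≠ 0`, or `1`, suffices. A product serves for sums, and
  -- its constant coefficient stays nonzero.
  have hpoly : ∀ v, ∃ q : Polynomial ℂ, q.coeff 0 ≠ 0 ∧
      Polynomial.aeval (C : Module.End ℂ (Space n m)) q (v - ι (π v)) = 0 := by
    intro v
    induction v using Finsupp.induction_linear with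
    | zero => exact ⟨1, by simp, by simp⟩
    | add v w hv hw =>
      obtain ⟨q, hq, hqv⟩ := hv
      obtain ⟨q', hq', hqw⟩ := hw
      refine ⟨q * q', by simp [Polynomial.mul_coeff_zero, hq, hq'], ?_⟩
      rw [map_add, map_add, add_sub_add_comm, map_add]
      nth_rewrite 1 [mul_comm q q']
      rw [map_mul, map_mul, Module.End.mul_apply, Module.End.mul_apply, hqv, hqw, map_zero, map_zero,
        add_zero]
    | single p a =>
      obtain ⟨c, h1, h2, h3⟩ := hmono (factors p)
      have hp : Finsupp.single p a = a • listMono (factors p) := by rw [listMono_factors]; simp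
      rw [hp]
      by_cases hc : c = 0
      · refine ⟨1, by simp, ?_⟩
        rw [map_smul, map_smul, h2 hc, sub_self, map_zero]
      · refine ⟨Polynomial.X - Polynomial.C (c : ℂ), by simpa using hc, ?_⟩
        rw [map_smul, h3 hc, smul_zero, map_zero, sub_zero, map_smul, map_sub, Polynomial.aeval_X,
          Polynomial.aeval_C, LinearMap.sub_apply, h1, Module.algebraMap_end_apply, sub_self, smul_zero]
  have hπs : ∀ v, π (degScale 2 v) = degScale 2 (π v) := fun v =>
    linearMap_ext_create (f := π ∘ₗ degScale 2) (g := degScale 2 ∘ₗ π) (by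
      have h1 := mem_degSpace_iff.mp (vacuum_mem (n := n) (m := m))
      have h2 := mem_degSpace_iff.mp (vacuum_mem (n := r) (m := s))
      simp only [LinearMap.comp_apply, hπ0, h1, h2, map_smul]) (fun w k v ih => by
      simp only [LinearMap.comp_apply] at ih ⊢
      have hsc : ∀ {n m : ℕ} (u : Gen n m) k v, degScale 2 (create u k v) =
          (2 : ℂ) ^ gdeg u • create u k (degScale 2 v) := fun u k v => by
        have := scales_genField (c := 2) (by norm_num) u (-k - 1) v
        simpa only [genField, genMode_neg] using this
      rw [hsc, map_smul]
      by_cases hw : w ∈ Set.range Γ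
      · obtain ⟨u, rfl⟩ := hw
        rw [hπc, hπc, ih, hsc, gdeg_genMap]
      · rw [hπz w hw, hπz w hw, smul_zero, map_zero]) v
  have hπdeg : ∀ p, ∀ v ∈ degSpace n m p, π v ∈ degSpace r s p := fun p v hv => by
    rw [mem_degSpace_iff, ← hπs, mem_degSpace_iff.mp hv, map_smul]
  have hπd : ∀ v, π (vprod 0 (differentialElement f) v) =
      vprod 0 (differentialElement g) (π v) := fun v => by
    rw [hd, map_add, hπD, hπp, add_zero]
  have hπT : ∀ v, π (translation v) = translation (π v) := fun v =>
    linearMap_ext_create (f := π ∘ₗ translation) (g := translation ∘ₗ π) (by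
      simp [translation_vacuum, hπ0]) (fun w k v ih => by
      simp only [LinearMap.comp_apply] at ih ⊢
      rw [translation_create, map_add, map_smul]
      by_cases hw : w ∈ Set.range Γ
      · obtain ⟨u, rfl⟩ := hw
        rw [hπc, hπc, hπc, ih, translation_create]
      · rw [hπz w hw, hπz w hw, hπz w hw, smul_zero, map_zero, add_zero]) v
  have hacyclic : ∀ v : Space n m, vprod 0 (differentialElement f) v = 0 → π v = 0 →
      ∃ w : Space n m, v = vprod 0 (differentialElement f) w := by
    intro v hv hπv
    obtain ⟨q, hq, hqv⟩ := hpoly v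
    rw [hπv, map_zero, sub_zero] at hqv
    refine exists_eq_of_aeval_eq_zero (V := Space n m)
      (d := (toField (differentialElement f)).modes 0) (h := θ ∘ₗ parity) ?_ ?_ hq hv hqv
    · exact LinearMap.ext fun v => hanti v
    · exact LinearMap.ext fun v => differential_differential f v
  refine ⟨ι, π, IsChiralRetract.of_acyclic (isDGVertexAlgebra g) (isDGVertexAlgebra f) hιh
    hπdeg hπd hπT hπp hπι hacyclic, fun hsurj => ?_⟩
  · have hΓs : ∀ w, w ∈ Set.range Γ := by
      intro w
      obtain ⟨u | ⟨k, o, b⟩, rfl⟩ := (splitGen_bijective E he).surjective w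
      · exact ⟨u, rfl⟩
      · exact absurd (hsurj k.1) k.2
    have hιπ : ∀ v, ι (π v) = v := fun v => linearMap_ext_create (f := ι ∘ₗ π) (g := LinearMap.id)
      (by simp [hι.map_vacuum, hπ0]) (fun w k v ih => by
        obtain ⟨u, rfl⟩ := hΓs w
        simp only [LinearMap.comp_apply, hιc, hπc] at ih ⊢
        rw [ih]; rfl) v
    exact ⟨LinearEquiv.ofLinearMap (M := Space r s) (M₂ := Space n m) ι π (LinearMap.ext hιπ)
      (LinearMap.ext hπι), hιh⟩

end Stabilization

end Chiral

/-! ## Koszul complexes -/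

namespace Koszul

variable {R S : Type*} [CommRing R] [CommRing S] {m m' : ℕ}

theorem differential_algebraMap (f : Fin m → R) (r : R) :
    koszulDifferential f (algebraMap R (ExteriorAlgebra R (Fin m → R)) r) = 0 :=
  CliffordAlgebra.contractLeft_algebraMap _ _ r

theorem differential_ι_mul (f : Fin m → R) (v : Fin m → R) (x : ExteriorAlgebra R (Fin m → R)) :
    koszulDifferential f (ExteriorAlgebra.ι R v * x) =
      (∑ i, v i * f i) • x - ExteriorAlgebra.ι R v * koszulDifferential f x := by
  have := CliffordAlgebra.contractLeft_ι_mul (Q := (0 : QuadraticForm R (Fin m → R)))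
    (d := Fintype.linearCombination R f) v x
  rw [Fintype.linearCombination_apply] at this
  exact this

theorem differential_ι (f : Fin m → R) (v : Fin m → R) :
    koszulDifferential f (ExteriorAlgebra.ι R v) = algebraMap R _ (∑ i, v i * f i) := by
  have := differential_ι_mul f v 1
  rwa [mul_one, ← map_one (algebraMap R _), differential_algebraMap, mul_zero, sub_zero, map_one,
    Algebra.smul_def, mul_one] at this

theorem exterior_induction {P : ExteriorAlgebra R (Fin m → R) → Prop}
    (algebraMap : ∀ r : R, P (algebraMap R _ r)) (add : ∀ x y, P x → P y → P (x + y))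
    (ι_mul : ∀ x v, P x → P (ExteriorAlgebra.ι R v * x)) (x) : P x :=
  CliffordAlgebra.left_induction _ algebraMap add ι_mul x

theorem algebraMapInv_ι (v : Fin m → R) :
    ExteriorAlgebra.algebraMapInv (ExteriorAlgebra.ι R v) = 0 := by
  rw [ExteriorAlgebra.algebraMapInv, ExteriorAlgebra.lift_ι_apply, LinearMap.zero_apply]

theorem algebraMapInv_algebraMap (r : R) : ExteriorAlgebra.algebraMapInv
    (algebraMap R (ExteriorAlgebra R (Fin m → R)) r) = r :=
  ExteriorAlgebra.algebraMap_leftInverse _ r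

/-- Boundaries are combinations of the `fᵢ`. -/
theorem differential_mem (f : Fin m → R) (x : ExteriorAlgebra R (Fin m → R)) :
    koszulDifferential f x ∈ Ideal.span (Set.range f) •
      (⊤ : Submodule R (ExteriorAlgebra R (Fin m → R))) := by
  induction x using exterior_induction with
  | algebraMap r => rw [differential_algebraMap]; exact zero_mem _
  | add x y hx hy => rw [map_add]; exact add_mem hx hy
  | ι_mul x v hx =>
    rw [differential_ι_mul]
    refine sub_mem (Submodule.smul_mem_smul (sum_mem fun i _ => Ideal.mul_mem_left _ _
      (Ideal.subset_span ⟨i, rfl⟩)) Submodule.mem_top) ?_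
    have h := Submodule.mem_map_of_mem (f := LinearMap.mulLeft R (ExteriorAlgebra.ι R v)) hx
    rw [Submodule.map_smul''] at h
    exact Submodule.smul_mono le_rfl le_top h

/-- A homomorphism of Koszul algebras over a ring homomorphism. -/
theorem exists_map (σ : R →+* S) (f : Fin m → R) (g : Fin m' → S) (θ : Fin m → Fin m' → S)
    (h : ∀ i, σ (f i) = ∑ j, θ i j * g j) :
    ∃ Φ : ExteriorAlgebra R (Fin m → R) →+* ExteriorAlgebra S (Fin m' → S),
      (∀ r, Φ (algebraMap R _ r) = algebraMap S _ (σ r)) ∧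
      (∀ v, Φ (ExteriorAlgebra.ι R v) = ExteriorAlgebra.ι S fun j => ∑ i, σ (v i) * θ i j) ∧
      (∀ x, Φ (koszulDifferential f x) = koszulDifferential g (Φ x)) ∧
      ∀ x, ExteriorAlgebra.algebraMapInv (Φ x) = σ (ExteriorAlgebra.algebraMapInv x) := by
  -- The target becomes an `R`-algebra through `σ`, so that the universal property of the exterior
  -- algebra over `R` applies.
  let _ : Algebra R (ExteriorAlgebra S (Fin m' → S)) :=
    ((algebraMap S (ExteriorAlgebra S (Fin m' → S))).comp σ).toAlgebra' fun c x =>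
      Algebra.commutes (σ c) x
  have hsmul : ∀ (r : R) (x : ExteriorAlgebra S (Fin m' → S)), r • x = σ r • x := fun r x =>
    (Algebra.smul_def (σ r) x).symm
  let φ : (Fin m → R) →ₗ[R] ExteriorAlgebra S (Fin m' → S) :=
    { toFun := fun v => ExteriorAlgebra.ι S fun j => ∑ i, σ (v i) * θ i j
      map_add' := fun v w => by
        rw [← map_add]
        congr 1
        funext j
        simp only [Pi.add_apply, map_add, add_mul, Finset.sum_add_distrib]
      map_smul' := fun r v => by
        rw [hsmul, ← map_smul]
        congr 1
        funext j
        simp only [Pi.smul_apply, smul_eq_mul, map_mul, Finset.mul_sum, mul_assoc, RingHom.id_apply] }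
  let Φ := ExteriorAlgebra.lift R ⟨φ, fun v => ExteriorAlgebra.ι_sq_zero _⟩
  have h1 : ∀ r, Φ (algebraMap R _ r) = algebraMap S _ (σ r) := fun r => Φ.commutes r
  have h2 : ∀ v, Φ (ExteriorAlgebra.ι R v) = ExteriorAlgebra.ι S fun j => ∑ i, σ (v i) * θ i j :=
    fun v => ExteriorAlgebra.lift_ι_apply _ _ _ v
  refine ⟨Φ.toRingHom, h1, h2, fun x => ?_, fun x => ?_⟩
  · change Φ (koszulDifferential f x) = koszulDifferential g (Φ x)
    induction x using exterior_induction with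
    | algebraMap r => rw [differential_algebraMap, h1, differential_algebraMap, map_zero]
    | add x y hx hy => rw [map_add, map_add, map_add, map_add, hx, hy]
    | ι_mul x v hx =>
      rw [differential_ι_mul, map_sub, map_mul, map_mul, hx, h2, differential_ι_mul, map_smul, hsmul]
      congr 2
      rw [map_sum]
      simp only [map_mul, h, Finset.mul_sum, Finset.sum_mul]
      rw [Finset.sum_comm]
      exact Finset.sum_congr rfl fun _ _ => Finset.sum_congr rfl fun _ _ => by ring
  · change ExteriorAlgebra.algebraMapInv (Φ x) = _
    induction x using exterior_induction with
    | algebraMap r => rw [h1, algebraMapInv_algebraMap, algebraMapInv_algebraMap]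
    | add x y hx hy => rw [map_add, map_add, map_add, map_add, hx, hy]
    | ι_mul x v hx =>
      rw [map_mul, h2, map_mul, map_mul, algebraMapInv_ι, algebraMapInv_ι, zero_mul, zero_mul, map_zero]

end Koszul

namespace KoszulPresentation

open MvPolynomial

variable {A : Type*} [CommRing A] [Algebra ℂ A] {𝒜 : ℕ → Submodule ℂ A} {K L : KoszulPresentation 𝒜}

theorem augmentation_apply (z) : K.augmentation z = K.aug (ExteriorAlgebra.algebraMapInv z) := rfl

theorem IsResolution.aug_surjective (h : K.IsResolution) : Function.Surjective K.aug := by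
  intro a
  obtain ⟨z, -, hz⟩ := h.surjective a
  exact ⟨_, hz⟩

/-- Exactness in degree zero: a polynomial in the kernel is a boundary, and the scalar part of a
boundary lies in the ideal of the `fᵢ`. -/
theorem IsResolution.ker_aug (h : K.IsResolution) : RingHom.ker K.aug = Ideal.span (Set.range K.f) := by
  refine le_antisymm (fun p hp => ?_) ?_
  · obtain ⟨w, hw⟩ := h.injective (algebraMap _ _ p) (Koszul.differential_algebraMap _ _) (by
      rw [augmentation_apply, Koszul.algebraMapInv_algebraMap]; exact hp)
    have h1 := Submodule.mem_map_of_mem (f := (ExteriorAlgebra.algebraMapInv : ExteriorAlgebra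
      (MvPolynomial (Fin K.n) ℂ) (Fin K.m → MvPolynomial (Fin K.n) ℂ) →ₐ[_] _).toLinearMap)
      (Koszul.differential_mem K.f w)
    rw [Submodule.map_smul'', ← hw, AlgHom.toLinearMap_apply, Koszul.algebraMapInv_algebraMap] at h1
    have h2 := Submodule.smul_mono (le_refl (Ideal.span (Set.range K.f))) le_top h1
    rwa [smul_eq_mul, Ideal.mul_top] at h2
  · rw [Ideal.span_le]
    rintro _ ⟨i, rfl⟩
    have := h.comm (ExteriorAlgebra.ι _ (Pi.single i 1))
    rw [Koszul.differential_ι, augmentation_apply, Koszul.algebraMapInv_algebraMap] at this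
    simpa [Pi.single_apply] using this

/-- The coefficients of a relation between the `fᵢ` are combinations of the `fᵢ`. -/
theorem IsResolution.mem_of_relation (h : K.IsResolution)
    {a : Fin K.m → MvPolynomial (Fin K.n) ℂ} (ha : ∑ i, a i * K.f i = 0) (i : Fin K.m) :
    a i ∈ RingHom.ker K.aug := by
  -- The relation says that `∑ aᵢ ξᵢ` is a cycle. The augmentation kills it, so it is a boundary,
  -- and coefficients of boundaries lie in the ideal of the `fᵢ`.
  obtain ⟨w, hw⟩ := h.injective (ExteriorAlgebra.ι _ a) (by
    rw [Koszul.differential_ι, ha, map_zero]) (by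
    rw [augmentation_apply, Koszul.algebraMapInv_ι, map_zero])
  have h1 := Submodule.mem_map_of_mem (f := LinearMap.proj i ∘ₗ ExteriorAlgebra.ιInv)
    (Koszul.differential_mem K.f w)
  rw [Submodule.map_smul'', ← hw, LinearMap.comp_apply, ExteriorAlgebra.ι_leftInverse,
    LinearMap.proj_apply] at h1
  have h2 := Submodule.smul_mono (le_refl (Ideal.span (Set.range K.f))) le_top h1
  rwa [smul_eq_mul, Ideal.mul_top, ← h.ker_aug] at h2

/-- A retract of a Koszul resolution is a Koszul resolution. -/
theorem IsResolution.of_retract (h : K.IsResolution)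
    (σ : MvPolynomial (Fin L.n) ℂ →ₐ[ℂ] MvPolynomial (Fin K.n) ℂ)
    (τ : MvPolynomial (Fin K.n) ℂ →ₐ[ℂ] MvPolynomial (Fin L.n) ℂ)
    (hτσ : ∀ i, τ (σ (X i)) = X i)
    (θ : Fin L.m → Fin K.m → MvPolynomial (Fin K.n) ℂ)
    (θ' : Fin K.m → Fin L.m → MvPolynomial (Fin L.n) ℂ)
    (hθ : ∀ j, σ (L.f j) = ∑ i, θ j i * K.f i) (hθ' : ∀ i, τ (K.f i) = ∑ j, θ' i j * L.f j)
    (hid : ∀ j k, ∑ i, τ (θ j i) * θ' i k = if j = k then 1 else 0)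
    (hσ : ∀ i, K.aug (σ (X i)) = L.aug (X i)) (hτ : ∀ i, L.aug (τ (X i)) = K.aug (X i)) :
    L.IsResolution := by
  obtain ⟨Φ, hΦ, hΦι, hΦd, hΦa⟩ := Koszul.exists_map σ.toRingHom L.f K.f θ hθ
  obtain ⟨Ψ, hΨ, hΨι, hΨd, -⟩ := Koszul.exists_map τ.toRingHom K.f L.f θ' hθ'
  have h1 : ∀ p, K.aug (σ p) = L.aug p := fun p =>
    congrFun (congrArg DFunLike.coe (algHom_ext (f := K.aug.comp σ) (g := L.aug) hσ)) p
  have h2 : ∀ p, L.aug (τ p) = K.aug p := fun p =>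
    congrFun (congrArg DFunLike.coe (algHom_ext (f := L.aug.comp τ) (g := K.aug) hτ)) p
  have h3 : ∀ p, τ (σ p) = p := fun p =>
    congrFun (congrArg DFunLike.coe (algHom_ext (f := τ.comp σ) (g := AlgHom.id ℂ _) hτσ)) p
  have h4 : ∀ z, L.augmentation z = K.augmentation (Φ z) := fun z => by
    rw [augmentation_apply, augmentation_apply, hΦa]
    exact (h1 _).symm
  have h5 : ∀ z, Ψ (Φ z) = z := by
    intro z
    induction z using Koszul.exterior_induction with
    | algebraMap r =>
      rw [hΦ, hΨ]
      exact congrArg _ (h3 r)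
    | add x y hx hy => rw [map_add, map_add, hx, hy]
    | ι_mul x v hx =>
      rw [map_mul, map_mul, hx, hΦι, hΨι]
      congr 2
      funext k
      change ∑ i, τ (∑ j, σ (v j) * θ j i) * θ' i k = v k
      simp only [map_sum, map_mul, h3, Finset.sum_mul]
      rw [Finset.sum_comm]
      simp only [mul_assoc, ← Finset.mul_sum, hid]
      simp
  refine ⟨fun z => ?_, fun a => ?_, fun z hz hz' => ?_⟩
  · rw [h4, hΦd, h.comm]
  · obtain ⟨p, rfl⟩ := h.aug_surjective a
    refine ⟨algebraMap _ _ (τ p), Koszul.differential_algebraMap _ _, ?_⟩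
    rw [augmentation_apply, Koszul.algebraMapInv_algebraMap, h2]
  -- A cycle is transported to the large complex, bounded there, and the bounding element is brought
  -- back by the left inverse `Ψ`.
  · obtain ⟨w, hw⟩ := h.injective (Φ z) (by rw [← hΦd, hz, map_zero]) (by rw [← h4, hz'])
    exact ⟨Ψ w, by rw [← hΨd, ← hw, h5]⟩

end KoszulPresentation

/-! ## Minimal generating sets in graded algebras -/

namespace GradedGenerators

open DirectSum

variable {R : Type*} [CommRing R] [Algebra ℂ R] (𝒢 : ℕ → Submodule ℂ R) [GradedAlgebra 𝒢]

theorem mem_irrelevant_iff (a : R) :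
    a ∈ (HomogeneousIdeal.irrelevant 𝒢).toIdeal ↔ (decompose 𝒢 a 0 : R) = 0 := Iff.rfl

variable {𝒢}

/-- In degree `d` a product from `R_> I` involves only components of degree less than `d` of the
factor from `I`. This drives the induction in Nakayama's lemma. -/
theorem decompose_mul_mem {I N : Ideal R} {d : ℕ}
    (h : ∀ i < d, ∀ y ∈ I, (decompose 𝒢 y i : R) ∈ N) {x : R}
    (hx : x ∈ (HomogeneousIdeal.irrelevant 𝒢).toIdeal * I) : (decompose 𝒢 x d : R) ∈ N := by
  induction hx using Submodule.mul_induction_on' with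
  | mem_mul_mem u hu v hv =>
    rw [decompose_mul, coe_mul_apply_eq_sum_antidiagonal]
    refine sum_mem fun ij hij => ?_
    rw [Finset.HasAntidiagonal.mem_antidiagonal] at hij
    by_cases h0 : ij.1 = 0
    · rw [h0, (mem_irrelevant_iff 𝒢 u).mp hu, zero_mul]
      exact zero_mem _
    · exact N.mul_mem_left _ (h _ (by omega) v hv)
  | add x _ y _ hx hy =>
    rw [decompose_add, DirectSum.add_apply, Submodule.coe_add]
    exact add_mem hx hy

/-- The graded Nakayama lemma. -/
theorem le_of_le_sup {I N : Ideal R} (hN : N.IsHomogeneous 𝒢)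
    (h : I ≤ N ⊔ (HomogeneousIdeal.irrelevant 𝒢).toIdeal * I) : I ≤ N := by
  have key : ∀ d : ℕ, ∀ y ∈ I, (decompose 𝒢 y d : R) ∈ N := by
    intro d
    induction d using Nat.strong_induction_on with
    | _ d ih =>
      intro y hy
      obtain ⟨b, hb, x, hx, rfl⟩ := Submodule.mem_sup.mp (h hy)
      rw [decompose_add, DirectSum.add_apply, Submodule.coe_add]
      exact add_mem (hN.mem_iff.mp hb d) (decompose_mul_mem ih hx)
  exact fun y hy => hN.mem_iff.mpr fun d => key d y hy

theorem _root_.IsMinimalGeneratingSet.span_eq {I : Ideal R} {κ : Type*} {e : κ → R}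
    (h : IsMinimalGeneratingSet 𝒢 I e) : Ideal.span (Set.range e) = I := by
  refine le_antisymm (Ideal.span_le.mpr ?_) (le_of_le_sup (𝒢 := 𝒢) ?_ fun a ha => ?_)
  · rintro _ ⟨i, rfl⟩
    exact h.mem i
  · refine Ideal.homogeneous_span 𝒢 _ ?_
    rintro _ ⟨i, rfl⟩
    exact h.homogeneous i
  · obtain ⟨b, hb, hab⟩ := h.spans a ha
    rw [← add_sub_cancel b a]
    refine Submodule.add_mem_sup ?_ hab
    exact Submodule.span_le_restrictScalars ℂ R _ hb

/-- Modulo `R_> I` only the degree zero parts of the coefficients act, so the relation becomes a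
linear relation between basis vectors. -/
theorem _root_.IsMinimalGeneratingSet.eq_zero_of_relation {I : Ideal R} {κ : Type*} [Fintype κ]
    {e : κ → R} (h : IsMinimalGeneratingSet 𝒢 I e) {a : κ → R} {c : κ → ℂ}
    (hc : ∀ i, a i - algebraMap ℂ R (c i) ∈ (HomogeneousIdeal.irrelevant 𝒢).toIdeal)
    (ha : ∑ i, a i * e i ∈ (HomogeneousIdeal.irrelevant 𝒢).toIdeal * I) (i : κ) : c i = 0 := by
  refine Fintype.linearIndependent_iff.mp h.linearIndependent c ?_ i
  have h1 : ∑ i, c i • e i ∈ (HomogeneousIdeal.irrelevant 𝒢).toIdeal * I := by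
    have h2 : ∑ i, c i • e i = ∑ i, a i * e i - ∑ i, (a i - algebraMap ℂ R (c i)) * e i := by
      rw [← Finset.sum_sub_distrib]
      refine Finset.sum_congr rfl fun i _ => ?_
      rw [Algebra.smul_def]
      ring
    rw [h2]
    exact sub_mem ha (sum_mem fun i _ => Submodule.mul_mem_mul (hc i) (h.mem i))
  rw [← Ideal.Quotient.eq_zero_iff_mem, map_sum] at h1
  rw [← h1]
  exact Finset.sum_congr rfl fun i _ => rfl

/-- A subalgebra that contains homogeneous generators of the irrelevant ideal is everything. -/
theorem subalgebra_eq_top (h0 : 𝒢 0 = Submodule.span ℂ {1}) {κ : Type*} [Fintype κ] {y : κ → R}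
    {wt : κ → ℕ} (hwt : ∀ i, 0 < wt i) (hy : ∀ i, y i ∈ 𝒢 (wt i))
    (hspan : (HomogeneousIdeal.irrelevant 𝒢).toIdeal ≤ Ideal.span (Set.range y))
    {S : Subalgebra ℂ R} (hS : ∀ i, y i ∈ S) : S = ⊤ := by
  have key : ∀ d : ℕ, ∀ a ∈ 𝒢 d, a ∈ S := by
    intro d
    induction d using Nat.strong_induction_on with
    | _ d ih =>
      intro a ha
      rcases Nat.eq_zero_or_pos d with rfl | hd
      · rw [h0] at ha
        obtain ⟨c, rfl⟩ := Submodule.mem_span_singleton.mp ha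
        exact S.smul_mem S.one_mem c
      · obtain ⟨b, hb⟩ := Ideal.mem_span_range_iff_exists_fun.mp (hspan (HomogeneousIdeal.mem_irrelevant_of_mem 𝒢 hd ha))
        have h1 : a = ∑ i, (decompose 𝒢 (b i * y i) d : R) := by
          rw [← decompose_of_mem_same 𝒢 ha, ← hb, decompose_sum, DFinsupp.finsetSum_apply,
            AddSubmonoidClass.coe_finsetSum]
        rw [h1]
        refine sum_mem fun i _ => ?_
        -- In degree `d` the coefficient of `y i` has degree `d - wt i < d`, so the inductive
        -- hypothesis applies to it.
        rw [coe_decompose_mul_of_right_mem 𝒢 d (hy i)]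
        split_ifs
        · exact S.mul_mem (ih _ (by have := hwt i; omega) _ (SetLike.coe_mem _)) (hS i)
        · exact S.zero_mem
  classical
  rw [eq_top_iff]
  intro a _
  rw [← sum_support_decompose 𝒢 a]
  exact sum_mem fun d _ => key d _ (SetLike.coe_mem _)

/-- A finite homogeneous generating set contains a minimal one. -/
theorem exists_comp_isMinimalGeneratingSet {I : Ideal R} {τ : Type*} [Finite τ] {v : τ → R}
    (hmem : ∀ t, v t ∈ I) (hhom : ∀ t, SetLike.IsHomogeneousElem 𝒢 (v t))
    (hspan : ∀ x ∈ I, ∃ b ∈ Submodule.span ℂ (Set.range v),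
      x - b ∈ (HomogeneousIdeal.irrelevant 𝒢).toIdeal * I) :
    ∃ (s : ℕ) (a : Fin s → τ), IsMinimalGeneratingSet 𝒢 I fun i => v (a i) := by
  let q := (Ideal.Quotient.mkₐ ℂ ((HomogeneousIdeal.irrelevant 𝒢).toIdeal * I)).toLinearMap
  -- A subfamily whose classes are linearly independent with the same span as all the classes is a
  -- minimal generating set.
  obtain ⟨κ, a, ha, hκ, hli⟩ := exists_linearIndependent' ℂ fun t => q (v t)
  have : Finite κ := Finite.of_injective a ha
  obtain ⟨s, ⟨E⟩⟩ := Finite.exists_equiv_fin κ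
  refine ⟨s, fun i => a (E.symm i), fun i => hmem _, fun i => hhom _,
    hli.comp _ E.symm.injective, fun x hx => ?_⟩
  obtain ⟨b, hb, hxb⟩ := hspan x hx
  have h1 : q x ∈ Submodule.span ℂ (Set.range fun t => q (v t)) := by
    have h2 := Submodule.mem_map_of_mem (f := q) hb
    rw [Submodule.map_span, ← Set.range_comp] at h2
    have h3 : q x = q b := (Ideal.Quotient.mk_eq_mk_iff_sub_mem _ _).mpr hxb
    rw [h3]
    exact h2
  have h2 : Submodule.span ℂ (Set.range ((fun t => q (v t)) ∘ a)) =
      Submodule.map q (Submodule.span ℂ (Set.range fun i => v (a (E.symm i)))) := by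
    rw [Submodule.map_span, ← Set.range_comp, ← E.symm.surjective.range_comp]
    rfl
  rw [← hκ, h2] at h1
  obtain ⟨b, hb, hbx⟩ := h1
  exact ⟨b, hb, (Ideal.Quotient.mk_eq_mk_iff_sub_mem _ _).mp hbx.symm⟩

/-- A finitely generated homogeneous ideal has a minimal generating set. -/
theorem exists_isMinimalGeneratingSet [IsNoetherianRing R] (h0 : 𝒢 0 = Submodule.span ℂ {1})
    {I : Ideal R} (hI : I.IsHomogeneous 𝒢) :
    ∃ (s : ℕ) (e : Fin s → R), IsMinimalGeneratingSet 𝒢 I e := by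
  obtain ⟨S, hS⟩ := (Ideal.IsHomogeneous.iff_exists 𝒢 I).mp hI
  obtain ⟨T, hTS, hT⟩ := (Submodule.fg_span_iff_fg_span_finset_subset _).mp
    (IsNoetherian.noetherian (Submodule.span R
      ((fun x : SetLike.homogeneousSubmonoid 𝒢 => (x : R)) '' S)))
  have hIT : I = Ideal.span (T : Set R) := hS.trans hT
  obtain ⟨s, a, ha⟩ := exists_comp_isMinimalGeneratingSet (𝒢 := 𝒢) (I := I)
    (v := fun t : T => (t : R)) (fun t => hIT ▸ Ideal.subset_span t.2) (fun t => by
      obtain ⟨y, -, hy⟩ := hTS t.2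
      rw [← hy]
      exact y.2) (fun x hx => by
      have hx' := hx
      rw [hIT, ← Subtype.range_coe (s := (T : Set R))] at hx'
      obtain ⟨b, hb⟩ :=
        (Ideal.mem_span_range_iff_exists_fun (α := T) (v := fun t => (t : R))).mp hx'
      -- Modulo `R_> I` each coefficient may be replaced by its component of degree zero, which is a
      -- complex number.
      refine ⟨∑ t, (decompose 𝒢 (b t) 0 : R) * t, sum_mem fun t _ => ?_, ?_⟩
      · have h2 : (decompose 𝒢 (b t) 0 : R) ∈ Submodule.span ℂ {(1 : R)} :=
          h0 ▸ SetLike.coe_mem _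
        obtain ⟨c, hc⟩ := Submodule.mem_span_singleton.mp h2
        rw [← hc, smul_mul_assoc, one_mul]
        exact Submodule.smul_mem _ _ (Submodule.subset_span ⟨t, rfl⟩)
      · rw [← hb, ← Finset.sum_sub_distrib]
        refine sum_mem fun t _ => ?_
        rw [← sub_mul]
        refine Submodule.mul_mem_mul ?_ (by rw [hIT]; exact Ideal.subset_span t.2)
        rw [mem_irrelevant_iff, decompose_sub, DirectSum.sub_apply, Submodule.coe_sub,
          decompose_of_mem_same 𝒢 (SetLike.coe_mem _), sub_self])
  exact ⟨s, _, ha⟩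

end GradedGenerators

/-! ## Weighted homogeneous polynomials and presentations -/

namespace WeightedPolynomial

open MvPolynomial DirectSum

attribute [local instance] MvPolynomial.weightedGradedAlgebra

variable {ι R : Type*} [CommRing R] [Algebra ℂ R]

theorem algHom_mem {𝒢 : ℕ → Submodule ℂ R} [SetLike.GradedMonoid 𝒢] {wt : ι → ℕ}
    {φ : MvPolynomial ι ℂ →ₐ[ℂ] R} (h : ∀ i, φ (X i) ∈ 𝒢 (wt i)) {p : MvPolynomial ι ℂ} {d : ℕ}
    (hp : p.IsWeightedHomogeneous wt d) : φ p ∈ 𝒢 d := by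
  induction hp using IsWeightedHomogeneous.induction_on with
  | zero => rw [map_zero]; exact zero_mem _
  | add p q _ _ hp hq => rw [map_add]; exact add_mem hp hq
  | monomial s r hs =>
    rw [aeval_unique φ, aeval_monomial, ← Algebra.smul_def, ← hs]
    exact Submodule.smul_mem _ _ (SetLike.prod_pow_mem_graded 𝒢 _ _ _ fun i _ => h i)

theorem decompose_eq (wt : ι → ℕ) (p : MvPolynomial ι ℂ) (d : ℕ) :
    (decompose (weightedHomogeneousSubmodule ℂ wt) p d : MvPolynomial ι ℂ) =
      weightedHomogeneousComponent wt d p :=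
  weightedDecomposition.decompose'_apply ℂ wt p d

theorem decompose_map {𝒢 : ℕ → Submodule ℂ R} [GradedAlgebra 𝒢] {wt : ι → ℕ}
    {φ : MvPolynomial ι ℂ →ₐ[ℂ] R} (h : ∀ i, φ (X i) ∈ 𝒢 (wt i)) (p : MvPolynomial ι ℂ) (d : ℕ) :
    (decompose 𝒢 (φ p) d : R) = φ (weightedHomogeneousComponent wt d p) := by
  let Φ : weightedHomogeneousSubmodule ℂ wt →+*ᵍ 𝒢 :=
    { toRingHom := φ.toRingHom
      map_mem := fun {_ _} hp => algHom_mem h hp }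
  rw [← decompose_eq]
  exact (Φ.map_directSumDecompose (x := p) (i := d)).symm

theorem component_mul {wt : ι → ℕ} {a p : MvPolynomial ι ℂ} {d : ℕ}
    (hp : p.IsWeightedHomogeneous wt d) (n : ℕ) : weightedHomogeneousComponent wt n (a * p) =
      if d ≤ n then weightedHomogeneousComponent wt (n - d) a * p else 0 := by
  rw [← decompose_eq, ← decompose_eq]
  exact coe_decompose_mul_of_right_mem (weightedHomogeneousSubmodule ℂ wt) n hp

theorem component_zero {wt : ι → ℕ} (hwt : ∀ i, 0 < wt i) (p : MvPolynomial ι ℂ) :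
    weightedHomogeneousComponent wt 0 p = C (constantCoeff p) :=
  weightedHomogeneousComponent_zero p fun i => (hwt i).ne'

theorem mem_irrelevant {wt : ι → ℕ} (hwt : ∀ i, 0 < wt i) (p : MvPolynomial ι ℂ) :
    p ∈ (HomogeneousIdeal.irrelevant (weightedHomogeneousSubmodule ℂ wt)).toIdeal ↔
      constantCoeff p = 0 := by
  rw [GradedGenerators.mem_irrelevant_iff, decompose_eq, component_zero hwt, C_eq_zero]

theorem degree_zero {wt : ι → ℕ} (hwt : ∀ i, 0 < wt i) :
    weightedHomogeneousSubmodule ℂ wt 0 = Submodule.span ℂ {(1 : MvPolynomial ι ℂ)} := by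
  refine le_antisymm (fun p hp => ?_) ?_
  · rw [← IsWeightedHomogeneous.weightedHomogeneousComponent_same (m := 0) hp, component_zero hwt]
    exact Submodule.mem_span_singleton.mpr ⟨constantCoeff p, by rw [smul_eq_C_mul, mul_one]⟩
  · rw [Submodule.span_singleton_le_iff_mem]
    exact isWeightedHomogeneous_one ℂ wt

/-- A homogeneous polynomial with nonzero constant coefficient is constant. -/
theorem eq_C_of_constantCoeff_ne_zero {wt : ι → ℕ} (hwt : ∀ i, 0 < wt i) {p : MvPolynomial ι ℂ}
    {d : ℕ} (hp : p.IsWeightedHomogeneous wt d) (h : constantCoeff p ≠ 0) :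
    d = 0 ∧ p = C (constantCoeff p) := by
  have hd : d = 0 := by
    rw [constantCoeff_eq] at h
    rw [← hp h, map_zero]
  subst hd
  exact ⟨rfl, by rw [← component_zero hwt, hp.weightedHomogeneousComponent_same]⟩

theorem constantCoeff_pderiv (i : ι) (p : MvPolynomial ι ℂ) :
    constantCoeff (pderiv i p) = coeff (Finsupp.single i 1) p := by
  classical
  induction p using MvPolynomial.induction_on with
  | C a => rw [pderiv_C, map_zero, coeff_C, if_neg (Finsupp.single_ne_zero.mpr one_ne_zero).symm]
  | add p q hp hq => rw [map_add, map_add, coeff_add, hp, hq]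
  | mul_X p j _ =>
    rw [pderiv_mul, pderiv_X, map_add, map_mul, map_mul, constantCoeff_X, mul_zero, zero_add,
      coeff_mul_X']
    by_cases h : i = j
    · subst h
      simp [constantCoeff_eq]
    · rw [Pi.single_eq_of_ne (Ne.symm h), map_zero, mul_zero, if_neg]
      simpa [Finsupp.single_apply] using Ne.symm h

/-- A homogeneous polynomial of the degree of a variable `Xᵢ` is the sum of a multiple of `Xᵢ` and
a polynomial that does not involve `Xᵢ`. -/
theorem notMem_vars_sub {wt : ι → ℕ} (hwt : ∀ i, 0 < wt i) {p : MvPolynomial ι ℂ} {i : ι}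
    (hp : p.IsWeightedHomogeneous wt (wt i)) :
    i ∉ (p - C (constantCoeff (pderiv i p)) * X i).vars := by
  intro hi
  obtain ⟨s, hs, his⟩ := (mem_vars_iff_mem_support i).mp hi
  rw [mem_support_iff] at hs
  have h1 : (p - C (constantCoeff (pderiv i p)) * X i).IsWeightedHomogeneous wt (wt i) :=
    hp.sub ((isWeightedHomogeneous_X ℂ wt i).C_mul _)
  -- A monomial of weight `wt i` divisible by `Xᵢ` is `Xᵢ` itself, all weights being positive, and
  -- its coefficient has been subtracted.
  have h2 := h1 hs
  have h3 : Finsupp.single i 1 ≤ s := by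
    rw [Finsupp.single_le_iff]
    exact Nat.one_le_iff_ne_zero.mpr (Finsupp.mem_support_iff.mp his)
  obtain ⟨t, rfl⟩ := exists_add_of_le h3
  rw [map_add, Finsupp.weight_single, one_smul] at h2
  have h4 : Finsupp.weight wt t = 0 := by omega
  have h5 : t = 0 := Finsupp.ext fun j =>
    (weightedDegree_eq_zero_iff (nonTorsionWeight_of fun i => (hwt i).ne')).mp h4 j
  rw [h5, add_zero, ← constantCoeff_pderiv, map_sub, pderiv_C_mul, pderiv_X_self, map_sub, mul_one,
    constantCoeff_C, sub_self] at hs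
  exact hs rfl

end WeightedPolynomial

/-! ### Lifts, kernels and linear parts for a graded augmentation -/

namespace KoszulPresentation

open MvPolynomial DirectSum WeightedPolynomial

attribute [local instance] MvPolynomial.weightedGradedAlgebra

section

variable {A : Type*} [CommRing A] [Algebra ℂ A] {𝒜 : ℕ → Submodule ℂ A} [GradedAlgebra 𝒜]
  {ι : Type*} {wt : ι → ℕ} {φ : MvPolynomial ι ℂ →ₐ[ℂ] A}

theorem isHomogeneous_ker (hφ : ∀ i, φ (X i) ∈ 𝒜 (wt i)) :
    (RingHom.ker φ).IsHomogeneous (weightedHomogeneousSubmodule ℂ wt) := by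
  intro d p hp
  rw [decompose_eq, RingHom.mem_ker, ← decompose_map hφ, (RingHom.mem_ker).mp hp, decompose_zero]
  rfl

theorem exists_homogeneous_lift (hφ : ∀ i, φ (X i) ∈ 𝒜 (wt i)) (hs : Function.Surjective φ) {a : A}
    {d : ℕ} (ha : a ∈ 𝒜 d) : ∃ p : MvPolynomial ι ℂ, p.IsWeightedHomogeneous wt d ∧ φ p = a := by
  obtain ⟨p, rfl⟩ := hs a
  refine ⟨weightedHomogeneousComponent wt d p,
    weightedHomogeneousComponent_isWeightedHomogeneous _ _, ?_⟩
  rw [← decompose_map hφ, decompose_of_mem_same 𝒜 ha]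

theorem sub_constantCoeff_mem (hφ : ∀ i, φ (X i) ∈ 𝒜 (wt i)) (hwt : ∀ i, 0 < wt i)
    (p : MvPolynomial ι ℂ) : φ p - algebraMap ℂ A (constantCoeff p) ∈
      (HomogeneousIdeal.irrelevant 𝒜).toIdeal := by
  rw [GradedGenerators.mem_irrelevant_iff, decompose_sub, DirectSum.sub_apply, Submodule.coe_sub,
    decompose_map hφ, component_zero hwt,
    decompose_of_mem_same 𝒜 (SetLike.algebraMap_mem_graded 𝒜 _), sub_eq_zero]
  exact φ.commutes _

theorem constantCoeff_eq_zero [Nontrivial A] (hφ : ∀ i, φ (X i) ∈ 𝒜 (wt i))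
    (hwt : ∀ i, 0 < wt i) {p : MvPolynomial ι ℂ} (hp : φ p = 0) : constantCoeff p = 0 := by
  have h := decompose_map hφ p 0
  rw [hp, decompose_zero, component_zero hwt] at h
  have h1 : algebraMap ℂ A (constantCoeff p) = 0 := (φ.commutes _).symm.trans h.symm
  exact (map_eq_zero _).mp h1

/-- Modulo the square of `A_>` only the constant and linear terms of a polynomial matter. Linear
coefficients thus detect minimality of generators. -/
theorem sub_linear_mem [Fintype ι] (hφ : ∀ i, φ (X i) ∈ 𝒜 (wt i)) (hwt : ∀ i, 0 < wt i)
    (p : MvPolynomial ι ℂ) : φ p - algebraMap ℂ A (constantCoeff p) -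
      ∑ i, constantCoeff (pderiv i p) • φ (X i) ∈
      (HomogeneousIdeal.irrelevant 𝒜).toIdeal * (HomogeneousIdeal.irrelevant 𝒜).toIdeal := by
  classical
  induction p using MvPolynomial.induction_on with
  | C a =>
    simp only [pderiv_C, map_zero, zero_smul, Finset.sum_const_zero, sub_zero, constantCoeff_C]
    rw [show φ (C a) = algebraMap ℂ A a from φ.commutes a, sub_self]
    exact zero_mem _
  | add p q hp hq =>
    simp only [map_add, add_smul, Finset.sum_add_distrib]
    convert! add_mem hp hq using 1
    ring
  | mul_X p j _ =>
    have h1 : ∑ i, constantCoeff (pderiv i (p * X j)) • φ (X i) = constantCoeff p • φ (X j) := by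
      rw [Finset.sum_eq_single j]
      · simp
      · intro i _ hi
        simp [pderiv_X_of_ne hi.symm]
      · simp
    rw [h1, map_mul, map_mul, constantCoeff_X, mul_zero, map_zero, sub_zero, Algebra.smul_def,
      ← sub_mul]
    exact Submodule.mul_mem_mul (sub_constantCoeff_mem hφ hwt p)
      (HomogeneousIdeal.mem_irrelevant_of_mem 𝒜 (hwt j) (hφ j))

theorem surjective_of_generators (h𝒜 : 𝒜 0 = Submodule.span ℂ {1}) [Fintype ι]
    (hφ : ∀ i, φ (X i) ∈ 𝒜 (wt i)) (hwt : ∀ i, 0 < wt i)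
    (h : IsMinimalGeneratingSet 𝒜 (HomogeneousIdeal.irrelevant 𝒜).toIdeal fun i => φ (X i)) :
    Function.Surjective φ := by
  rw [← AlgHom.range_eq_top]
  exact GradedGenerators.subalgebra_eq_top h𝒜 hwt hφ h.span_eq.ge fun i => ⟨X i, rfl⟩

end

variable {A : Type*} [CommRing A] [Algebra ℂ A] {𝒜 : ℕ → Submodule ℂ A} [GradedAlgebra 𝒜]
  {K M : KoszulPresentation 𝒜}

theorem IsMinimal.aug_surjective (h𝒜 : 𝒜 0 = Submodule.span ℂ {1}) (h : M.IsMinimal) :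
    Function.Surjective M.aug :=
  surjective_of_generators h𝒜 M.aug_mem M.wt_pos h.generators

theorem IsMinimal.ker_aug (h : M.IsMinimal) : RingHom.ker M.aug = Ideal.span (Set.range M.f) :=
  h.relations.span_eq.symm

theorem IsMinimal.constantCoeff_eq_zero_of_relation (h : M.IsMinimal)
    {a : Fin M.m → MvPolynomial (Fin M.n) ℂ} (ha : ∑ i, a i * M.f i = 0) (i : Fin M.m) :
    constantCoeff (a i) = 0 := by
  refine h.relations.eq_zero_of_relation (a := a) (c := fun i => constantCoeff (a i)) (fun i => ?_)
    (by rw [ha]; exact zero_mem _) i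
  rw [mem_irrelevant M.wt_pos, map_sub, sub_eq_zero]
  exact (constantCoeff_C _ _).symm

/-- The counterpart of minimality valid for any Koszul resolution: coefficients of relations lie in
the kernel, and a polynomial in the kernel has no constant term because `A` is nontrivial. It
ensures that the relations are not redundant. -/
theorem IsResolution.constantCoeff_eq_zero_of_relation [Nontrivial A] (h : K.IsResolution)
    {a : Fin K.m → MvPolynomial (Fin K.n) ℂ} (ha : ∑ i, a i * K.f i = 0) (i : Fin K.m) :
    constantCoeff (a i) = 0 :=
  constantCoeff_eq_zero K.aug_mem K.wt_pos (h.mem_of_relation ha i)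

end KoszulPresentation

/-! ## Changes of coordinates and of relations in a presentation -/

namespace KoszulPresentation

open MvPolynomial WeightedPolynomial

attribute [local instance] MvPolynomial.weightedGradedAlgebra

variable {A : Type*} [CommRing A] [Algebra ℂ A] {𝒜 : ℕ → Submodule ℂ A}
  {K : KoszulPresentation 𝒜}

/-- The presentation with the same variables as `K`, and other relations and augmentation. -/
def replace (K : KoszulPresentation 𝒜) (f : Fin K.m → MvPolynomial (Fin K.n) ℂ)
    (aug : MvPolynomial (Fin K.n) ℂ →ₐ[ℂ] A) (hf : ∀ i, ∃ d, (f i).IsWeightedHomogeneous K.wt d)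
    (haug : ∀ i, aug (X i) ∈ 𝒜 (K.wt i)) : KoszulPresentation 𝒜 where
  n := K.n
  m := K.m
  wt := K.wt
  wt_pos := K.wt_pos
  f := f
  fdeg := fun i => (hf i).choose
  f_homogeneous := fun i => (hf i).choose_spec
  aug := aug
  aug_mem := haug

/-- Relations `f` and an augmentation in the variables of `K` that give a Koszul resolution with
the same chiral Koszul complex as `K`. -/
structure IsTransform (K : KoszulPresentation 𝒜) (f : Fin K.m → MvPolynomial (Fin K.n) ℂ)
    (aug : MvPolynomial (Fin K.n) ℂ →ₐ[ℂ] A) : Prop where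
  homogeneous : ∀ i, ∃ d, (f i).IsWeightedHomogeneous K.wt d
  aug_mem : ∀ i, aug (X i) ∈ 𝒜 (K.wt i)
  isResolution : (K.replace f aug homogeneous aug_mem).IsResolution
  isomorphic : (Chiral.chiralKoszul K.f).Isomorphic (Chiral.chiralKoszul f)

theorem IsResolution.isTransform (h : K.IsResolution) : K.IsTransform K.f K.aug where
  homogeneous := fun i => ⟨_, K.f_homogeneous i⟩
  aug_mem := K.aug_mem
  isResolution := ⟨h.comm, h.surjective, h.injective⟩
  isomorphic := DGVertexData.Isomorphic.refl _

namespace IsTransform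

variable {f f' : Fin K.m → MvPolynomial (Fin K.n) ℂ} {aug : MvPolynomial (Fin K.n) ℂ →ₐ[ℂ] A}

/-- The Koszul complexes correspond under `S` and `T` with identity matrices on the `ξᵢ`, so the
resolution property is carried along. -/
theorem change_variables (h : K.IsTransform f aug)
    {S T : MvPolynomial (Fin K.n) ℂ →ₐ[ℂ] MvPolynomial (Fin K.n) ℂ}
    (hS : ∀ i, (S (X i)).IsWeightedHomogeneous K.wt (K.wt i))
    (hT : ∀ i, (T (X i)).IsWeightedHomogeneous K.wt (K.wt i))
    (hST : ∀ i, S (T (X i)) = X i) (hTS : ∀ i, T (S (X i)) = X i)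
    (hiso : (Chiral.chiralKoszul f).Isomorphic (Chiral.chiralKoszul fun j => S (f j)))
    [SetLike.GradedMonoid 𝒜] :
    K.IsTransform (fun j => S (f j)) (aug.comp T) where
  homogeneous := fun i => by
    obtain ⟨d, hd⟩ := h.homogeneous i
    exact ⟨d, algHom_mem (𝒢 := weightedHomogeneousSubmodule ℂ K.wt) hS hd⟩
  aug_mem := fun i => algHom_mem h.aug_mem (hT i)
  isResolution := by
    refine h.isResolution.of_retract (L := K.replace _ _ _ _) T S hST
      (1 : Matrix (Fin K.m) (Fin K.m) _) (1 : Matrix (Fin K.m) (Fin K.m) _) (fun j => ?_)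
      (fun j => ?_) (fun j k => ?_) (fun i => rfl) (fun i => ?_)
    · have h1 : T (S (f j)) = f j := congrFun (congrArg DFunLike.coe
        (algHom_ext (f := T.comp S) (g := AlgHom.id ℂ _) hTS)) (f j)
      exact h1.trans (congrFun (Matrix.one_mulVec f) j).symm
    · exact (congrFun (Matrix.one_mulVec fun j => S (f j)) j).symm
    · have h1 : ∀ j k : Fin K.m, ∑ i, S ((1 : Matrix (Fin K.m) (Fin K.m) _) j i) *
          (1 : Matrix (Fin K.m) (Fin K.m) _) i k = if j = k then 1 else 0 := fun j k => by
        simp [Matrix.one_apply, apply_ite S]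
      exact h1 j k
    · exact congrArg aug (hTS i)
  isomorphic := h.isomorphic.trans hiso

/-- An invertible matrix acts on the `ξᵢ`; its inverse makes the new complex a retract of the old
one. -/
theorem change_relations (h : K.IsTransform f aug)
    (hf' : ∀ i, ∃ d, (f' i).IsWeightedHomogeneous K.wt d)
    {P Q : Matrix (Fin K.m) (Fin K.m) (MvPolynomial (Fin K.n) ℂ)} (hPQ : P * Q = 1)
    (hP : f' = P.mulVec f)
    (hiso : (Chiral.chiralKoszul f).Isomorphic (Chiral.chiralKoszul f')) :
    K.IsTransform f' aug where
  homogeneous := hf'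
  aug_mem := h.aug_mem
  isResolution := by
    have hQ : f = Q.mulVec f' := by
      rw [hP, Matrix.mulVec_mulVec, mul_eq_one_comm.mp hPQ, Matrix.one_mulVec]
    exact h.isResolution.of_retract (L := K.replace _ _ _ _) (AlgHom.id ℂ _) (AlgHom.id ℂ _)
      (fun i => rfl) P Q (fun j => congrFun hP j) (fun j => congrFun hQ j)
      (fun j k => (congrFun (congrFun hPQ j) k).trans Matrix.one_apply) (fun i => rfl)
      (fun i => rfl)
  isomorphic := h.isomorphic.trans hiso

/-- The substitution `Xᵢ ↦ Y`, for a polynomial `Y` that contains a multiple of `Xᵢ`. -/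
theorem exists_substitution [SetLike.GradedMonoid 𝒜] (h : K.IsTransform f aug) {i : Fin K.n}
    {Y : MvPolynomial (Fin K.n) ℂ} (hY : Y.IsWeightedHomogeneous K.wt (K.wt i))
    (hc : constantCoeff (pderiv i Y) ≠ 0) :
    ∃ f' aug', K.IsTransform f' aug' ∧ aug' (X i) = aug Y ∧
      ∀ k ≠ i, aug' (X k) = aug (X k) := by
  set c := constantCoeff (pderiv i Y) with hcdef
  set p := Y - C c * X i with hp
  have hpi : i ∉ p.vars := notMem_vars_sub K.wt_pos hY
  have hpi' : i ∉ (-p).vars := by rwa [vars_neg]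
  have hpw : p.IsWeightedHomogeneous K.wt (K.wt i) :=
    hY.sub ((isWeightedHomogeneous_X ℂ K.wt i).C_mul _)
  have haeval : ∀ (q : Fin K.n → MvPolynomial (Fin K.n) ℂ), (∀ k ≠ i, q k = X k) →
      aeval q p = p := by
    intro q hq
    conv_rhs => rw [← aeval_X_left_apply (R := ℂ) p]
    exact eval₂Hom_congr' rfl (fun k hk _ => hq k fun hki => hpi (hki ▸ hk)) rfl
  -- With `Y = c Xᵢ + p` the substitution `Xᵢ ↦ Y` is a rescaling composed with a shear. The
  -- relations undergo the inverse substitutions, hence `c⁻¹` here and `-p` in `S₂`.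
  let cs : Fin K.n → ℂ := fun k => if k = i then c⁻¹ else 1
  have hcs : ∀ k, cs k ≠ 0 := fun k => by
    by_cases hk : k = i <;> simp [cs, hk, hc]
  let S₁ : MvPolynomial (Fin K.n) ℂ →ₐ[ℂ] MvPolynomial (Fin K.n) ℂ := aeval fun k => cs k • X k
  let T₁ : MvPolynomial (Fin K.n) ℂ →ₐ[ℂ] MvPolynomial (Fin K.n) ℂ :=
    aeval fun k => (cs k)⁻¹ • X k
  let S₂ : MvPolynomial (Fin K.n) ℂ →ₐ[ℂ] MvPolynomial (Fin K.n) ℂ :=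
    aeval fun k => X k + if k = i then -p else 0
  let T₂ : MvPolynomial (Fin K.n) ℂ →ₐ[ℂ] MvPolynomial (Fin K.n) ℂ :=
    aeval fun k => X k + if k = i then p else 0
  have hsmul : ∀ (b : Fin K.n → ℂ) (k : Fin K.n),
      (b k • X k : MvPolynomial (Fin K.n) ℂ).IsWeightedHomogeneous K.wt (K.wt k) := fun b k => by
    rw [smul_eq_C_mul]
    exact (isWeightedHomogeneous_X ℂ K.wt k).C_mul _
  have hadd : ∀ (q : MvPolynomial (Fin K.n) ℂ), q.IsWeightedHomogeneous K.wt (K.wt i) →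
      ∀ k, (X k + if k = i then q else 0 : MvPolynomial (Fin K.n) ℂ).IsWeightedHomogeneous K.wt
        (K.wt k) := fun q hq k => by
    refine (isWeightedHomogeneous_X ℂ K.wt k).add ?_
    split_ifs with hk
    · exact hk ▸ hq
    · exact isWeightedHomogeneous_zero _ _ _
  have h1 : K.IsTransform (fun j => S₁ (f j)) (aug.comp T₁) := by
    refine h.change_variables (S := S₁) (T := T₁) (fun k => ?_) (fun k => ?_) (fun k => ?_)
      (fun k => ?_) ?_
    · rw [aeval_X]; exact hsmul _ k
    · rw [aeval_X]; exact hsmul (fun k => (cs k)⁻¹) k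
    · rw [aeval_X, map_smul, aeval_X, smul_smul, inv_mul_cancel₀ (hcs k), one_smul]
    · rw [aeval_X, map_smul, aeval_X, smul_smul, mul_inv_cancel₀ (hcs k), one_smul]
    · have := Chiral.isomorphic_scale f cs hcs (fun _ => 1) fun _ => one_ne_zero
      simpa only [one_smul] using this
  have h2 : K.IsTransform (fun j => S₂ (S₁ (f j))) ((aug.comp T₁).comp T₂) := by
    refine h1.change_variables (S := S₂) (T := T₂) (fun k => ?_) (fun k => ?_) (fun k => ?_)
      (fun k => ?_) (Chiral.isomorphic_shear _ i hpi')
    · rw [aeval_X]; exact hadd _ hpw.neg k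
    · rw [aeval_X]; exact hadd _ hpw k
    · rw [aeval_X, map_add, aeval_X]
      split_ifs
      · rw [haeval _ fun k hk => by rw [if_neg hk, add_zero], neg_add_cancel_right]
      · rw [map_zero, add_zero, add_zero]
    · rw [aeval_X, map_add, aeval_X]
      split_ifs
      · rw [map_neg, haeval _ fun k hk => by rw [if_neg hk, add_zero], add_neg_cancel_right]
      · rw [map_zero, add_zero, add_zero]
  refine ⟨_, _, h2, ?_, fun k hk => ?_⟩
  · change aug (T₁ (T₂ (X i))) = aug Y
    rw [aeval_X, if_pos rfl, map_add, aeval_X,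
      haeval _ fun k hk => by simp [cs, hk], hp]
    congr 1
    simp [cs, smul_eq_C_mul]
  · change aug (T₁ (T₂ (X k))) = aug (X k)
    rw [aeval_X, if_neg hk, add_zero, aeval_X]
    simp [cs, hk]

/-- A relation is replaced by a homogeneous combination of relations in which its coefficient is
a nonzero constant. -/
theorem replace_relation (h : K.IsTransform f aug) {i : Fin K.m}
    {a : Fin K.m → MvPolynomial (Fin K.n) ℂ} {c : ℂ} (hc : c ≠ 0) (hai : a i = C c) {D : ℕ}
    (ha : ∀ l, (a l * f l).IsWeightedHomogeneous K.wt D) :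
    K.IsTransform (fun j => if j = i then ∑ l, a l * f l else f j) aug := by
  -- The terms are added one at a time: first the rescaling by `c`, then one transvection for each
  -- `l ≠ i`. Every partial sum is homogeneous because all `a l * f l` have degree `D`.
  have key : ∀ s : Finset (Fin K.m), i ∉ s →
      K.IsTransform (fun j => if j = i then C c * f i + ∑ l ∈ s, a l * f l else f j) aug := by
    intro s
    induction s using Finset.induction_on with
    | empty =>
      intro _
      let d : Fin K.m → ℂ := fun j => if j = i then c else 1
      have hd : ∀ j, d j ≠ 0 := fun j => by
        by_cases hj : j = i <;> simp [d, hj, hc]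
      have hfd : (fun j => if j = i then C c * f i + ∑ l ∈ (∅ : Finset (Fin K.m)), a l * f l
          else f j) = fun j => d j • f j := by
        funext j
        by_cases hj : j = i
        · subst hj; simp [d, smul_eq_C_mul]
        · simp [d, hj]
      rw [hfd]
      refine h.change_relations (fun j => ?_) (P := Matrix.diagonal fun j => C (d j))
        (Q := Matrix.diagonal fun j => C (d j)⁻¹) ?_ ?_ ?_
      · obtain ⟨e, he⟩ := h.homogeneous j
        exact ⟨e, by rw [smul_eq_C_mul]; exact he.C_mul _⟩
      · rw [Matrix.diagonal_mul_diagonal, ← Matrix.diagonal_one]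
        congr 1
        funext j
        rw [← map_mul, mul_inv_cancel₀ (hd j), map_one]
      · funext j
        rw [Matrix.mulVec_diagonal, smul_eq_C_mul]
      · have := Chiral.isomorphic_scale f (fun _ => 1) (fun _ => one_ne_zero) d hd
        simpa only [one_smul, aeval_X_left_apply] using this
    | insert l s hl ih =>
      intro hi
      rw [Finset.mem_insert, not_or] at hi
      have h1 := ih hi.2
      have hf' : (fun j => if j = i then C c * f i + ∑ l ∈ insert l s, a l * f l else f j) =
          fun j => (if j = i then C c * f i + ∑ l ∈ s, a l * f l else f j) -
            if j = i then -a l * (if l = i then C c * f i + ∑ l ∈ s, a l * f l else f l) else 0 := by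
        funext j
        rw [Finset.sum_insert hl, if_neg (Ne.symm hi.1)]
        split_ifs
        · ring
        · rw [sub_zero]
      refine h1.change_relations (fun j => ?_) (P := Matrix.transvection i l (a l))
        (Q := Matrix.transvection i l (-a l)) ?_ ?_ ?_
      · split_ifs
        · refine ⟨D, IsWeightedHomogeneous.add ?_ (IsWeightedHomogeneous.sum _ _ _ ?_)⟩
          · rw [← hai]; exact ha i
          · exact fun l _ => ha l
        · exact h.homogeneous j
      · rw [Matrix.transvection_mul_transvection_same _ _ hi.1, add_neg_cancel,
          Matrix.transvection_zero]
      · rw [hf']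
        funext j
        rw [Matrix.transvection, Matrix.add_mulVec, Matrix.one_mulVec, Matrix.single_mulVec]
        simp only [Pi.add_apply, Function.update_apply, Pi.zero_apply]
        split_ifs <;> ring
      · rw [hf']
        exact Chiral.isomorphic_exchange _ hi.1 _
  convert! key (Finset.univ.erase i) (Finset.notMem_erase _ _) using 1
  funext j
  rw [← Finset.add_sum_erase _ _ (Finset.mem_univ i), hai]

end IsTransform

end KoszulPresentation

/-! ## Comparison with a minimal presentation -/

namespace KoszulPresentation

open MvPolynomial WeightedPolynomial

attribute [local instance] MvPolynomial.weightedGradedAlgebra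

variable {A : Type*} [CommRing A] [Algebra ℂ A] {𝒜 : ℕ → Submodule ℂ A} {K M : KoszulPresentation 𝒜}

theorem IsTransform.aug_surjective {f : Fin K.m → MvPolynomial (Fin K.n) ℂ}
    {aug : MvPolynomial (Fin K.n) ℂ →ₐ[ℂ] A} (h : K.IsTransform f aug) :
    Function.Surjective aug := h.isResolution.aug_surjective

theorem IsTransform.ker_aug {f : Fin K.m → MvPolynomial (Fin K.n) ℂ}
    {aug : MvPolynomial (Fin K.n) ℂ →ₐ[ℂ] A} (h : K.IsTransform f aug) :
    RingHom.ker aug = Ideal.span (Set.range f) := h.isResolution.ker_aug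

section Variables

variable [GradedAlgebra 𝒜]

/-- A lift of a minimal generator contains a variable that does not map to another generator. -/
theorem IsMinimal.exists_linear_coeff_ne_zero (hM : M.IsMinimal) {n : ℕ} {wt : Fin n → ℕ}
    (hwt : ∀ i, 0 < wt i) {φ : MvPolynomial (Fin n) ℂ →ₐ[ℂ] A} (hφ : ∀ i, φ (X i) ∈ 𝒜 (wt i))
    {t : Fin M.n} {Y : MvPolynomial (Fin n) ℂ} (hY : Y.IsWeightedHomogeneous wt (M.wt t))
    (hYt : φ Y = M.aug (X t)) (S : Finset (Fin n)) (hS : ∀ i ∈ S, ∃ j ≠ t, φ (X i) = M.aug (X j)) :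
    ∃ i ∉ S, constantCoeff (pderiv i Y) ≠ 0 := by
  by_contra! hcon
  -- If every variable outside `S` had zero linear coefficient, then modulo the square of `A_>` the
  -- generator `t` would be a combination of the other generators.
  refine hM.generators.linearIndependent.notMem_span_image (s := {t}ᶜ) (x := t) (by simp) ?_
  have hY0 : constantCoeff Y = 0 := by
    by_contra h
    exact (M.wt_pos t).ne' (eq_C_of_constantCoeff_ne_zero hwt hY h).1
  have h1 := sub_linear_mem hφ hwt Y
  rw [hY0, map_zero, sub_zero, hYt, ← Ideal.Quotient.mk_eq_mk_iff_sub_mem, map_sum] at h1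
  rw [h1]
  refine sum_mem fun i _ => ?_
  by_cases hi : i ∈ S
  · obtain ⟨j, hj, hij⟩ := hS i hi
    rw [hij]
    exact Submodule.smul_mem _ (constantCoeff (pderiv i Y)) 
      (Submodule.subset_span (Set.mem_image_of_mem _ hj))
  · rw [hcon i hi, zero_smul, map_zero]
    exact zero_mem _

/-- After a change of variables, the generators of a minimal presentation are the images of some
of the variables. -/
theorem IsResolution.exists_transform_generators (hK : K.IsResolution) (hM : M.IsMinimal) :
    ∃ f aug, ∃ e : Fin M.n → Fin K.n, K.IsTransform f aug ∧ Function.Injective e ∧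
      (∀ j, K.wt (e j) = M.wt j) ∧ ∀ j, aug (X (e j)) = M.aug (X j) := by
  rcases isEmpty_or_nonempty (Fin M.n) with hn | ⟨⟨t₀⟩⟩
  · exact ⟨K.f, K.aug, hn.elim, hK.isTransform, fun j => hn.elim j, fun j => hn.elim j,
      fun j => hn.elim j⟩
  -- Exchange step: a homogeneous lift of generator `t` contains linearly a variable not already
  -- used, and that variable is replaced by the lift. The weights agree because the lift is
  -- homogeneous.
  have hstep : ∀ {f aug}, K.IsTransform f aug → ∀ (t : Fin M.n) (S : Finset (Fin K.n)),
      (∀ i ∈ S, ∃ j ≠ t, aug (X i) = M.aug (X j)) → ∃ i ∉ S, ∃ f' aug', K.IsTransform f' aug' ∧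
        K.wt i = M.wt t ∧ aug' (X i) = M.aug (X t) ∧ ∀ k ≠ i, aug' (X k) = aug (X k) := by
    intro f aug h t S hS
    obtain ⟨Y, hY, hYt⟩ := exists_homogeneous_lift h.aug_mem h.aug_surjective (M.aug_mem t)
    obtain ⟨i, hiS, hi⟩ := hM.exists_linear_coeff_ne_zero K.wt_pos h.aug_mem hY hYt S hS
    have hwt : K.wt i = M.wt t := by
      rw [constantCoeff_pderiv] at hi
      rw [← hY hi, Finsupp.weight_single, one_smul]
    obtain ⟨f', aug', h', h1, h2⟩ := h.exists_substitution (hwt.symm ▸ hY) hi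
    exact ⟨i, hiS, f', aug', h', hwt, h1.trans hYt, h2⟩
  have key : ∀ T : Finset (Fin M.n), ∃ f aug, ∃ e : Fin M.n → Fin K.n, K.IsTransform f aug ∧
      Set.InjOn e T ∧ (∀ j ∈ T, K.wt (e j) = M.wt j) ∧ ∀ j ∈ T, aug (X (e j)) = M.aug (X j) := by
    intro T
    induction T using Finset.induction_on with
    | empty =>
      -- The map `e` needs a value even before any choice has been made; the exchange step shows
      -- that `K` has a variable.
      obtain ⟨i, -⟩ := hstep hK.isTransform t₀ ∅ (by simp)
      exact ⟨K.f, K.aug, fun _ => i, hK.isTransform, by simp, by simp, by simp⟩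
    | insert t T ht ih =>
      obtain ⟨f, aug, e, h, he, hwt, hX⟩ := ih
      obtain ⟨i, hi, f', aug', h', hwt', hXt, hX'⟩ := hstep h t (T.image e) fun i hi => by
        obtain ⟨j, hj, rfl⟩ := Finset.mem_image.mp hi
        exact ⟨j, fun hjt => ht (hjt ▸ hj), hX j hj⟩
      have hne : ∀ j ∈ T, j ≠ t := fun j hj hjt => ht (hjt ▸ hj)
      have hei : ∀ j ∈ T, e j ≠ i := fun j hj hji => hi (Finset.mem_image.mpr ⟨j, hj, hji⟩)
      refine ⟨f', aug', Function.update e t i, h', ?_, ?_, ?_⟩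
      · rw [Finset.coe_insert, Set.injOn_insert (by simpa using ht)]
        refine ⟨fun j hj k hk hjk => ?_, ?_⟩
        · rw [Function.update_of_ne (hne j hj), Function.update_of_ne (hne k hk)] at hjk
          exact he hj hk hjk
        · rintro ⟨j, hj, hji⟩
          rw [Function.update_of_ne (hne j hj), Function.update_self] at hji
          exact hei j hj hji
      · intro j hj
        rcases Finset.mem_insert.mp hj with rfl | hj
        · rw [Function.update_self, hwt']
        · rw [Function.update_of_ne (hne j hj), hwt j hj]
      · intro j hj
        rcases Finset.mem_insert.mp hj with rfl | hj
        · rw [Function.update_self, hXt]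
        · rw [Function.update_of_ne (hne j hj), hX' _ (hei j hj), hX j hj]
  obtain ⟨f, aug, e, h, he, hwt, hX⟩ := key Finset.univ
  exact ⟨f, aug, e, h, fun j k hjk => he (by simp) (by simp) hjk, fun j => hwt j (by simp),
    fun j => hX j (by simp)⟩

/-- After a change of variables, the generators of a minimal presentation are the images of some
of the variables, and the other variables map to zero. -/
theorem IsResolution.exists_transform_variables (h𝒜 : 𝒜 0 = Submodule.span ℂ {1})
    (hK : K.IsResolution) (hM : M.IsMinimal) :
    ∃ f aug, ∃ e : Fin M.n → Fin K.n, K.IsTransform f aug ∧ Function.Injective e ∧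
      (∀ j, K.wt (e j) = M.wt j) ∧ (∀ j, aug (X (e j)) = M.aug (X j)) ∧
      ∀ k ∉ Set.range e, aug (X k) = 0 := by
  obtain ⟨f₀, aug₀, e, h₀, he, hwt, hX₀⟩ := hK.exists_transform_generators hM
  have key : ∀ U : Finset (Fin K.n), (∀ k ∈ U, k ∉ Set.range e) → ∃ f aug,
      K.IsTransform f aug ∧ (∀ j, aug (X (e j)) = M.aug (X j)) ∧ ∀ k ∈ U, aug (X k) = 0 := by
    intro U
    induction U using Finset.induction_on with
    | empty => exact fun _ => ⟨f₀, aug₀, h₀, hX₀, by simp⟩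
    | insert i U hi ih =>
      intro hU
      obtain ⟨f, aug, h, hX, h0⟩ := ih fun k hk => hU k (Finset.mem_insert_of_mem hk)
      have hie := hU i (Finset.mem_insert_self _ _)
      -- The image of a remaining variable is a polynomial in the generators of `M`. Subtracting
      -- that polynomial in the chosen variables makes the image zero and leaves the chosen
      -- variables alone.
      obtain ⟨q, hq, hqi⟩ := exists_homogeneous_lift M.aug_mem (hM.aug_surjective h𝒜) (h.aug_mem i)
      have hren : ∀ p, aug (rename e p) = M.aug p := fun p => congrFun (congrArg DFunLike.coe
        (algHom_ext (f := aug.comp (rename e)) (g := M.aug) fun j => by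
          rw [AlgHom.comp_apply, rename_X, hX])) p
      have hqw : (rename e q).IsWeightedHomogeneous K.wt (K.wt i) :=
        algHom_mem (𝒢 := weightedHomogeneousSubmodule ℂ K.wt) (φ := rename e) (fun j => by
          rw [rename_X, ← hwt]
          exact isWeightedHomogeneous_X ℂ K.wt _) hq
      have hqd : pderiv i (rename e q) = 0 := by
        classical
        refine pderiv_eq_zero_of_notMem_vars fun hi' => hie ?_
        obtain ⟨j, -, hj⟩ := Finset.mem_image.mp (vars_rename e q hi')
        exact ⟨j, hj⟩
      obtain ⟨f', aug', h', h1, h2⟩ := h.exists_substitution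
        ((isWeightedHomogeneous_X ℂ K.wt i).sub hqw) (by
          rw [map_sub, pderiv_X_self, hqd, sub_zero, map_one]
          exact one_ne_zero)
      refine ⟨f', aug', h', fun j => ?_, fun k hk => ?_⟩
      · rw [h2 _ fun hji => hie ⟨j, hji⟩, hX]
      · by_cases hki : k = i
        · rw [hki, h1, map_sub, hren, hqi, sub_self]
        · rw [h2 k hki, h0 k ((Finset.mem_insert.mp hk).resolve_left hki)]
  classical
  obtain ⟨f, aug, h, hX, h0⟩ := key (Finset.univ.filter fun k => k ∉ Set.range e)
    fun k hk => (Finset.mem_filter.mp hk).2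
  exact ⟨f, aug, e, h, he, hwt, hX, fun k hk => h0 k (by simpa using hk)⟩

end Variables

/-- The relations `g` in some of the variables, together with the other variables. -/
def stabilization {n r s : ℕ} (e : Fin r → Fin n) (g : Fin s → MvPolynomial (Fin r) ℂ) :
    Fin s ⊕ {k // k ∉ Set.range e} → MvPolynomial (Fin n) ℂ :=
  Sum.elim (fun j => rename e (g j)) fun k => X k.1

section Stabilization

variable {n r s : ℕ} {e : Fin r → Fin n} (he : Function.Injective e)

theorem killCompl_X (j : Fin r) : killCompl (R := ℂ) he (X (e j)) = X j := by
  rw [← rename_X, killCompl_rename_app]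

theorem killCompl_X_of_notMem {k : Fin n} (hk : k ∉ Set.range e) :
    killCompl (R := ℂ) he (X k) = 0 := by
  rw [killCompl, aeval_X, dif_neg hk]

theorem constantCoeff_killCompl (p : MvPolynomial (Fin n) ℂ) :
    constantCoeff (killCompl he p) = constantCoeff p := by
  induction p using MvPolynomial.induction_on with
  | C a => rw [killCompl_C]; simp
  | add p q hp hq => rw [map_add, map_add, map_add, hp, hq]
  | mul_X p k _ =>
    rw [map_mul, map_mul, map_mul, constantCoeff_X, mul_zero]
    by_cases hk : k ∈ Set.range e
    · obtain ⟨j, rfl⟩ := hk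
      rw [killCompl_X, constantCoeff_X, mul_zero]
    · rw [killCompl_X_of_notMem he hk, map_zero, mul_zero]

/-- Modulo the extra variables every polynomial is one in the variables of `e`, so the kernel of the
augmentation is generated by the stabilization as soon as the smaller kernel is generated by `g`. -/
theorem sub_rename_killCompl_mem (g : Fin s → MvPolynomial (Fin r) ℂ) (p : MvPolynomial (Fin n) ℂ) :
    p - rename e (killCompl he p) ∈ Ideal.span (Set.range (stabilization e g)) := by
  induction p using MvPolynomial.induction_on with
  | C a => rw [killCompl_C, rename_C, sub_self]; exact zero_mem _
  | add p q hp hq =>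
    rw [map_add, map_add, add_sub_add_comm]
    exact add_mem hp hq
  | mul_X p k hp =>
    rw [map_mul, map_mul]
    by_cases hk : k ∈ Set.range e
    · obtain ⟨j, rfl⟩ := hk
      rw [killCompl_X, rename_X, ← sub_mul]
      exact Ideal.mul_mem_right _ _ hp
    · rw [killCompl_X_of_notMem he hk, map_zero, mul_zero, sub_zero]
      exact Ideal.mul_mem_left _ _ (Ideal.subset_span ⟨Sum.inr ⟨k, hk⟩, rfl⟩)

theorem mem_span_stabilization {g : Fin s → MvPolynomial (Fin r) ℂ} {p : MvPolynomial (Fin n) ℂ}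
    (hp : killCompl he p ∈ Ideal.span (Set.range g)) :
    p ∈ Ideal.span (Set.range (stabilization e g)) := by
  have h1 := Ideal.mem_map_of_mem (rename e : MvPolynomial (Fin r) ℂ →ₐ[ℂ] _) hp
  rw [Ideal.map_span] at h1
  rw [← sub_add_cancel p (rename e (killCompl he p))]
  refine add_mem (sub_rename_killCompl_mem he g p) (Ideal.span_mono ?_ h1)
  rintro _ ⟨_, ⟨j, rfl⟩, rfl⟩
  exact ⟨Sum.inl j, rfl⟩

/-- The coefficients of relations between the elements of a stabilization have no constant terms
if this holds for the stabilized elements. -/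
theorem constantCoeff_eq_zero_of_stabilization (he : Function.Injective e)
    {g : Fin s → MvPolynomial (Fin r) ℂ}
    (hg0 : ∀ j, constantCoeff (g j) = 0)
    (hg : ∀ a : Fin s → MvPolynomial (Fin r) ℂ, ∑ j, a j * g j = 0 → ∀ j, constantCoeff (a j) = 0)
    {b : Fin s ⊕ {k // k ∉ Set.range e} → MvPolynomial (Fin n) ℂ}
    (hb : ∑ t, b t * stabilization e g t = 0) (t) : constantCoeff (b t) = 0 := by
  rw [Fintype.sum_sum_type] at hb
  simp only [stabilization, Sum.elim_inl, Sum.elim_inr] at hb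
  rcases t with j | k
  · rw [← constantCoeff_killCompl he]
    -- Killing the extra variables leaves a relation between the `g j`.
    refine hg (fun j => killCompl he (b (Sum.inl j))) ?_ j
    have h1 := congrArg (killCompl he) hb
    rw [map_add, map_sum, map_sum, map_zero] at h1
    simp only [map_mul, killCompl_rename_app] at h1
    have h2 : ∑ k : {k // k ∉ Set.range e}, killCompl he (b (Sum.inr k)) * killCompl he (X k.1) = 0 :=
      Finset.sum_eq_zero fun k _ => by rw [killCompl_X_of_notMem he k.2, mul_zero]
    rw [h2, add_zero] at h1
    exact h1
  -- Differentiating by the extra variable `X k` and taking the constant term isolates the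
  -- coefficient of `X k`: the `g j` have no constant term and do not involve `X k`.
  · have h1 := congrArg (fun p => constantCoeff (pderiv k.1 p)) hb
    simp only [map_add, map_sum, map_zero, pderiv_mul, map_mul, constantCoeff_X, mul_zero,
      zero_add] at h1
    rw [Finset.sum_eq_zero fun j _ => ?_, zero_add, Finset.sum_eq_single k] at h1
    · rwa [pderiv_X_self, map_one, mul_one] at h1
    · intro l _ hl
      rw [pderiv_X_of_ne fun h => hl (Subtype.ext h), map_zero, mul_zero]
    · simp
    · classical
      rw [constantCoeff_rename, hg0, mul_zero, zero_add, pderiv_eq_zero_of_notMem_vars, map_zero,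
        mul_zero]
      intro hk
      obtain ⟨i, -, hi⟩ := Finset.mem_image.mp (vars_rename e _ hk)
      exact k.2 ⟨i, hi⟩

end Stabilization

end KoszulPresentation

/-! ## Reduction of a Koszul resolution to a minimal one -/

namespace KoszulPresentation

open MvPolynomial WeightedPolynomial

attribute [local instance] MvPolynomial.weightedGradedAlgebra

variable {A : Type*} [CommRing A] [Algebra ℂ A] {𝒜 : ℕ → Submodule ℂ A}
  {K M : KoszulPresentation 𝒜} {f : Fin K.m → MvPolynomial (Fin K.n) ℂ}
  {aug : MvPolynomial (Fin K.n) ℂ →ₐ[ℂ] A}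

/-- A homogeneous element of the kernel that is independent of some of the relations can replace
another relation. -/
theorem IsTransform.exists_replace_relation (h : K.IsTransform f aug) {τ : Type*} [Fintype τ]
    {u : τ → MvPolynomial (Fin K.n) ℂ} (hu : ∀ t, ∃ d, (u t).IsWeightedHomogeneous K.wt d)
    (hspan : Ideal.span (Set.range u) = RingHom.ker aug)
    (hrel : ∀ b : τ → MvPolynomial (Fin K.n) ℂ, ∑ t, b t * u t = 0 → ∀ t, constantCoeff (b t) = 0)
    (t₀ : τ) {V : Finset (Fin K.m)} (hV : ∀ l ∈ V, ∃ t ≠ t₀, f l = u t) :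
    ∃ i ∉ V, K.IsTransform (fun j => if j = i then u t₀ else f j) aug := by
  classical
  obtain ⟨D, hD⟩ := hu t₀
  choose d hd using h.homogeneous
  have hmem : ∀ t, u t ∈ RingHom.ker aug := fun t => hspan ▸ Ideal.subset_span ⟨t, rfl⟩
  obtain ⟨a', ha'⟩ := Ideal.mem_span_range_iff_exists_fun.mp (h.ker_aug ▸ hmem t₀)
  -- The coefficients are truncated to the degrees in which they contribute to degree `D`, so that
  -- each term `a l * f l` is homogeneous.
  let a : Fin K.m → MvPolynomial (Fin K.n) ℂ := fun l =>
    if d l ≤ D then weightedHomogeneousComponent K.wt (D - d l) (a' l) else 0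
  have haf : ∀ l, a l * f l = weightedHomogeneousComponent K.wt D (a' l * f l) := fun l => by
    rw [component_mul (hd l)]
    by_cases hl : d l ≤ D
    · simp only [a, if_pos hl]
    · simp only [a, if_neg hl, zero_mul]
  have ha : ∑ l, a l * f l = u t₀ := by
    rw [Finset.sum_congr rfl fun l _ => haf l, ← map_sum, ha', hD.weightedHomogeneousComponent_same]
  have hw : ∀ l, (a l * f l).IsWeightedHomogeneous K.wt D := fun l => by
    rw [haf]
    exact weightedHomogeneousComponent_isWeightedHomogeneous _ _
  -- Otherwise, expressing all `f l` by the `u t` gives a relation in which `u t₀` has a coefficient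
  -- with constant term `1`: indices in `V` do not contribute `u t₀`, and the others contribute no
  -- constant term.
  obtain ⟨i, hi, hai⟩ : ∃ i ∉ V, constantCoeff (a i) ≠ 0 := by
    by_contra! hcon
    have hb : ∀ l, ∃ b : τ → MvPolynomial (Fin K.n) ℂ, ∑ t, b t * u t = f l ∧
        (l ∈ V → b t₀ = 0) := fun l => by
      by_cases hl : l ∈ V
      · obtain ⟨t, ht, hlt⟩ := hV l hl
        refine ⟨Pi.single t 1, ?_, fun _ => Pi.single_eq_of_ne ht.symm 1⟩
        rw [hlt, Finset.sum_eq_single t]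
        · rw [Pi.single_eq_same, one_mul]
        · intro t' _ ht'
          rw [Pi.single_eq_of_ne ht', zero_mul]
        · simp
      · obtain ⟨b, hb⟩ := Ideal.mem_span_range_iff_exists_fun.mp
          (hspan ▸ h.ker_aug ▸ Ideal.subset_span (Set.mem_range_self l) :
            f l ∈ Ideal.span (Set.range u))
        exact ⟨b, hb, fun h => absurd h hl⟩
    choose b hb hb0 using hb
    have h2 : ∑ l, a l * f l = ∑ t, (∑ l, a l * b l t) * u t := by
      simp only [Finset.sum_mul]
      rw [Finset.sum_comm]
      refine Finset.sum_congr rfl fun l _ => ?_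
      rw [← hb l, Finset.mul_sum]
      exact Finset.sum_congr rfl fun t _ => (mul_assoc _ _ _).symm
    have h3 := hrel (fun t => (if t = t₀ then 1 else 0) - ∑ l, a l * b l t) (by
        simp only [sub_mul, Finset.sum_sub_distrib, ite_mul, one_mul, zero_mul]
        rw [← h2, Finset.sum_ite_eq' Finset.univ t₀, if_pos (Finset.mem_univ _), ha, sub_self]) t₀
    rw [if_pos rfl, map_sub, map_one, map_sum, Finset.sum_eq_zero, sub_zero] at h3
    · exact one_ne_zero h3
    · intro l _
      rw [map_mul]
      by_cases hl : l ∈ V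
      · rw [hb0 l hl, map_zero, mul_zero]
      · rw [hcon l hl, zero_mul]
  refine ⟨i, hi, ?_⟩
  -- A homogeneous polynomial with a constant term is constant, so the new relation contains a
  -- nonzero multiple of `f i` and can replace it.
  have hC : a i = C (constantCoeff (a i)) := by
    by_cases hl : d i ≤ D
    · have h1 : (a i).IsWeightedHomogeneous K.wt (D - d i) := by
        simp only [a, if_pos hl]
        exact weightedHomogeneousComponent_isWeightedHomogeneous _ _
      exact (eq_C_of_constantCoeff_ne_zero K.wt_pos h1 hai).2
    · simp only [a, if_neg hl, map_zero]
  have h1 := h.replace_relation hai hC hw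
  rwa [ha] at h1

theorem IsTransform.constantCoeff_eq_zero_of_relation [GradedAlgebra 𝒜] [Nontrivial A]
    (h : K.IsTransform f aug) {a : Fin K.m → MvPolynomial (Fin K.n) ℂ} (ha : ∑ i, a i * f i = 0)
    (i : Fin K.m) : constantCoeff (a i) = 0 :=
  h.isResolution.constantCoeff_eq_zero_of_relation (a := a) ha i

/-- A minimal generating set of the kernel consists of relations, after a change of relations. -/
theorem IsTransform.exists_relations [GradedAlgebra 𝒜] [Nontrivial A] (h : K.IsTransform f aug)
    {τ : Type*} [Fintype τ] {u : τ → MvPolynomial (Fin K.n) ℂ}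
    (hu : ∀ t, ∃ d, (u t).IsWeightedHomogeneous K.wt d)
    (hspan : Ideal.span (Set.range u) = RingHom.ker aug)
    (hrel : ∀ b : τ → MvPolynomial (Fin K.n) ℂ, ∑ t, b t * u t = 0 →
      ∀ t, constantCoeff (b t) = 0) :
    ∃ f', ∃ E : τ ≃ Fin K.m, K.IsTransform f' aug ∧ ∀ t, f' (E t) = u t := by
  classical
  -- A relation outside the image would be a combination of the `u t`, which are themselves among
  -- the relations. Its own coefficient in this syzygy would be `1`, which a Koszul resolution
  -- excludes.
  have hsurj : ∀ (f' : Fin K.m → MvPolynomial (Fin K.n) ℂ) (E : τ → Fin K.m),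
      K.IsTransform f' aug → Function.Injective E → (∀ t, f' (E t) = u t) →
      ∃ f', ∃ E : τ ≃ Fin K.m, K.IsTransform f' aug ∧ ∀ t, f' (E t) = u t := by
    intro f' E h' hE hu'
    refine ⟨f', Equiv.ofBijective E ⟨hE, fun i => ?_⟩, h', hu'⟩
    by_contra hi
    obtain ⟨b, hb⟩ := Ideal.mem_span_range_iff_exists_fun.mp
      (hspan ▸ h'.ker_aug ▸ Ideal.subset_span (Set.mem_range_self i) :
        f' i ∈ Ideal.span (Set.range u))
    have h1 := h'.constantCoeff_eq_zero_of_relation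
      (a := fun l => (if l = i then 1 else 0) - ∑ t, if l = E t then b t else 0) (by
        simp only [sub_mul, Finset.sum_sub_distrib, Finset.sum_mul]
        rw [Finset.sum_comm]
        simp only [ite_mul, one_mul, zero_mul, Finset.sum_ite_eq', Finset.mem_univ, if_true, hu']
        rw [hb, sub_self]) i
    rw [if_pos rfl, Finset.sum_eq_zero fun t _ => if_neg fun h => hi ⟨t, h.symm⟩, sub_zero,
      map_one] at h1
    exact one_ne_zero h1
  rcases isEmpty_or_nonempty τ with hτ | ⟨⟨t₀⟩⟩
  · exact hsurj f hτ.elim h (fun t => hτ.elim t) fun t => hτ.elim t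
  -- The `u t` are exchanged into the relations one by one, keeping those already placed.
  have key : ∀ S : Finset τ, ∃ f', ∃ E : τ → Fin K.m, K.IsTransform f' aug ∧
      Set.InjOn E S ∧ ∀ t ∈ S, f' (E t) = u t := by
    intro S
    induction S using Finset.induction_on with
    | empty =>
      obtain ⟨i, -⟩ := h.exists_replace_relation hu hspan hrel t₀ (V := ∅) (by simp)
      exact ⟨f, fun _ => i, h, by simp, by simp⟩
    | insert t S ht ih =>
      obtain ⟨f', E, h', hE, hS⟩ := ih
      obtain ⟨i, hi, h''⟩ := h'.exists_replace_relation hu hspan hrel t (V := S.image E)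
        fun l hl => by
          obtain ⟨t', ht', rfl⟩ := Finset.mem_image.mp hl
          exact ⟨t', fun h => ht (h ▸ ht'), hS t' ht'⟩
      have hne : ∀ t' ∈ S, t' ≠ t := fun t' ht' h => ht (h ▸ ht')
      have hEi : ∀ t' ∈ S, E t' ≠ i := fun t' ht' h => hi (Finset.mem_image.mpr ⟨t', ht', h⟩)
      refine ⟨_, Function.update E t i, h'', ?_, fun t' ht' => ?_⟩
      · rw [Finset.coe_insert, Set.injOn_insert (by simpa using ht)]
        refine ⟨fun j hj k hk hjk => ?_, ?_⟩
        · rw [Function.update_of_ne (hne j hj), Function.update_of_ne (hne k hk)] at hjk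
          exact hE hj hk hjk
        · rintro ⟨j, hj, hji⟩
          rw [Function.update_of_ne (hne j hj), Function.update_self] at hji
          exact hEi j hj hji
      · rcases Finset.mem_insert.mp ht' with rfl | ht'
        · rw [Function.update_self, if_pos rfl]
        · rw [Function.update_of_ne (hne t' ht'), if_neg (hEi t' ht'), hS t' ht']
  obtain ⟨f', E, h', hE, hS⟩ := key Finset.univ
  exact hsurj f' E h' (fun t t' htt' => hE (by simp) (by simp) htt') fun t => hS t (by simp)

/-- A minimal presentation of an algebra with a Koszul resolution is a Koszul resolution. Its
chiral Koszul complex is a retract of the chiral Koszul complex of any Koszul resolution. -/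
theorem IsResolution.reduction [GradedAlgebra 𝒜] [Nontrivial A]
    (h𝒜 : 𝒜 0 = Submodule.span ℂ {1}) (hK : K.IsResolution) (hM : M.IsMinimal) :
    M.IsResolution ∧ (∃ ι π, IsChiralRetract M.chiral K.chiral ι π) ∧ M.n ≤ K.n ∧
      (M.n = K.n → M.chiral.Isomorphic K.chiral) := by
  classical
  obtain ⟨f, aug, e, h, he, hwt, hX, h0⟩ := hK.exists_transform_variables h𝒜 hM
  have hkill : ∀ i, M.aug (killCompl he (X i)) = aug (X i) := fun i => by
    by_cases hi : i ∈ Set.range e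
    · obtain ⟨j, rfl⟩ := hi
      rw [killCompl_X, hX]
    · rw [killCompl_X_of_notMem he hi, h0 i hi, map_zero]
  have hkill' : ∀ p, M.aug (killCompl he p) = aug p := fun p => congrFun (congrArg DFunLike.coe
    (algHom_ext (f := M.aug.comp (killCompl he)) (g := aug) hkill)) p
  have hMf : ∀ j, M.aug (M.f j) = 0 := fun j =>
    RingHom.mem_ker.mp (hM.ker_aug ▸ Ideal.subset_span (Set.mem_range_self j))
  have haug : ∀ t, aug (stabilization e M.f t) = 0 := by
    rintro (j | k)
    · rw [← hkill', stabilization, Sum.elim_inl, killCompl_rename_app, hMf]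
    · exact h0 k.1 k.2
  have hspan : Ideal.span (Set.range (stabilization e M.f)) = RingHom.ker aug := by
    refine le_antisymm (Ideal.span_le.mpr ?_) fun p hp => mem_span_stabilization he ?_
    · rintro _ ⟨t, rfl⟩
      exact haug t
    · rw [← hM.ker_aug, RingHom.mem_ker, hkill']
      exact hp
  obtain ⟨f', E, h', hE⟩ := h.exists_relations (u := stabilization e M.f) (by
    rintro (j | k)
    · refine ⟨M.fdeg j, algHom_mem (𝒢 := weightedHomogeneousSubmodule ℂ K.wt) (φ := rename e)
        (fun i => ?_) (M.f_homogeneous j)⟩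
      rw [rename_X, ← hwt]
      exact isWeightedHomogeneous_X ℂ K.wt _
    · exact ⟨_, isWeightedHomogeneous_X ℂ K.wt k.1⟩) hspan
    fun b hb => constantCoeff_eq_zero_of_stabilization he
      (fun j => constantCoeff_eq_zero M.aug_mem M.wt_pos (hMf j))
      (fun a ha => hM.constantCoeff_eq_zero_of_relation ha) hb
  obtain ⟨ι, π, hιπ, hiso⟩ := Chiral.exists_isChiralRetract_of_stabilization E he
    (fun j => hE (Sum.inl j)) fun k => hE (Sum.inr k)
  have hn : M.n ≤ K.n := by simpa using Fintype.card_le_of_injective e he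
  refine ⟨?_, Chiral.exists_isChiralRetract_of_isomorphic (Chiral.isDGVertexAlgebra _)
    ⟨ι, π, hιπ⟩ (Chiral.isomorphic_symm h'.isomorphic), hn, fun hMK => ?_⟩
  -- The presentation `M` is a retract of the transformed `K`: the matrices select the relations
  -- coming from `M`, while `killCompl` sends the relations `X k` to zero.
  · have h1 : ∀ j, rename e (M.f j) = ∑ i, (if i = E (Sum.inl j) then 1 else 0) * f' i := fun j => by
      simp [hE, stabilization]
    have h2 : ∀ i, killCompl he (f' i) = ∑ j, (if i = E (Sum.inl j) then 1 else 0) * M.f j := by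
      intro i
      obtain ⟨t, rfl⟩ := E.surjective i
      rw [hE]
      rcases t with j | k
      · simp [stabilization, killCompl_rename_app]
      · simp [stabilization, killCompl_X_of_notMem he k.2]
    have h3 : ∀ j k, ∑ i, killCompl he (if i = E (Sum.inl j) then 1 else 0) *
        (if i = E (Sum.inl k) then 1 else 0) =
          if j = k then (1 : MvPolynomial (Fin M.n) ℂ) else 0 := fun j k => by
      simp [apply_ite (killCompl he), eq_comm]
    have h4 : ∀ j, aug (rename e (X j)) = M.aug (X j) := fun j => by rw [rename_X, hX]
    exact h'.isResolution.of_retract (rename e) (killCompl he)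
      (fun i => killCompl_rename_app he _) _ _ h1 h2 h3 h4 hkill
  -- An injection between sets of equal size is onto, so the stabilization adds no variable.
  · have he' : Function.Surjective e :=
      ((Fintype.bijective_iff_injective_and_card e).mpr ⟨he, by simpa using hMK⟩).2
    exact (hiso he').trans (Chiral.isomorphic_symm h'.isomorphic)

end KoszulPresentation

/-! ## Existence of minimal presentations -/

namespace KoszulPresentation

open MvPolynomial DirectSum WeightedPolynomial

attribute [local instance] MvPolynomial.weightedGradedAlgebra

variable {A : Type*} [CommRing A] [Algebra ℂ A] {𝒜 : ℕ → Submodule ℂ A} [GradedAlgebra 𝒜]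
  {K : KoszulPresentation 𝒜}

/-- The images of the variables of `K` generate `A_>` modulo its square by their linear parts, so
some of them form a minimal set. The kernel of the resulting map is homogeneous in a Noetherian
ring, hence has a finite minimal generating set. -/
theorem exists_isMinimal (hK : Function.Surjective K.aug) : ∃ M : KoszulPresentation 𝒜, M.IsMinimal := by
  obtain ⟨n, a, ha⟩ := GradedGenerators.exists_comp_isMinimalGeneratingSet (𝒢 := 𝒜)
    (I := (HomogeneousIdeal.irrelevant 𝒜).toIdeal) (v := fun i => K.aug (X i))
    (fun i => HomogeneousIdeal.mem_irrelevant_of_mem 𝒜 (K.wt_pos i) (K.aug_mem i))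
    (fun i => ⟨_, K.aug_mem i⟩) fun x hx => by
      obtain ⟨p, rfl⟩ := hK x
      refine ⟨∑ i, constantCoeff (pderiv i p) • K.aug (X i), sum_mem fun i _ =>
        Submodule.smul_mem _ _ (Submodule.subset_span ⟨i, rfl⟩), ?_⟩
      have h1 : algebraMap ℂ A (constantCoeff p) = 0 := by
        rw [GradedGenerators.mem_irrelevant_iff, decompose_map K.aug_mem,
          component_zero K.wt_pos] at hx
        exact (K.aug.commutes _).symm.trans hx
      have h2 := sub_linear_mem K.aug_mem K.wt_pos p
      rwa [h1, sub_zero] at h2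
  let φ : MvPolynomial (Fin n) ℂ →ₐ[ℂ] A := aeval fun i => K.aug (X (a i))
  have hφX : ∀ i, φ (X i) = K.aug (X (a i)) := fun i => aeval_X _ i
  have hφ : ∀ i, φ (X i) ∈ 𝒜 (K.wt (a i)) := fun i => hφX i ▸ K.aug_mem (a i)
  obtain ⟨m, f, hf⟩ := GradedGenerators.exists_isMinimalGeneratingSet
    (degree_zero fun i => K.wt_pos (a i)) (isHomogeneous_ker (wt := fun i => K.wt (a i)) hφ)
  choose d hd using hf.homogeneous
  refine ⟨⟨n, m, fun i => K.wt (a i), fun i => K.wt_pos (a i), f, d, hd, φ, hφ⟩, ?_, hf⟩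
  simpa only [hφX] using ha

end KoszulPresentation

end

/-! ### The main theorem -/

theorem mainTheorem5 {A : Type*} [CommRing A] [Algebra ℂ A] [Nontrivial A]
    (𝒜 : ℕ → Submodule ℂ A) [GradedAlgebra 𝒜] (h𝒜 : 𝒜 0 = Submodule.span ℂ {1})
    (K L : KoszulPresentation 𝒜) (hK : K.IsResolution) (hL : L.IsResolution) :
    (∃ (vK : K.chiral.IsDGVertexAlgebra) (vL : L.chiral.IsDGVertexAlgebra),
      DGVertexAlgebra.QuasiIsomorphic ⟨K.chiral, vK⟩ ⟨L.chiral, vL⟩) ∧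
    (∃ M : KoszulPresentation 𝒜, M.IsMinimal ∧ M.IsResolution) ∧
    (∀ M : KoszulPresentation 𝒜, M.IsMinimal →
      M.chiral.IsDGVertexAlgebra ∧
      (∃ ι π, IsChiralRetract M.chiral K.chiral ι π) ∧
      (∃ ι π, IsChiralRetract M.chiral L.chiral ι π)) ∧
    (∀ M M' : KoszulPresentation 𝒜, M.IsMinimal → M'.IsMinimal →
      M.chiral.Isomorphic M'.chiral) := by
  obtain ⟨M, hM⟩ := KoszulPresentation.exists_isMinimal hK.aug_surjective
  refine ⟨⟨Chiral.isDGVertexAlgebra _, Chiral.isDGVertexAlgebra _, ?_⟩,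
    ⟨M, hM, (hK.reduction h𝒜 hM).1⟩, fun M hM => ⟨Chiral.isDGVertexAlgebra _,
      (hK.reduction h𝒜 hM).2.1, (hL.reduction h𝒜 hM).2.1⟩, fun M M' hM hM' => ?_⟩
  -- The zigzag passes through the minimal complex, which maps quasi-isomorphically to both.
  · obtain ⟨ι, π, h⟩ := (hK.reduction h𝒜 hM).2.1
    obtain ⟨ι', π', h'⟩ := (hL.reduction h𝒜 hM).2.1
    exact (Relation.EqvGen.symm ⟨M.chiral, Chiral.isDGVertexAlgebra _⟩ _
      (.rel _ _ ⟨ι, h.isHom, h.ι_quasiIso⟩)).trans _ _ _ (.rel _ _ ⟨ι', h'.isHom, h'.ι_quasiIso⟩)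
  -- Both minimal presentations are resolutions, so each reduces to the other. The two inequalities
  -- give equal numbers of variables, and the reduction is then an isomorphism.
  · have h1 := (hK.reduction h𝒜 hM).1.reduction h𝒜 hM'
    have h2 := (hK.reduction h𝒜 hM').1.reduction h𝒜 hM
    exact h2.2.2.2 (le_antisymm h2.2.2.1 h1.2.2.1)
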